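/- Consider the Vlasov--Navier--Stokes system on $\mathbb R^3\times\mathbb R^3$, $$\partial_t f+v\cdot\nabla_x f+\operatorname{div}_v[f(u-v)]=0,\qquad \partial_t u+u\cdot\nabla u-\Delta u+\nabla \mathrm{p}=j_f-\rho_f u,\qquad \operatorname{div}u=0,$$ with $\rho_f(t,x)=\int_{\mathbb R^3} f(t,x,v)\,dv$ and $j_f(t,x)=\int_{\mathbb R^3} v f(t,x,v)\,dv$. Put $$E(t)=\tfrac12\int|u(t)|^2dx+\tfrac12\iint f(t)|v|^2dv\,dx,\qquad D(t)=\iint f(t)|u(t)-v|^2dv\,dx+\int|\nabla u(t)|^2dx .$$ An initial condition $(u_0,f_0)$ is admissible if $u_0\in L^2(\mathbb R^3)$ with $\operatorname{div}u_0=0$, $0\le f_0\in L^1\cap L^\infty(\mathbb R^3\times\mathbb R^3)$, $f_0|v|^2\in L^1$ and $\iint f_0\,dv\,dx=1$. A global weak solution with this initial condition is a pair $(u,f)$ with $u\in L^\infty_{\rm loc}(\mathbb R_+;L^2)\cap L^2_{\rm loc}(\mathbb R_+;H^1_{\rm div})$, $0\le f\in L^\infty_{\rm loc}(\mathbb R_+;L^1\cap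 L^\infty)$, $j_f-\rho_fu\in L^2_{\rm loc}(\mathbb R_+;H^{-1})$ and $\iint f\,dv\,dx=1$, such that $u$ is a Leray solution (a weak solution, weakly continuous in time with values in $L^2$) of the Navier--Stokes equations with $u|_{t=0}=u_0$, $f$ is a renormalized solution of the Vlasov equation with $f|_{t=0}=f_0$, and $E(t)+\int_s^tD(\sigma)\,d\sigma\le E(s)$ for almost every $s\ge0$ (including $s=0$) and all $t\ge s$. For $p\ge 2$ let $$D_p(t)=\iint_{\mathbb R^3\times\mathbb R^3} f(t,x,v)|v-u(t,x)|^p\,dv\,dx,\qquad m_p(t,x)=\int_{\mathbb R^3} f(t,x,v)|v|^p\,dv .$$ For all $p\ge2$, $\gamma\in\mathbb R$ and $k\in\mathbb N=\{0,1,2,\dots\}$ there is a constant $C=C(p,\gamma,k)$ such that, for every admissible initial condition $(u_0,f_0)$, every global weak solution $(u,f)$ with this initial condition and every $t\ge0$, $$\begin{aligned}\int_0^tD_p(s)(1+s)^{p\gamma}\,ds\le C\Big(&\int_0^tD_p(s)(1+s)^{p\gamma-k}\,ds+\|\rho_f\|_{L^\infty(0,t;L^\infty(\mathbb R^3))}\,\|(1+s)^\gamma\partial_su\|^p_{L^p(0,t;L^p(\mathbb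 R^3))}\\&+\|(1+s)^\gamma|\nabla_xu|\,m_p^{1/p}\|^p_{L^p(0,t;L^p(\mathbb R^3))}+\iint_{\mathbb R^3\times\mathbb R^3} f_0|v-u_0|^p\,dv\,dx\Big),\end{aligned}$$ as an inequality in $[0,+\infty]$, where the norm of $\partial_su$ is $+\infty$ if this distributional derivative is not in $L^p$. -/

import Mathlib

open MeasureTheory Set
open scoped ENNReal NNReal ContDiff

noncomputable section

namespace VNS

/-- Euclidean space `ℝ³`. -/
abbrev E3 : Type := EuclideanSpace ℝ (Fin 3)

/-- The `i`-th vector of the canonical basis of `ℝ³`. -/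
def e (i : Fin 3) : E3 := EuclideanSpace.single i 1

/-- The Euclidean (Frobenius) norm `|∇u|` of a Jacobian matrix. -/
def gradNorm (G : E3 →L[ℝ] E3) : ℝ := Real.sqrt (∑ i, ‖G (e i)‖ ^ 2)

/-- Smooth compactly supported functions. -/
def IsTest {X Y : Type*} [NormedAddCommGroup X] [NormedSpace ℝ X]
    [NormedAddCommGroup Y] [NormedSpace ℝ Y] (φ : X → Y) : Prop :=
  ContDiff ℝ ∞ φ ∧ HasCompactSupport φ

/-- `div w = 0` in the sense of distributions on `ℝ³`. -/
def IsWeaklyDivFree (w : E3 → E3) : Prop :=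
  ∀ φ : E3 → ℝ, IsTest φ → ∫ x, fderiv ℝ φ x (w x) = 0

/-- `G` is the weak Jacobian of `w` on `ℝ³`: `G x h` is the derivative of `w` in direction `h`. -/
def HasWeakGradient (w : E3 → E3) (G : E3 → E3 →L[ℝ] E3) : Prop :=
  LocallyIntegrable w ∧ LocallyIntegrable G ∧
    ∀ φ : E3 → ℝ, IsTest φ → ∀ h : E3,
      ∫ x, (fderiv ℝ φ x h) • w x = - ∫ x, φ x • G x h

/-- `w` is the weak time derivative of `u` on `(0,t) × ℝ³`. -/
def HasWeakTimeDeriv (u : ℝ → E3 → E3) (t : ℝ) (w : ℝ × E3 → E3) : Prop :=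
  LocallyIntegrableOn w (Ioo 0 t ×ˢ univ) ∧
    ∀ φ : ℝ × E3 → ℝ, IsTest φ → tsupport φ ⊆ Ioo 0 t ×ˢ univ →
      ∫ z, (fderiv ℝ φ z (1, 0)) • u z.1 z.2 = - ∫ z, φ z • w z

/-- Lebesgue measure on `(0,t) × ℝ³`. -/
def slab (t : ℝ) : Measure (ℝ × E3) := (volume.restrict (Ioo 0 t)).prod volume

/-- `ρ_f(t,x) = ∫ f(t,x,v) dv`. -/
def density (f : ℝ → E3 × E3 → ℝ) (t : ℝ) (x : E3) : ℝ := ∫ v, f t (x, v)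

/-- `j_f(t,x) = ∫ v f(t,x,v) dv`. -/
def momentum (f : ℝ → E3 × E3 → ℝ) (t : ℝ) (x : E3) : E3 := ∫ v, f t (x, v) • v

/-- The Brinkman force `j_f - ρ_f u`. -/
def brinkman (u : ℝ → E3 → E3) (f : ℝ → E3 × E3 → ℝ) (t : ℝ) (x : E3) : E3 :=
  momentum f t x - density f t x • u t x

/-- `m_p(t,x) = ∫ f(t,x,v) |v|^p dv`, possibly infinite. -/
def moment (p : ℝ) (f : ℝ → E3 × E3 → ℝ) (t : ℝ) (x : E3) : ℝ≥0∞ :=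
  ∫⁻ v, ENNReal.ofReal (f t (x, v) * ‖v‖ ^ p)

/-- The energy `E(t)`. -/
def energy (u : ℝ → E3 → E3) (f : ℝ → E3 × E3 → ℝ) (t : ℝ) : ℝ≥0∞ :=
  ((∫⁻ x, ENNReal.ofReal (‖u t x‖ ^ 2)) +
    ∫⁻ z : E3 × E3, ENNReal.ofReal (f t z * ‖z.2‖ ^ 2)) / 2

/-- The dissipation `D(t)`; `Du` is the spatial Jacobian of `u`. -/
def dissipation (u : ℝ → E3 → E3) (Du : ℝ → E3 → E3 →L[ℝ] E3) (f : ℝ → E3 × E3 → ℝ)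
    (t : ℝ) : ℝ≥0∞ :=
  (∫⁻ z : E3 × E3, ENNReal.ofReal (f t z * ‖u t z.1 - z.2‖ ^ 2)) +
    ∫⁻ x, ENNReal.ofReal (gradNorm (Du t x) ^ 2)

/-- `∬ g(x,v) |v - w(x)|^p dv dx`. -/
def relMoment (p : ℝ) (w : E3 → E3) (g : E3 × E3 → ℝ) : ℝ≥0∞ :=
  ∫⁻ z : E3 × E3, ENNReal.ofReal (g z * ‖z.2 - w z.1‖ ^ p)

/-- The higher fluid-kinetic dissipation `D_p(t)`. -/
def higherDissipation (p : ℝ) (u : ℝ → E3 → E3) (f : ℝ → E3 × E3 → ℝ) (t : ℝ) : ℝ≥0∞ :=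
  relMoment p (u t) (f t)

/-- Admissible initial conditions. -/
structure IsAdmissible (u₀ : E3 → E3) (f₀ : E3 × E3 → ℝ) : Prop where
  u_mem : MemLp u₀ 2
  u_div : IsWeaklyDivFree u₀
  f_nonneg : ∀ᵐ z, 0 ≤ f₀ z
  f_mem_one : MemLp f₀ 1
  f_mem_top : MemLp f₀ ⊤
  f_moment : Integrable (fun z : E3 × E3 => f₀ z * ‖z.2‖ ^ 2)
  f_mass : ∫ z, f₀ z = 1

/-- Renormalized solutions of `∂ₜf + v·∇ₓf + div_v[f(u - v)] = 0`, `f(0) = f₀`: for every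
admissible `β`, the equation
`∂ₜβ(f) + div_x[v β(f)] + div_v[(u - v) β(f)] + 3 (β(f) - f β'(f)) = 0`, `β(f)(0) = β(f₀)`,
holds in the sense of distributions on `[0,∞) × ℝ³ × ℝ³`. -/
def IsRenormalizedVlasov (f₀ : E3 × E3 → ℝ) (u : ℝ → E3 → E3) (f : ℝ → E3 × E3 → ℝ) : Prop :=
  ∀ β : ℝ → ℝ, ContDiff ℝ 1 β → (∃ K, ∀ r, |β r| ≤ K ∧ (1 + |r|) * |deriv β r| ≤ K) →
    ∀ φ : ℝ × E3 × E3 → ℝ, IsTest φ →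
      (∫ t in Ici (0 : ℝ), ∫ z : E3 × E3,
          (β (f t z) * fderiv ℝ φ (t, z) (1, z.2, u t z.1 - z.2)
            - 3 * (β (f t z) - f t z * deriv β (f t z)) * φ (t, z)))
        + ∫ z : E3 × E3, β (f₀ z) * φ (0, z) = 0

/-- Weak form of `∂ₜu + u·∇u - Δu + ∇p = j_f - ρ_f u`, `u(0) = u₀`, tested against
divergence-free fields on `[0,∞) × ℝ³`. -/
def IsWeakNavierStokes (u₀ : E3 → E3) (u : ℝ → E3 → E3) (Du : ℝ → E3 → E3 →L[ℝ] E3)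
    (f : ℝ → E3 × E3 → ℝ) : Prop :=
  ∀ φ : ℝ × E3 → E3, IsTest φ → (∀ z, ∑ i, (fderiv ℝ φ z (0, e i)) i = 0) →
    (∫ t in Ici (0 : ℝ), ∫ x,
        (inner ℝ (u t x) (fderiv ℝ φ (t, x) (1, 0))
          + inner ℝ (u t x) (fderiv ℝ φ (t, x) (0, u t x))
          - ∑ i, inner ℝ (Du t x (e i)) (fderiv ℝ φ (t, x) (0, e i))
          + inner ℝ (brinkman u f t x) (φ (t, x))))
      + ∫ x, inner ℝ (u₀ x) (φ (0, x)) = 0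

/-- Global weak solutions `(u,f)` of the Vlasov-Navier-Stokes system on `ℝ³ × ℝ³` with initial
condition `(u₀,f₀)`; `Du` is the weak spatial Jacobian of `u`. Only times `t ≥ 0` matter. -/
structure IsGlobalWeakSolution (u₀ : E3 → E3) (f₀ : E3 × E3 → ℝ) (u : ℝ → E3 → E3)
    (Du : ℝ → E3 → E3 →L[ℝ] E3) (f : ℝ → E3 × E3 → ℝ) : Prop where
  u_meas : AEStronglyMeasurable (fun z : ℝ × E3 => u z.1 z.2)
    ((volume.restrict (Ici (0 : ℝ))).prod volume)
  Du_meas : AEStronglyMeasurable (fun z : ℝ × E3 => Du z.1 z.2)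
    ((volume.restrict (Ici (0 : ℝ))).prod volume)
  f_meas : AEStronglyMeasurable (fun z : ℝ × E3 × E3 => f z.1 z.2)
    ((volume.restrict (Ici (0 : ℝ))).prod volume)
  f_slice_meas : ∀ t, 0 ≤ t → AEStronglyMeasurable (f t) volume
  /- `u ∈ L^∞_loc(ℝ₊; L²) ∩ L²_loc(ℝ₊; H¹_div)` -/
  u_bdd : ∀ T : ℝ, ∃ K : ℝ≥0, ∀ᵐ t ∂(volume.restrict (Icc 0 T)), eLpNorm (u t) 2 volume ≤ K
  u_grad : ∀ᵐ t ∂(volume.restrict (Ici (0 : ℝ))), HasWeakGradient (u t) (Du t)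
  u_div : ∀ᵐ t ∂(volume.restrict (Ici (0 : ℝ))), IsWeaklyDivFree (u t)
  Du_sq : ∀ T : ℝ, ∫⁻ t in Icc 0 T, ∫⁻ x, ENNReal.ofReal (gradNorm (Du t x) ^ 2) < ⊤
  /- `0 ≤ f ∈ L^∞_loc(ℝ₊; L¹ ∩ L^∞)`, of total mass one -/
  f_nonneg : ∀ t, 0 ≤ t → ∀ᵐ z, 0 ≤ f t z
  f_bdd : ∀ T : ℝ, ∃ K : ℝ≥0, ∀ᵐ t ∂(volume.restrict (Icc 0 T)),
    eLpNorm (f t) 1 volume ≤ K ∧ eLpNorm (f t) ⊤ volume ≤ K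
  f_mass : ∀ᵐ t ∂(volume.restrict (Ici (0 : ℝ))), ∫ z, f t z = 1
  /- `j_f - ρ_f u ∈ L²_loc(ℝ₊; H⁻¹)`, with `H⁻¹` the dual of `H¹` -/
  brinkman_dual : ∀ T : ℝ, ∃ g : ℝ → ℝ, MemLp g 2 (volume.restrict (Icc 0 T)) ∧
    ∀ᵐ t ∂(volume.restrict (Icc 0 T)), LocallyIntegrable (brinkman u f t) ∧
      ∀ φ : E3 → E3, IsTest φ →
        |∫ x, inner ℝ (brinkman u f t x) (φ x)| ≤
          g t * Real.sqrt ((∫ x, ‖φ x‖ ^ 2) + ∫ x, gradNorm (fderiv ℝ φ x) ^ 2)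
  /- `u` is a Leray solution: weakly continuous in time with values in `L²` -/
  u_mem : ∀ t, 0 ≤ t → MemLp (u t) 2
  u_cont : ∀ φ : E3 → E3, MemLp φ 2 →
    ContinuousOn (fun t => ∫ x, inner ℝ (u t x) (φ x)) (Ici 0)
  u_init : u 0 =ᵐ[volume] u₀
  navierStokes : IsWeakNavierStokes u₀ u Du f
  /- `f` is a renormalized solution of the Vlasov equation -/
  f_init : f 0 =ᵐ[volume] f₀
  vlasov : IsRenormalizedVlasov f₀ u f
  /- energy inequality from `s = 0` and from almost every `s ≥ 0` -/
  energy_zero : ∀ t, 0 ≤ t →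
    energy u f t + ∫⁻ σ in Icc 0 t, dissipation u Du f σ ≤ energy u f 0
  energy_ae : ∀ᵐ s ∂(volume.restrict (Ici (0 : ℝ))), ∀ t, s ≤ t →
    energy u f t + ∫⁻ σ in Icc s t, dissipation u Du f σ ≤ energy u f s

/-- `‖(1+s)^γ ∂ₛu‖_{L^p(0,t;L^p)}`. The weak time derivative is unique up to null sets, so the
infimum is the norm of that derivative; it is `∞` if the distributional derivative of `u`
is not a function. -/
def timeDerivNorm (p γ t : ℝ) (u : ℝ → E3 → E3) : ℝ≥0∞ :=
  ⨅ (w : ℝ × E3 → E3) (_ : HasWeakTimeDeriv u t w),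
    eLpNorm (fun z : ℝ × E3 => ((1 + z.1) ^ γ : ℝ) • w z) (ENNReal.ofReal p) (slab t)

/-- `‖(1+s)^γ |∇ₓu| m_p^{1/p}‖_{L^p(0,t;L^p)}`. -/
def gradMomentNorm (p γ t : ℝ) (Du : ℝ → E3 → E3 →L[ℝ] E3) (f : ℝ → E3 × E3 → ℝ) : ℝ≥0∞ :=
  eLpNorm (fun z : ℝ × E3 =>
    ENNReal.ofReal ((1 + z.1) ^ γ * gradNorm (Du z.1 z.2)) * moment p f z.1 z.2 ^ (1 / p))
    (ENNReal.ofReal p) (slab t)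

/-- `‖ρ_f‖_{L^∞(0,t;L^∞)}`. -/
def densityNorm (t : ℝ) (f : ℝ → E3 × E3 → ℝ) : ℝ≥0∞ :=
  eLpNorm (fun z : ℝ × E3 => density f z.1 z.2) ⊤ (slab t)

/-- `∫₀ᵗ D_p(s) (1+s)^a ds`. -/
def weightedDissipation (p a t : ℝ) (u : ℝ → E3 → E3) (f : ℝ → E3 × E3 → ℝ) : ℝ≥0∞ :=
  ∫⁻ s in Ioo 0 t, higherDissipation p u f s * ENNReal.ofReal ((1 + s) ^ a)

end VNS

end

/-! Along the characteristics `x' = v`, `v' = u - v` of the Vlasov equation, the relative velocity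
`ξ = v - u` satisfies `d/ds |ξ|^p = -p |ξ|^p - p |ξ|^(p-2) ξ · (∂ₛu + (v·∇)u)`. Integrated against
`f` with the weight `(1+s)^(pγ)`, this is a balance law whose damping term is `p` times the
left-hand side of the estimate. Young's inequality bounds the cross terms by a small multiple of
`|ξ|^p` plus `|∂ₛu|^p` and `(|∇u| |v|)^p`; integrating these in `v` against `f` produces `ρ_f
|∂ₛu|^p` and `|∇u|^p m_p`. The derivative of the weight has lost one power of `1+s`: for large `s`
it is a small multiple of the weight, and for bounded `s` it is comparable with `(1+s)^(pγ-k)`.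
Since `p ≥ 2`, all small multiples are absorbed by the damping (`moment_integrand_le`,
`weighted_moment_le`). Absorption needs a finite left-hand side. This comes for free: if the
right-hand side is finite, so is the integral with weight `(1+s)^(pγ-k)`, and on a bounded time
interval all weights are comparable.

What remains is to justify the balance law for weak solutions.

As `f` is bounded, a renormalization equal to the identity on its range turns the renormalized
equation into the weak one (`weak_vlasov`).

The test function depends on `u`, which is only weakly differentiable. It is mollified in space-time
inside the test function only; the drift keeps the original `u`, so no commutator appears, and
boundedness of `f` reduces the limit to `L¹` convergence of the mollified derivatives
(`transport_identity`). The kernels look only at later times, so differentiation commutes with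
mollification down to `s = 0`. The initial term needs a strong trace: weak continuity in time and a
locally integrable `∂ₛu` make `u` a primitive of `∂ₛu`, hence strongly continuous at `0` in `L¹` on
balls (`ae_sub_eq_integral`, `tendsto_mollified_initial`).

Finally `|ξ|^p` is reached from compactly supported test functions. The cutoffs in `x`, `v` and `ξ`
share one scale `N`, so every factor `1/N` from a gradient meets a velocity of size at most `2N`;
all cutoff errors are dominated by `f (1 + |ξ|^p)` (`abs_fderiv_productTest_le`, `moment_identity`).
-/

noncomputable section

namespace VNS
open Filter Topology Convolution

/-! ### Mollification: `L¹` convergence and commutation with weak derivatives -/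

section Mollify
variable {X F : Type*} [NormedAddCommGroup X] [NormedSpace ℝ X] [FiniteDimensional ℝ X]
  [MeasurableSpace X] [BorelSpace X] [NormedAddCommGroup F] [NormedSpace ℝ F]
  {μ : Measure X} [μ.IsAddHaarMeasure]

/-- Translations act continuously on `L¹`. -/
theorem exists_forall_lintegral_enorm_translate_sub_le {g : X → F} (hg : Integrable g μ)
    {ε : ℝ≥0∞} (hε : 0 < ε) :
    ∃ δ > 0, ∀ y : X, ‖y‖ ≤ δ → ∫⁻ z, ‖g (z - y) - g z‖ₑ ∂μ ≤ ε := by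
  have : Fact ((1 : ℝ≥0∞) ≠ ⊤) := ⟨ENNReal.one_ne_top⟩
  have hg1 : MemLp g 1 μ := memLp_one_iff_integrable.2 hg
  set G : Lp F 1 μ := hg1.toLp g
  -- The domain action on `Lp` is precomposition with a translation; acting by `-y` gives `z ↦ g (z
  -- - y)`, and joint continuity of this action is the whole content.
  have hc : Continuous fun y : X => (DomAddAct.mk (-y) : Xᵈᵃᵃ) +ᵥ G :=
    (continuous_vadd (M := Xᵈᵃᵃ) (X := Lp F 1 μ)).comp
      ((DomAddAct.continuous_mk.comp continuous_neg).prodMk continuous_const)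
  have hev : ∀ᶠ y : X in 𝓝 (0 : X), edist ((DomAddAct.mk (-y) : Xᵈᵃᵃ) +ᵥ G) G ≤ ε := by
    have h0 := hc.tendsto 0
    simp only [neg_zero, DomAddAct.mk_zero, zero_vadd] at h0
    filter_upwards [h0.eventually (Metric.eball_mem_nhds G hε)] with y hy
    exact le_of_lt hy
  obtain ⟨δ, hδ, hb⟩ := Metric.eventually_nhds_iff_ball.1 hev
  refine ⟨δ / 2, by positivity, fun y hy => ?_⟩
  have h1 := hb y (by simp; linarith)
  refine le_trans (le_of_eq ?_) h1
  rw [DomAddAct.mk_vadd_toLp, Lp.edist_toLp_toLp, eLpNorm_one_eq_lintegral_enorm]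
  refine lintegral_congr fun z => ?_
  simp [sub_eq_neg_add, add_comm]

/-- A smooth compactly supported probability density. -/
structure IsMollifier (κ : X → ℝ) (μ : Measure X) : Prop where
  smooth : ContDiff ℝ ∞ κ
  compact : HasCompactSupport κ
  nonneg : ∀ y, 0 ≤ κ y
  integral_eq : ∫ y, κ y ∂μ = 1

variable {κ : X → ℝ}

theorem IsMollifier.lintegral_eq (h : IsMollifier κ μ) : ∫⁻ y, ENNReal.ofReal (κ y) ∂μ = 1 := by
  rw [← ofReal_integral_eq_lintegral_ofReal
    (h.smooth.continuous.integrable_of_hasCompactSupport h.compact) (ae_of_all _ h.nonneg),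
    h.integral_eq, ENNReal.ofReal_one]

theorem IsMollifier.integrable_smul (h : IsMollifier κ μ) {g : X → F}
    (hg : LocallyIntegrable g μ) (z : X) : Integrable (fun y => κ y • g (z - y)) μ :=
  HasCompactSupport.convolutionExists_left (L := ContinuousLinearMap.lsmul ℝ ℝ) h.compact
    h.smooth.continuous hg z

/-- Convolution with a probability density moves a function by at most the mean translation
error. -/
theorem IsMollifier.enorm_convolution_sub_le [CompleteSpace F] (h : IsMollifier κ μ) {g : X → F}
    (hg : LocallyIntegrable g μ) (z : X) (c : F) :
    ‖(κ ⋆[ContinuousLinearMap.lsmul ℝ ℝ, μ] g) z - c‖ₑ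
      ≤ ∫⁻ y, ENNReal.ofReal (κ y) * ‖g (z - y) - c‖ₑ ∂μ := by
  have hi := h.integrable_smul hg z
  have hk : Integrable κ μ := h.smooth.continuous.integrable_of_hasCompactSupport h.compact
  have e1 : (κ ⋆[ContinuousLinearMap.lsmul ℝ ℝ, μ] g) z - c
      = ∫ y, κ y • (g (z - y) - c) ∂μ := by
    simp_rw [smul_sub]
    rw [integral_sub hi (hk.smul_const c), integral_smul_const, h.integral_eq, one_smul]
    simp [convolution_def]
  rw [e1]
  refine (enorm_integral_le_lintegral_enorm _).trans (le_of_eq (lintegral_congr fun y => ?_))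
  rw [enorm_smul, Real.enorm_eq_ofReal (h.nonneg y)]

/-- Mollification converges in `L¹`. -/
theorem tendsto_lintegral_convolution_sub [CompleteSpace F] {κ : ℕ → X → ℝ} {r : ℕ → ℝ}
    (hκ : ∀ n, IsMollifier (κ n) μ) (hr : Tendsto r atTop (𝓝 0))
    (hs : ∀ n y, κ n y ≠ 0 → ‖y‖ ≤ r n) {g : X → F} (hg : Integrable g μ) :
    Tendsto (fun n => ∫⁻ z, ‖((κ n) ⋆[ContinuousLinearMap.lsmul ℝ ℝ, μ] g) z - g z‖ₑ ∂μ)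
      atTop (𝓝 0) := by
  rw [ENNReal.tendsto_nhds_zero]
  intro ε hε
  obtain ⟨δ, hδ, hb⟩ := exists_forall_lintegral_enorm_translate_sub_le hg hε
  filter_upwards [hr.eventually (ge_mem_nhds hδ)] with n hn
  have hm : AEMeasurable (fun q : X × X => ENNReal.ofReal (κ n q.2) * ‖g (q.1 - q.2) - g q.1‖ₑ)
      (μ.prod μ) := by
    have h1 : AEStronglyMeasurable (fun q : X × X => g (q.1 - q.2)) (μ.prod μ) :=
      hg.1.comp_quasiMeasurePreserving (quasiMeasurePreserving_sub_of_right_invariant μ μ)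
    have h2 : AEStronglyMeasurable (fun q : X × X => g q.1) (μ.prod μ) := hg.1.comp_fst
    exact (((hκ n).smooth.continuous.measurable.comp measurable_snd).ennreal_ofReal.aemeasurable).mul
      (h1.sub h2).enorm
  calc ∫⁻ z, ‖((κ n) ⋆[ContinuousLinearMap.lsmul ℝ ℝ, μ] g) z - g z‖ₑ ∂μ
      ≤ ∫⁻ z, ∫⁻ y, ENNReal.ofReal (κ n y) * ‖g (z - y) - g z‖ₑ ∂μ ∂μ :=
        lintegral_mono fun z => (hκ n).enorm_convolution_sub_le hg.locallyIntegrable z _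
    _ = ∫⁻ y, ∫⁻ z, ENNReal.ofReal (κ n y) * ‖g (z - y) - g z‖ₑ ∂μ ∂μ :=
        lintegral_lintegral_swap hm
    _ = ∫⁻ y, ENNReal.ofReal (κ n y) * ∫⁻ z, ‖g (z - y) - g z‖ₑ ∂μ ∂μ :=
        lintegral_congr fun y => lintegral_const_mul' _ _ ENNReal.ofReal_ne_top
    _ ≤ ∫⁻ y, ENNReal.ofReal (κ n y) * ε ∂μ := by
        refine lintegral_mono fun y => ?_
        by_cases hy : κ n y = 0
        · simp [hy]
        · gcongr
          exact hb y ((hs n y hy).trans hn)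
    _ = ε := by
        rw [lintegral_mul_const _ (hκ n).smooth.continuous.measurable.ennreal_ofReal,
          (hκ n).lintegral_eq, one_mul]

/-- The derivative of a mollified function is the mollified weak derivative. -/
theorem IsMollifier.fderiv_convolution [CompleteSpace F] (h : IsMollifier κ μ) {U : X → F}
    {D : X → X →L[ℝ] F} (hU : LocallyIntegrable U μ) (hD : LocallyIntegrable D μ) (z : X)
    (hz : ∀ a : X, ∫ y, fderiv ℝ (fun y => κ (z - y)) y a • U y ∂μ = -∫ y, κ (z - y) • D y a ∂μ) :
    fderiv ℝ (κ ⋆[ContinuousLinearMap.lsmul ℝ ℝ, μ] U) z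
      = (κ ⋆[ContinuousLinearMap.lsmul ℝ ℝ, μ] D) z := by
  have hk1 : ContDiff ℝ 1 κ := h.smooth.of_le (by exact_mod_cast le_top)
  have hd := h.compact.hasFDerivAt_convolution_left (ContinuousLinearMap.lsmul ℝ ℝ) hk1 hU z
  rw [hd.fderiv]
  ext1 a
  have i1 : Integrable (fun y => ((ContinuousLinearMap.lsmul ℝ ℝ).precompL X)
      (fderiv ℝ κ (z - y)) (U y)) μ :=
    ((h.compact.fderiv ℝ).convolutionExists_left
      (L := (ContinuousLinearMap.lsmul ℝ ℝ : ℝ →L[ℝ] F →L[ℝ] F).precompL X)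
      (hk1.continuous_fderiv one_ne_zero) hU z).integrable_swap
  have i2 : Integrable (fun y => κ (z - y) • D y) μ :=
    (h.compact.convolutionExists_left (L := ContinuousLinearMap.lsmul ℝ ℝ)
      h.smooth.continuous hD z).integrable_swap
  rw [convolution_eq_swap, convolution_lsmul_swap, ContinuousLinearMap.integral_apply i1,
    ContinuousLinearMap.integral_apply i2]
  -- Reflecting the kernel costs a sign, which cancels the sign in the definition of the weak
  -- derivative. Only this one reflected kernel is ever tested, so the weak identity is needed only
  -- where it fits.
  have e : ∀ y, fderiv ℝ (fun y => κ (z - y)) y a = - fderiv ℝ κ (z - y) a := fun y => by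
    have := ((hk1.differentiable one_ne_zero).differentiableAt.hasFDerivAt
      (x := z - y)).comp y ((hasFDerivAt_id y).const_sub z)
    have h2 : fderiv ℝ (fun y => κ (z - y)) y = _ := this.fderiv
    rw [h2]; simp
  have := hz a
  simp_rw [e, neg_smul, integral_neg, neg_inj] at this
  simpa [ContinuousLinearMap.precompL_apply] using this

end Mollify

/-- Mollifiers on space-time that look only at later times. -/
theorem exists_forward_mollifier {δ : ℝ} (hδ : 0 < δ) :
    ∃ κ : ℝ × E3 → ℝ, IsMollifier κ volume ∧
      ∀ y, y ∈ tsupport κ → -(2 * δ) < y.1 ∧ y.1 < 0 ∧ ‖y.2‖ ≤ δ ∧ ‖y‖ ≤ 2 * δ := by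
  -- With centre time `-δ` and outer radius `δ/2` the support stays in strictly negative times; as a
  -- convolution evaluates at `z - y`, only times after `z.1` are sampled.
  let b : ContDiffBump ((-δ, 0) : ℝ × E3) := ⟨δ / 4, δ / 2, by positivity, by linarith⟩
  refine ⟨b.normed volume, ⟨b.contDiff_normed, b.hasCompactSupport_normed, b.nonneg_normed,
    b.integral_normed⟩, fun y hy => ?_⟩
  rw [b.tsupport_normed_eq, Metric.mem_closedBall, Prod.dist_eq, max_le_iff] at hy
  have h1 : |y.1 - -δ| ≤ δ / 2 := hy.1
  have h2 : ‖y.2‖ ≤ δ / 2 := by simpa using hy.2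
  rw [abs_le] at h1
  refine ⟨by linarith, by linarith, by linarith, ?_⟩
  rw [Prod.norm_def, max_le_iff, Real.norm_eq_abs, abs_le]
  exact ⟨⟨by linarith, by linarith⟩, by linarith⟩

/-! ### Phase space: joint measurability and integrability of the solution -/

/-- Lebesgue measure on `(0,T) × ℝ³ × ℝ³`. -/
def phase (T : ℝ) : Measure (ℝ × E3 × E3) := (volume.restrict (Ioo 0 T)).prod volume

instance (T : ℝ) : SigmaFinite (slab T) := by unfold slab; infer_instance

/-- The exceptional set of a slicewise statement need not be measurable in the product. Passing to a
measurable representative of `g` makes Fubini for null sets available. -/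
theorem ae_prod_mem_of_ae_ae_mem {α β γ : Type*} [MeasurableSpace α] [MeasurableSpace β]
    [MeasurableSpace γ] {μ : Measure α} {ν : Measure β} [SFinite ν] {g : α × β → γ}
    (hg : AEMeasurable g (μ.prod ν)) {A : Set γ} (hA : MeasurableSet A)
    (h : ∀ᵐ a ∂μ, ∀ᵐ b ∂ν, g (a, b) ∈ A) : ∀ᵐ z ∂μ.prod ν, g z ∈ A := by
  have h1 := Measure.ae_ae_of_ae_prod hg.ae_eq_mk
  have h2 : ∀ᵐ z ∂μ.prod ν, hg.mk g z ∈ A := by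
    rw [Measure.ae_prod_iff_ae_ae (hg.measurable_mk hA)]
    filter_upwards [h, h1] with a ha hb
    filter_upwards [ha, hb] with b ha hb
    rwa [← hb]
  filter_upwards [h2, hg.ae_eq_mk] with z hz hz'
  rwa [hz']

theorem restrict_Ioo_le_Ici (T : ℝ) :
    (volume.restrict (Ioo 0 T)).prod (volume : Measure E3)
      ≤ (volume.restrict (Ici (0 : ℝ))).prod volume :=
  Measure.prod_mono (Measure.restrict_mono (fun _ h => h.1.le) le_rfl) le_rfl

theorem phase_le (T : ℝ) : phase T ≤ (volume.restrict (Ici (0 : ℝ))).prod volume :=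
  Measure.prod_mono (Measure.restrict_mono (fun _ h => h.1.le) le_rfl) le_rfl

theorem ae_Ioo_of_Ici {P : ℝ → Prop} (T : ℝ) (h : ∀ᵐ t ∂(volume.restrict (Ici (0 : ℝ))), P t) :
    ∀ᵐ t ∂(volume.restrict (Ioo 0 T)), P t :=
  ae_mono (Measure.restrict_mono (fun _ h => h.1.le) le_rfl) h

theorem ae_Ioo_of_Icc {P : ℝ → Prop} (T : ℝ) (h : ∀ᵐ t ∂(volume.restrict (Icc 0 T)), P t) :
    ∀ᵐ t ∂(volume.restrict (Ioo 0 T)), P t :=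
  ae_mono (Measure.restrict_mono Ioo_subset_Icc_self le_rfl) h

/-- Forgetting the velocity, on `((0,T) × ℝ³) × ℝ³`. -/
theorem measurePreserving_assoc_phase (T : ℝ) :
    MeasurePreserving (MeasurableEquiv.prodAssoc : (ℝ × E3) × E3 ≃ᵐ ℝ × E3 × E3)
      ((slab T).prod volume) (phase T) :=
  measurePreserving_prodAssoc _ _ _

theorem quasiMeasurePreserving_slab (T : ℝ) :
    Measure.QuasiMeasurePreserving (fun z : ℝ × E3 × E3 => (z.1, z.2.1)) (phase T) (slab T) := by
  have h1 := (measurePreserving_assoc_phase T).symm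
  exact (Measure.quasiMeasurePreserving_fst (μ := slab T) (ν := (volume : Measure E3))).comp
    h1.quasiMeasurePreserving

/-- Reassociating the product integrates the velocity first; this is how velocity moments of `f` are
recovered from phase-space integrals. -/
theorem lintegral_phase {T : ℝ} {h : ℝ × E3 × E3 → ℝ≥0∞} (hh : AEMeasurable h (phase T)) :
    ∫⁻ z, h z ∂phase T = ∫⁻ y, (∫⁻ v, h (y.1, y.2, v)) ∂slab T := by
  rw [← (measurePreserving_assoc_phase T).map_eq] at hh ⊢
  rw [lintegral_map' hh (MeasurableEquiv.measurable _).aemeasurable]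
  exact lintegral_prod _ (hh.comp_measurable (MeasurableEquiv.measurable _))

theorem integrable_phase_of_slab {T : ℝ} {h : ℝ × E3 → ℝ} {ψ : E3 → ℝ}
    (hh : Integrable h (slab T)) (hψ : Integrable ψ) :
    Integrable (fun z : ℝ × E3 × E3 => h (z.1, z.2.1) * ψ z.2.2) (phase T) :=
  (measurePreserving_assoc_phase T).integrable_comp_emb (MeasurableEquiv.measurableEmbedding _)
    |>.1 (hh.mul_prod hψ)

section Solution
variable {u₀ : E3 → E3} {f₀ : E3 × E3 → ℝ} {u : ℝ → E3 → E3} {Du : ℝ → E3 → E3 →L[ℝ] E3}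
  {f : ℝ → E3 × E3 → ℝ}

namespace IsGlobalWeakSolution

theorem aestronglyMeasurable_u (hs : IsGlobalWeakSolution u₀ f₀ u Du f) (T : ℝ) :
    AEStronglyMeasurable (fun z : ℝ × E3 => u z.1 z.2) (slab T) :=
  hs.u_meas.mono_measure (restrict_Ioo_le_Ici T)

theorem aestronglyMeasurable_Du (hs : IsGlobalWeakSolution u₀ f₀ u Du f) (T : ℝ) :
    AEStronglyMeasurable (fun z : ℝ × E3 => Du z.1 z.2) (slab T) :=
  hs.Du_meas.mono_measure (restrict_Ioo_le_Ici T)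

theorem aestronglyMeasurable_f (hs : IsGlobalWeakSolution u₀ f₀ u Du f) (T : ℝ) :
    AEStronglyMeasurable (fun z : ℝ × E3 × E3 => f z.1 z.2) (phase T) :=
  hs.f_meas.mono_measure (phase_le T)

theorem ae_nonneg_f (hs : IsGlobalWeakSolution u₀ f₀ u Du f) (T : ℝ) :
    ∀ᵐ z ∂phase T, 0 ≤ f z.1 z.2 := by
  refine ae_prod_mem_of_ae_ae_mem (hs.aestronglyMeasurable_f T).aemeasurable
    (A := Ici 0) measurableSet_Ici ?_
  filter_upwards [ae_restrict_mem measurableSet_Ioo] with t ht using hs.f_nonneg t ht.1.le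

/-- This joint bound serves twice: it lets the renormalization act as the identity, and it lets `L¹`
convergence of mollified derivatives pass through multiplication by `f`. -/
theorem exists_ae_abs_f_le (hs : IsGlobalWeakSolution u₀ f₀ u Du f) (T : ℝ) :
    ∃ K : ℝ≥0, ∀ᵐ z ∂phase T, |f z.1 z.2| ≤ K := by
  obtain ⟨K, hK⟩ := hs.f_bdd T
  refine ⟨K, ?_⟩
  refine (ae_prod_mem_of_ae_ae_mem (hs.aestronglyMeasurable_f T).aemeasurable
    (A := Icc (-K) K) measurableSet_Icc ?_).mono fun z hz => abs_le.2 hz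
  filter_upwards [ae_Ioo_of_Icc T hK] with t ht
  rw [eLpNorm_exponent_top] at ht
  filter_upwards [ae_le_eLpNormEssSup (f := f t) (μ := volume)] with z hz
  have h1 := hz.trans ht.2
  rw [enorm_le_coe] at h1
  exact abs_le.1 h1

theorem integrable_f (hs : IsGlobalWeakSolution u₀ f₀ u Du f) (T : ℝ) :
    Integrable (fun z : ℝ × E3 × E3 => f z.1 z.2) (phase T) := by
  obtain ⟨K, hK⟩ := hs.f_bdd T
  refine ⟨hs.aestronglyMeasurable_f T, ?_⟩
  unfold HasFiniteIntegral
  have hm := (hs.aestronglyMeasurable_f T).enorm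
  unfold phase at hm ⊢
  rw [lintegral_prod _ hm]
  calc _ ≤ ∫⁻ _ in Ioo 0 T, (K : ℝ≥0∞) := by
        refine lintegral_mono_ae ?_
        filter_upwards [ae_Ioo_of_Icc T hK] with t ht
        simpa [eLpNorm_one_eq_lintegral_enorm] using ht.1
    _ < ⊤ := by simp [ENNReal.mul_lt_top]

theorem memLp_u (hs : IsGlobalWeakSolution u₀ f₀ u Du f) (T : ℝ) :
    MemLp (fun z : ℝ × E3 => u z.1 z.2) 2 (slab T) := by
  obtain ⟨K, hK⟩ := hs.u_bdd T
  refine ⟨hs.aestronglyMeasurable_u T, ?_⟩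
  rw [eLpNorm_lt_top_iff_lintegral_rpow_enorm_lt_top (by simp) (by simp)]
  have hm := (hs.aestronglyMeasurable_u T).enorm.pow_const (2 : ℝ≥0∞).toReal
  unfold slab at hm ⊢
  rw [lintegral_prod _ hm]
  calc _ ≤ ∫⁻ _ in Ioo 0 T, (K : ℝ≥0∞) ^ (2 : ℝ≥0∞).toReal := by
        refine lintegral_mono_ae ?_
        filter_upwards [ae_Ioo_of_Icc T hK] with t ht
        rw [eLpNorm_eq_lintegral_rpow_enorm_toReal (by simp) (by simp), one_div,
          ENNReal.rpow_inv_le_iff (by simp)] at ht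
        exact ht
    _ < ⊤ := by
        simp [ENNReal.mul_lt_top]

end IsGlobalWeakSolution
end Solution

theorem slab_ball_lt_top (T R : ℝ) : slab T (univ ×ˢ Metric.closedBall 0 R) < ⊤ := by
  unfold slab
  rw [Measure.prod_prod]
  exact ENNReal.mul_lt_top (by simp) measure_closedBall_lt_top

/-- A cylinder over a ball has finite measure because the time interval is bounded, so `L^q` embeds
in `L¹` there. -/
theorem integrable_ball_of_memLp {F : Type*} [NormedAddCommGroup F] {T : ℝ} {h : ℝ × E3 → F}
    {q : ℝ≥0∞} (hq : 1 ≤ q) (hh : MemLp h q (slab T)) (R : ℝ) :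
    IntegrableOn h (univ ×ˢ Metric.closedBall 0 R) (slab T) := by
  have : IsFiniteMeasure ((slab T).restrict (univ ×ˢ Metric.closedBall 0 R)) :=
    ⟨by simpa using slab_ball_lt_top T R⟩
  exact (hh.restrict _).integrable hq

/-! ### From renormalized to weak solutions of the Vlasov equation -/

/-- Functions of the identity near a given interval that renormalization admits. -/
theorem exists_renormalization (K : ℝ) :
    ∃ β : ℝ → ℝ, ContDiff ℝ 1 β ∧ (∃ C, ∀ r, |β r| ≤ C ∧ (1 + |r|) * |deriv β r| ≤ C) ∧
      ∀ r, |r| ≤ K → β r = r ∧ deriv β r = 1 := by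
  -- The inner radius exceeds `K`, so every `r` with `|r| ≤ K` is interior to the region where the
  -- bump is `1` and the derivative is controlled as well as the value. The absolute value covers
  -- negative `K`.
  let b : ContDiffBump (0 : ℝ) := ⟨|K| + 1, |K| + 2, by positivity, by linarith⟩
  have hβ : ContDiff ℝ 1 (fun r => b r * r) := b.contDiff.mul contDiff_id
  have hc : HasCompactSupport (fun r => b r * r) := b.hasCompactSupport.mul_right
  refine ⟨fun r => b r * r, hβ, ?_, fun r hr => ?_⟩
  · obtain ⟨C1, h1⟩ := hc.exists_bound_of_continuous hβ.continuous
    have hd : HasCompactSupport (fun r => (1 + |r|) * deriv (fun r => b r * r) r) :=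
      hc.deriv.mul_left
    obtain ⟨C2, h2⟩ := hd.exists_bound_of_continuous
      ((by fun_prop : Continuous fun r : ℝ => 1 + |r|).mul (hβ.continuous_deriv le_rfl))
    refine ⟨max C1 C2, fun r => ⟨(h1 r).trans (le_max_left _ _), ?_⟩⟩
    have := h2 r
    rw [Real.norm_eq_abs, abs_mul, abs_of_nonneg (by positivity : (0:ℝ) ≤ 1 + |r|)] at this
    exact this.trans (le_max_right _ _)
  · have hr' : r ∈ Metric.ball (0 : ℝ) b.rIn := by
      simp only [b, Metric.mem_ball, dist_zero_right, Real.norm_eq_abs]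
      linarith [le_abs_self K]
    have h1 := b.eventuallyEq_one_of_mem_ball hr'
    have h2 : (fun r => b r * r) =ᶠ[𝓝 r] fun r => r := by
      filter_upwards [h1] with y hy
      rw [hy]; simp
    exact ⟨h2.eq_of_nhds, by rw [h2.deriv_eq]; simp⟩

section Weak
variable {u₀ : E3 → E3} {f₀ : E3 × E3 → ℝ} {u : ℝ → E3 → E3} {Du : ℝ → E3 → E3 →L[ℝ] E3}
  {f : ℝ → E3 × E3 → ℝ}

/-- Integrability over phase space of a product of a bounded function and a function of linear
growth in the space-time unknowns, cut off in space and velocity. -/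
theorem integrable_of_le_cutoff {T R : ℝ} {h : ℝ × E3 → ℝ} {g : ℝ × E3 × E3 → ℝ}
    (hh : IntegrableOn h (univ ×ˢ Metric.closedBall 0 R) (slab T))
    (hg : AEStronglyMeasurable g (phase T))
    (hle : ∀ᵐ z ∂phase T, |g z| ≤ if ‖z.2.1‖ ≤ R ∧ ‖z.2.2‖ ≤ R then h (z.1, z.2.1) else 0) :
    Integrable g (phase T) := by
  have hS : MeasurableSet (univ ×ˢ Metric.closedBall 0 R : Set (ℝ × E3)) :=
    MeasurableSet.univ.prod Metric.isClosed_closedBall.measurableSet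
  have h1 : Integrable ((univ ×ˢ Metric.closedBall 0 R : Set (ℝ × E3)).indicator h) (slab T) :=
    hh.integrable_indicator hS
  have h2 : Integrable ((Metric.closedBall (0 : E3) R).indicator (fun _ => (1 : ℝ))) :=
    (integrableOn_const (by exact measure_closedBall_lt_top.ne)).integrable_indicator
      Metric.isClosed_closedBall.measurableSet
  refine (integrable_phase_of_slab h1 h2).mono' hg ?_
  filter_upwards [hle] with z hz
  refine hz.trans (le_of_eq ?_)
  by_cases hx : ‖z.2.1‖ ≤ R <;> by_cases hv : ‖z.2.2‖ ≤ R <;> simp [indicator, hx, hv]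

/-- On the support of the test function `x` and `v` are bounded, so the drift grows at most linearly
in `|u|`, which is integrable on cylinders; `f` is bounded. -/
theorem integrable_mul_fderiv_test (hs : IsGlobalWeakSolution u₀ f₀ u Du f) {T : ℝ}
    {φ : ℝ × E3 × E3 → ℝ} (hφ : IsTest φ) :
    Integrable (fun z : ℝ × E3 × E3 =>
      f z.1 z.2 * fderiv ℝ φ z (1, z.2.2, u z.1 z.2.1 - z.2.2)) (phase T) := by
  obtain ⟨K, hK⟩ := hs.exists_ae_abs_f_le T
  have hφ1 : ContDiff ℝ 1 φ := hφ.1.of_le (by exact_mod_cast le_top)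
  have hcd : Continuous (fderiv ℝ φ) := hφ1.continuous_fderiv one_ne_zero
  obtain ⟨C, hC⟩ := (hφ.2.fderiv ℝ).exists_bound_of_continuous hcd
  obtain ⟨R, hR⟩ := (hφ.2.fderiv ℝ).isCompact.isBounded.subset_closedBall 0
  have hC0 : 0 ≤ C := (norm_nonneg _).trans (hC 0)
  have hum := (hs.aestronglyMeasurable_u T).comp_quasiMeasurePreserving
    (quasiMeasurePreserving_slab T)
  have hi := integrable_ball_of_memLp (by norm_num) (hs.memLp_u T) R
  have : IsFiniteMeasure ((slab T).restrict (univ ×ˢ Metric.closedBall 0 R)) :=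
    ⟨by simpa using slab_ball_lt_top T R⟩
  refine integrable_of_le_cutoff (R := R)
    (h := fun y => K * (C * (1 + R + (‖u y.1 y.2‖ + R)))) ?_ ?_ ?_
  · exact (((integrable_const (1 + R)).add (hi.norm.add (integrable_const R))).const_mul C).const_mul _
  · refine (hs.aestronglyMeasurable_f T).mul ?_
    have hvec : AEStronglyMeasurable (fun z : ℝ × E3 × E3 =>
        ((1 : ℝ), z.2.2, u z.1 z.2.1 - z.2.2)) (phase T) :=
      aestronglyMeasurable_const.prodMk
        ((by fun_prop : Continuous fun z : ℝ × E3 × E3 => z.2.2).aestronglyMeasurable.prodMk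
        (hum.sub (by fun_prop : Continuous fun z : ℝ × E3 × E3 => z.2.2).aestronglyMeasurable))
    exact isBoundedBilinearMap_apply.continuous.comp_aestronglyMeasurable
      (hcd.aestronglyMeasurable.prodMk hvec)
  · filter_upwards [hK] with z hz
    by_cases hzR : z ∈ tsupport (fderiv ℝ φ)
    · have hb := hR hzR
      rw [mem_closedBall_zero_iff, Prod.norm_def, Prod.norm_def, max_le_iff, max_le_iff] at hb
      rw [if_pos hb.2, abs_mul]
      have hR0 : 0 ≤ R := (norm_nonneg _).trans hb.1
      refine mul_le_mul hz ?_ (abs_nonneg _) K.2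
      refine ((fderiv ℝ φ z).le_opNorm _).trans (mul_le_mul (hC z) ?_ (norm_nonneg _) hC0)
      have h3 : ‖u z.1 z.2.1 - z.2.2‖ ≤ ‖u z.1 z.2.1‖ + R :=
        (norm_sub_le _ _).trans (by linarith [hb.2.2])
      have h4 := norm_nonneg (u z.1 z.2.1)
      rw [Prod.norm_def, Prod.norm_def]
      refine max_le (by simp; linarith) (max_le (by dsimp only; linarith [hb.2.2]) ?_)
      dsimp only; linarith
    · have : fderiv ℝ φ z = 0 := image_eq_zero_of_notMem_tsupport hzR
      rw [this]
      simp only [_root_.zero_apply, mul_zero, abs_zero]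
      split_ifs with h
      · have := (norm_nonneg _).trans h.1
        positivity
      · exact le_rfl

/-- Bounded renormalized solutions are weak solutions of the Vlasov equation. -/
theorem IsGlobalWeakSolution.weak_vlasov (h₀ : IsAdmissible u₀ f₀)
    (hs : IsGlobalWeakSolution u₀ f₀ u Du f) {T : ℝ}
    {φ : ℝ × E3 × E3 → ℝ} (hφ : IsTest φ) (hT : ∀ s z, T ≤ s → φ (s, z) = 0) :
    (∫ z, f z.1 z.2 * fderiv ℝ φ z (1, z.2.2, u z.1 z.2.1 - z.2.2) ∂phase T)
      + ∫ z, f₀ z * φ (0, z) = 0 := by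
  obtain ⟨K, hK⟩ := hs.exists_ae_abs_f_le T
  have hK0 : ∃ K₀ : ℝ, ∀ᵐ z, |f₀ z| ≤ K₀ := by
    have := h₀.f_mem_top.2
    rw [eLpNorm_exponent_top] at this
    refine ⟨(eLpNormEssSup f₀ volume).toReal, ?_⟩
    filter_upwards [ae_le_eLpNormEssSup (f := f₀) (μ := volume)] with z hz
    rw [← Real.norm_eq_abs, ← toReal_enorm]
    exact ENNReal.toReal_mono this.ne hz
  obtain ⟨K₀, hK₀⟩ := hK0
  -- One `β` must be the identity on the values of both `f` and `f₀`. There `β r - r β' r = 0`, so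
  -- the zero-order term of the renormalized equation disappears.
  obtain ⟨β, hβ, hβb, hβe⟩ := exists_renormalization (max K K₀)
  have hv := hs.vlasov β hβ hβb φ hφ
  have e0 : ∫ z, β (f₀ z) * φ (0, z) = ∫ z, f₀ z * φ (0, z) := by
    refine integral_congr_ae ?_
    filter_upwards [hK₀] with z hz
    rw [(hβe _ (hz.trans (le_max_right _ _))).1]
  have hφ1 : ContDiff ℝ 1 φ := hφ.1.of_le (by exact_mod_cast le_top)
  have hcd : Continuous (fderiv ℝ φ) := hφ1.continuous_fderiv one_ne_zero
  -- For `s > T` the test function vanishes in a neighbourhood; the slice `s = T` follows by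
  -- continuity of the derivative.
  have hzero : ∀ s z, T ≤ s → fderiv ℝ φ (s, z) = 0 := by
    intro s z hsT
    have hcl : IsClosed {y : ℝ × E3 × E3 | fderiv ℝ φ y = 0} :=
      isClosed_singleton.preimage hcd
    have hsub : closure {y : ℝ × E3 × E3 | T < y.1} ⊆ {y | fderiv ℝ φ y = 0} := by
      refine closure_minimal (fun y hy => ?_) hcl
      have hop : IsOpen {y : ℝ × E3 × E3 | T < y.1} := isOpen_lt continuous_const continuous_fst
      have : φ =ᶠ[𝓝 y] fun _ => 0 := by
        filter_upwards [hop.mem_nhds hy] with y' hy'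
        exact hT y'.1 y'.2 (le_of_lt hy')
      show fderiv ℝ φ y = 0
      rw [this.fderiv_eq]; simp
    apply hsub
    refine mem_closure_of_tendsto (f := fun n : ℕ => (s + 1 / ((n : ℝ) + 1), z)) (b := atTop) ?_ ?_
    · refine Tendsto.prodMk_nhds ?_ tendsto_const_nhds
      simpa using (tendsto_const_nhds (x := s)).add tendsto_one_div_add_atTop_nhds_zero_nat
    · refine Eventually.of_forall fun n => ?_
      have : (0:ℝ) < 1 / ((n : ℝ) + 1) := by positivity
      show T < s + 1 / ((n : ℝ) + 1)
      linarith
  rw [e0] at hv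
  refine Eq.trans ?_ hv
  congr 1
  have h1 : ∫ t in Ici (0 : ℝ), ∫ z : E3 × E3,
          (β (f t z) * fderiv ℝ φ (t, z) (1, z.2, u t z.1 - z.2)
            - 3 * (β (f t z) - f t z * deriv β (f t z)) * φ (t, z))
      = ∫ t in Ioo 0 T, ∫ z : E3 × E3,
          (β (f t z) * fderiv ℝ φ (t, z) (1, z.2, u t z.1 - z.2)
            - 3 * (β (f t z) - f t z * deriv β (f t z)) * φ (t, z)) := by
    rw [integral_Ici_eq_integral_Ioi]
    refine (setIntegral_eq_of_subset_of_forall_sdiff_eq_zero measurableSet_Ioi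
      (fun _ h => h.1) fun s hs' => ?_)
    have : T ≤ s := not_lt.1 fun h => hs'.2 ⟨hs'.1, h⟩
    simp [hzero s _ this, hT s _ this]
  rw [h1]
  unfold phase
  have hi := integrable_mul_fderiv_test hs (T := T) hφ
  unfold phase at hi
  rw [integral_prod _ hi]
  refine integral_congr_ae ?_
  have hae := hK
  unfold phase at hae
  filter_upwards [Measure.ae_ae_of_ae_prod hae] with t ht
  refine integral_congr_ae ?_
  filter_upwards [ht] with z hz
  obtain ⟨ha, hb⟩ := hβe (f t z) (hz.trans (le_max_left _ _))
  rw [ha, hb]; ring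

end Weak

/-! ### Weak space-time derivative of the fluid velocity and its mollification -/

instance : (volume : Measure (ℝ × E3)).IsAddHaarMeasure :=
  Measure.prod.instIsAddHaarMeasure volume volume

theorem gradNorm_nonneg (G : E3 →L[ℝ] E3) : 0 ≤ gradNorm G := Real.sqrt_nonneg _

theorem continuous_gradNorm : Continuous gradNorm := by
  unfold gradNorm; fun_prop

/-- Expansion in the canonical basis and Cauchy–Schwarz over the three coordinates. -/
theorem norm_apply_le_gradNorm_mul (G : E3 →L[ℝ] E3) (x : E3) : ‖G x‖ ≤ gradNorm G * ‖x‖ := by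
  have hx : x = ∑ i, x i • e i := by
    ext j; simp [e, Fin.sum_univ_three]; fin_cases j <;> simp
  have h1 : ‖G x‖ ≤ ∑ i, ‖G (e i)‖ * ‖x i‖ := by
    conv_lhs => rw [hx, map_sum]
    refine (norm_sum_le _ _).trans (Finset.sum_le_sum fun i _ => ?_)
    rw [map_smul, norm_smul, mul_comm]
  refine h1.trans ?_
  rw [EuclideanSpace.norm_eq, gradNorm]
  exact Real.sum_mul_le_sqrt_mul_sqrt _ _ _

theorem norm_le_gradNorm (G : E3 →L[ℝ] E3) : ‖G‖ ≤ gradNorm G :=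
  G.opNorm_le_bound (gradNorm_nonneg G) (norm_apply_le_gradNorm_mul G)

theorem slab_eq_restrict (T : ℝ) : slab T = volume.restrict (Ioo 0 T ×ˢ univ) := by
  unfold slab
  rw [← Measure.restrict_univ (μ := (volume : Measure E3)), Measure.prod_restrict]
  rfl

theorem integrableOn_slab_iff {F : Type*} [NormedAddCommGroup F] {T : ℝ} {B : Set E3}
    (hB : MeasurableSet B) {h : ℝ × E3 → F} :
    IntegrableOn h (univ ×ˢ B) (slab T) ↔ IntegrableOn h (Ioo 0 T ×ˢ B) := by
  rw [slab_eq_restrict, IntegrableOn, Measure.restrict_restrict (MeasurableSet.univ.prod hB),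
    prod_inter_prod, univ_inter, inter_univ, IntegrableOn]

theorem memLp_Du {u₀ : E3 → E3} {f₀ : E3 × E3 → ℝ} {u : ℝ → E3 → E3}
    {Du : ℝ → E3 → E3 →L[ℝ] E3} {f : ℝ → E3 × E3 → ℝ}
    (hs : IsGlobalWeakSolution u₀ f₀ u Du f) (T : ℝ) :
    MemLp (fun z : ℝ × E3 => Du z.1 z.2) 2 (slab T) := by
  have hm := hs.aestronglyMeasurable_Du T
  have hg : AEMeasurable (fun z : ℝ × E3 => ENNReal.ofReal (gradNorm (Du z.1 z.2) ^ 2)) (slab T) :=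
    ((continuous_gradNorm.pow 2).comp_aestronglyMeasurable hm).aemeasurable.ennreal_ofReal
  refine ⟨hm, ?_⟩
  rw [eLpNorm_lt_top_iff_lintegral_rpow_enorm_lt_top (by simp) (by simp)]
  calc _ ≤ ∫⁻ z, ENNReal.ofReal (gradNorm (Du z.1 z.2) ^ 2) ∂slab T := by
        refine lintegral_mono fun z => ?_
        rw [← ofReal_norm, ENNReal.ofReal_rpow_of_nonneg (norm_nonneg _) (by simp)]
        refine ENNReal.ofReal_le_ofReal ?_
        simp only [ENNReal.toReal_ofNat, Real.rpow_two]
        exact pow_le_pow_left₀ (norm_nonneg _) (norm_le_gradNorm _) 2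
    _ = ∫⁻ t in Ioo 0 T, ∫⁻ x, ENNReal.ofReal (gradNorm (Du t x) ^ 2) := by
        unfold slab at hg ⊢
        exact lintegral_prod _ hg
    _ ≤ ∫⁻ t in Icc 0 T, ∫⁻ x, ENNReal.ofReal (gradNorm (Du t x) ^ 2) :=
        lintegral_mono_set Ioo_subset_Icc_self
    _ < ⊤ := hs.Du_sq T

/-- The space-time derivative assembled from a time derivative and a spatial Jacobian. -/
def totalDeriv (Du : ℝ → E3 → E3 →L[ℝ] E3) (w : ℝ × E3 → E3) (y : ℝ × E3) : ℝ × E3 →L[ℝ] E3 :=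
  (ContinuousLinearMap.fst ℝ ℝ E3).smulRight (w y) +
    (Du y.1 y.2).comp (ContinuousLinearMap.snd ℝ ℝ E3)

theorem totalDeriv_apply (Du : ℝ → E3 → E3 →L[ℝ] E3) (w : ℝ × E3 → E3) (y a : ℝ × E3) :
    totalDeriv Du w y a = a.1 • w y + Du y.1 y.2 a.2 := by
  simp [totalDeriv]

theorem integrableOn_totalDeriv {Du : ℝ → E3 → E3 →L[ℝ] E3} {w : ℝ × E3 → E3}
    {μ : Measure (ℝ × E3)} (hD : Integrable (fun y : ℝ × E3 => Du y.1 y.2) μ)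
    (hw : Integrable w μ) : Integrable (totalDeriv Du w) μ := by
  have h1 : Integrable (fun y => (ContinuousLinearMap.fst ℝ ℝ E3).smulRight (w y)) μ :=
    ((ContinuousLinearMap.smulRightL ℝ (ℝ × E3) E3)
      (ContinuousLinearMap.fst ℝ ℝ E3)).integrable_comp hw
  have h2 : Integrable (fun y : ℝ × E3 => (Du y.1 y.2).comp (ContinuousLinearMap.snd ℝ ℝ E3)) μ :=
    ((ContinuousLinearMap.compL ℝ (ℝ × E3) E3 E3).flip
      (ContinuousLinearMap.snd ℝ ℝ E3)).integrable_comp hD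
  exact Integrable.add (ε' := ℝ × E3 →L[ℝ] E3) h1 h2

/-- A bounded continuous factor supported in the slab makes locally integrable functions
integrable. -/
theorem integrable_smul_of_tsupport {F : Type*} [NormedAddCommGroup F] [NormedSpace ℝ F] {T : ℝ}
    {c : ℝ × E3 → ℝ} (hc : Continuous c) (hcc : HasCompactSupport c)
    (hcs : tsupport c ⊆ Ioo 0 T ×ˢ univ) {h : ℝ × E3 → F}
    (hh : ∀ R, IntegrableOn h (univ ×ˢ Metric.closedBall 0 R) (slab T)) :
    Integrable (fun y => c y • h y) := by
  obtain ⟨R, hR⟩ := hcc.isCompact.isBounded.subset_closedBall 0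
  obtain ⟨C, hC⟩ := hcc.exists_bound_of_continuous hc
  have h1 := (integrableOn_slab_iff Metric.isClosed_closedBall.measurableSet).1 (hh R)
  have h2 : IntegrableOn (fun y => c y • h y) (Ioo 0 T ×ˢ Metric.closedBall 0 R) :=
    h1.bdd_smul C hc.aestronglyMeasurable (ae_of_all _ hC)
  refine (integrableOn_iff_integrable_of_support_subset ?_).1 h2
  intro y hy
  have hy' : y ∈ tsupport c := subset_tsupport _ fun h0 => hy (by simp [h0])
  refine ⟨(hcs hy').1, ?_⟩
  have := hR hy'
  rw [mem_closedBall_zero_iff, Prod.norm_def, max_le_iff] at this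
  simpa using this.2

section Sol
variable {u₀ : E3 → E3} {f₀ : E3 × E3 → ℝ} {u : ℝ → E3 → E3} {Du : ℝ → E3 → E3 →L[ℝ] E3}
  {f : ℝ → E3 × E3 → ℝ} {T : ℝ} {w : ℝ × E3 → E3}

theorem tsupport_fderiv_apply_subset {X : Type*} [NormedAddCommGroup X] [NormedSpace ℝ X]
    (φ : X → ℝ) (a : X) : tsupport (fun y => fderiv ℝ φ y a) ⊆ tsupport φ := by
  refine closure_minimal (fun y hy => ?_) isClosed_closure
  by_contra h
  exact hy (by simp [fderiv_of_notMem_tsupport ℝ h])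

/-- The space-time field has `totalDeriv` as weak derivative inside the slab. -/
theorem integral_fderiv_smul_eq (hs : IsGlobalWeakSolution u₀ f₀ u Du f)
    (hw : HasWeakTimeDeriv u T w)
    (hwi : ∀ R, IntegrableOn w (univ ×ˢ Metric.closedBall 0 R) (slab T))
    {φ : ℝ × E3 → ℝ} (hφ : IsTest φ) (hsupp : tsupport φ ⊆ Ioo 0 T ×ˢ univ) (a : ℝ × E3) :
    ∫ y, fderiv ℝ φ y a • u y.1 y.2 = -∫ y, φ y • totalDeriv Du w y a := by
  have hφ1 : ContDiff ℝ 1 φ := hφ.1.of_le (by exact_mod_cast le_top)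
  have hdc : ∀ a, Continuous fun y => fderiv ℝ φ y a := fun a =>
    (hφ1.continuous_fderiv one_ne_zero).clm_apply continuous_const
  have hds : ∀ a, tsupport (fun y => fderiv ℝ φ y a) ⊆ Ioo 0 T ×ˢ univ := fun a =>
    (tsupport_fderiv_apply_subset φ a).trans hsupp
  have hdcs : ∀ a, HasCompactSupport (fun y => fderiv ℝ φ y a) := fun a =>
    hφ.2.mono' ((subset_tsupport _).trans (tsupport_fderiv_apply_subset φ a))
  have hui := fun R => integrable_ball_of_memLp (by norm_num) (hs.memLp_u T) R
  have hDi := fun R => integrable_ball_of_memLp (by norm_num) (memLp_Du hs T) R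
  have iu := fun a => integrable_smul_of_tsupport (hdc a) (hdcs a) (hds a) hui
  have iw := integrable_smul_of_tsupport hφ.1.continuous hφ.2 hsupp hwi
  have iD : Integrable (fun y => φ y • Du y.1 y.2 a.2) := by
    have := integrable_smul_of_tsupport hφ.1.continuous hφ.2 hsupp hDi
    simpa using this.apply_continuousLinearMap a.2
  -- By Fubini, a slice `φ (s, ·)` with `s` in `(0,T)` is an admissible test function for the weak
  -- gradient at time `s`; for the other times both integrands vanish.
  have hspace : ∫ y, fderiv ℝ φ y (0, a.2) • u y.1 y.2 = -∫ y, φ y • Du y.1 y.2 a.2 := by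
    rw [Measure.volume_eq_prod, integral_prod _ (iu _), integral_prod _ iD, ← integral_neg]
    have hg := ae_restrict_iff' (measurableSet_Ici) |>.1 hs.u_grad
    refine integral_congr_ae ?_
    filter_upwards [hg] with s hgs
    by_cases hs' : s ∈ Ioo 0 T
    · have hW := (hgs hs'.1.le).2.2 (fun x => φ (s, x)) ⟨?_, ?_⟩ a.2
      · rw [← hW]
        refine integral_congr_ae (ae_of_all _ fun x => ?_)
        dsimp only
        congr 1
        have h1 : HasFDerivAt (fun x => φ (s, x)) _ x :=
          ((hφ1.differentiable one_ne_zero).differentiableAt.hasFDerivAt (x := (s, x))).comp x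
            (hasFDerivAt_prodMk_right s x)
        rw [h1.fderiv]; simp
      · exact hφ.1.comp (contDiff_const.prodMk contDiff_id)
      · refine HasCompactSupport.intro' (K := Prod.snd '' tsupport φ)
          (hφ.2.isCompact.image continuous_snd)
          (hφ.2.isCompact.image continuous_snd).isClosed fun x hx => ?_
        exact image_eq_zero_of_notMem_tsupport fun h => hx ⟨_, h, rfl⟩
    · have hx : ∀ x, (s, x) ∉ tsupport φ := fun x h => hs' (hsupp h).1
      have e1 : ∀ x, φ (s, x) = 0 := fun x => image_eq_zero_of_notMem_tsupport (hx x)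
      have e2 : ∀ x, fderiv ℝ φ (s, x) = 0 := fun x => fderiv_of_notMem_tsupport ℝ (hx x)
      simp [e1, e2]
  have htime := hw.2 φ hφ hsupp
  have e1 : ∀ y, fderiv ℝ φ y a • u y.1 y.2
      = a.1 • (fderiv ℝ φ y (1, 0) • u y.1 y.2) + fderiv ℝ φ y (0, a.2) • u y.1 y.2 := fun y => by
    -- Splitting the direction into time and space parts puts together the two separate weak
    -- identities.
    have : a = a.1 • ((1 : ℝ), (0 : E3)) + (0, a.2) := by ext <;> simp
    conv_lhs => rw [this, map_add, map_smul, add_smul, smul_assoc]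
  have e2 : ∀ y, φ y • totalDeriv Du w y a = a.1 • (φ y • w y) + φ y • Du y.1 y.2 a.2 := fun y => by
    rw [totalDeriv_apply, smul_add, smul_comm]
  simp_rw [e1, e2]
  rw [integral_add ((iu (1, 0)).fun_smul a.1) (iu _), integral_add (iw.fun_smul a.1) iD, integral_smul,
    integral_smul, htime, hspace, neg_add, smul_neg]

/-- Restriction of a space-time field to `(0,T) × B_R`. -/
def cut {F : Type*} [Zero F] (T R : ℝ) (h : ℝ × E3 → F) : ℝ × E3 → F :=
  (Ioo 0 T ×ˢ Metric.closedBall 0 R).indicator h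

theorem cut_of_mem {F : Type*} [Zero F] {R s : ℝ} {x : E3} (h : ℝ × E3 → F) (hs : s ∈ Ioo 0 T)
    (hx : ‖x‖ ≤ R) : cut T R h (s, x) = h (s, x) :=
  indicator_of_mem (mk_mem_prod hs (mem_closedBall_zero_iff.2 hx)) h

theorem cut_of_lt_norm {F : Type*} [Zero F] {R s : ℝ} {x : E3} (h : ℝ × E3 → F)
    (hx : R < ‖x‖) : cut T R h (s, x) = 0 :=
  indicator_of_notMem (fun hm => hx.not_ge (mem_closedBall_zero_iff.1 hm.2)) h

theorem integrable_cut {F : Type*} [NormedAddCommGroup F] {R : ℝ} {h : ℝ × E3 → F}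
    (hh : IntegrableOn h (univ ×ˢ Metric.closedBall 0 R) (slab T)) : Integrable (cut T R h) :=
  ((integrableOn_slab_iff Metric.isClosed_closedBall.measurableSet).1 hh).integrable_indicator
    (measurableSet_Ioo.prod Metric.isClosed_closedBall.measurableSet)

/-- Mollifying commutes with differentiation as long as the kernel stays inside the slab. -/
theorem fderiv_mollified (hs : IsGlobalWeakSolution u₀ f₀ u Du f)
    (hw : HasWeakTimeDeriv u T w)
    (hwi : ∀ R, IntegrableOn w (univ ×ˢ Metric.closedBall 0 R) (slab T))
    {κ : ℝ × E3 → ℝ} (hκ : IsMollifier κ volume) {R : ℝ} {z : ℝ × E3}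
    (hz : ∀ y, z - y ∈ tsupport κ → y ∈ Ioo 0 T ×ˢ Metric.closedBall 0 R) :
    fderiv ℝ (κ ⋆[ContinuousLinearMap.lsmul ℝ ℝ, volume] cut T R fun y => u y.1 y.2) z
      = (κ ⋆[ContinuousLinearMap.lsmul ℝ ℝ, volume] cut T R (totalDeriv Du w)) z := by
  have hui := integrable_ball_of_memLp (by norm_num) (hs.memLp_u T) R
  have hDi := integrable_ball_of_memLp (by norm_num) (memLp_Du hs T) R
  refine hκ.fderiv_convolution (integrable_cut hui).locallyIntegrable
    (integrable_cut (integrableOn_totalDeriv hDi (hwi R))).locallyIntegrable z fun a => ?_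
  have htest : IsTest fun y => κ (z - y) :=
    ⟨hκ.smooth.comp (contDiff_const.sub contDiff_id),
      hκ.compact.comp_homeomorph (Homeomorph.subLeft z)⟩
  -- Wherever the reflected kernel lives, the truncation is invisible: `cut` agrees there with the
  -- original field, so the artificial jump at its edge does not contribute.
  have hts : ∀ y ∈ tsupport (fun y => κ (z - y)), z - y ∈ tsupport κ := fun y hy =>
    tsupport_comp_subset_preimage κ (by fun_prop : Continuous fun y => z - y) hy
  have := integral_fderiv_smul_eq hs hw hwi htest
    (fun y hy => ⟨(hz y (hts y hy)).1, mem_univ _⟩) a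
  refine Eq.trans (integral_congr_ae (ae_of_all _ fun y => ?_))
    (this.trans (congrArg Neg.neg (integral_congr_ae (ae_of_all _ fun y => ?_))))
  · dsimp only
    by_cases hy : y ∈ tsupport (fun y => κ (z - y))
    · rw [cut, indicator_of_mem (hz y (hts y hy))]
    · rw [fderiv_of_notMem_tsupport ℝ hy]; simp
  · dsimp only
    by_cases hy : y ∈ tsupport (fun y => κ (z - y))
    · rw [cut, indicator_of_mem (hz y (hts y hy))]
    · rw [image_eq_zero_of_notMem_tsupport hy]; simp

end Sol

/-! ### Time regularity and the strong initial trace -/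

/-- A continuous function on a half line with an integrable weak derivative is a primitive of
it. -/
theorem sub_eq_integral_of_weak_deriv {m q : ℝ → ℝ} {T : ℝ} (hm : ContinuousOn m (Ici 0))
    (hq : IntegrableOn q (Ioo 0 T))
    (hweak : ∀ θ : ℝ → ℝ, IsTest θ → tsupport θ ⊆ Ioo 0 T →
      ∫ s, deriv θ s * m s = -∫ s, θ s * q s) {b : ℝ} (hb : b ∈ Ioo 0 T) :
    m b - m 0 = ∫ s in Ioo 0 b, q s := by
  have hδ : ∀ n : ℕ, (0 : ℝ) < 1 / ((n : ℝ) + 1) := fun n => by positivity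
  -- One-sided kernels again: the derivative identity then holds on all of `[0, b]`, the endpoint
  -- `0` included, with no weak information at negative times.
  let B : ∀ n : ℕ, ContDiffBump (-(1 / ((n : ℝ) + 1)) : ℝ) := fun n =>
    ⟨1 / ((n : ℝ) + 1) / 4, 1 / ((n : ℝ) + 1) / 2, by positivity, by linarith [hδ n]⟩
  let κ : ℕ → ℝ → ℝ := fun n => (B n).normed volume
  have hκ : ∀ n, IsMollifier (κ n) volume := fun n =>
    ⟨(B n).contDiff_normed, (B n).hasCompactSupport_normed, (B n).nonneg_normed,
      (B n).integral_normed⟩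
  have hsupp : ∀ n, ∀ y ∈ tsupport (κ n),
      -(2 * (1 / ((n : ℝ) + 1))) < y ∧ y < 0 := fun n y hy => by
    rw [(B n).tsupport_normed_eq, Metric.mem_closedBall, Real.dist_eq, abs_le] at hy
    have h1 : (B n).rOut = 1 / ((n : ℝ) + 1) / 2 := rfl
    rw [h1] at hy
    have := hδ n
    constructor <;> linarith [hy.1, hy.2]
  have hlim : Tendsto (fun n : ℕ => 2 * (1 / ((n : ℝ) + 1))) atTop (𝓝 0) := by
    simpa using (tendsto_one_div_add_atTop_nhds_zero_nat (𝕜 := ℝ)).const_mul 2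
  have hnorm : ∀ n y, κ n y ≠ 0 → ‖y‖ ≤ 2 * (1 / ((n : ℝ) + 1)) := fun n y hy => by
    obtain ⟨h1, h2⟩ := hsupp n y (subset_tsupport _ hy)
    rw [Real.norm_eq_abs, abs_le]; constructor <;> linarith
  -- The constant extension to negative times is continuous on the whole line, so its mollifications
  -- converge at every point, in particular at `0` and `b`.
  set M : ℝ → ℝ := fun s => m (max s 0)
  have hM : Continuous M := by
    refine hm.comp_continuous (by fun_prop) fun s => mem_Ici.2 (le_max_right _ _)
  set Q : ℝ → ℝ := (Ioo 0 T).indicator q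
  have hQ : Integrable Q := hq.integrable_indicator measurableSet_Ioo
  have hMlim : ∀ x, Tendsto (fun n => ((κ n) ⋆[ContinuousLinearMap.lsmul ℝ ℝ, volume] M) x)
      atTop (𝓝 (M x)) := fun x => by
    refine convolution_tendsto_right (g := fun _ => M) (k := fun _ => x)
      (Eventually.of_forall fun n => (hκ n).nonneg) (Eventually.of_forall fun n => (hκ n).integral_eq)
      ?_ (Eventually.of_forall fun _ => hM.aestronglyMeasurable) ?_ tendsto_const_nhds
    · rw [tendsto_smallSets_iff]
      intro t ht
      obtain ⟨ε, hε, hεt⟩ := Metric.mem_nhds_iff.1 ht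
      filter_upwards [hlim.eventually (gt_mem_nhds hε)] with n hn y hy
      exact hεt (by simpa using (hnorm n y hy).trans_lt hn)
    · exact (hM.tendsto x).comp tendsto_snd
  have hQlim := tendsto_lintegral_convolution_sub hκ hlim hnorm hQ
  have hQi : ∀ n, Integrable ((κ n) ⋆[ContinuousLinearMap.lsmul ℝ ℝ, volume] Q) := fun n =>
    ((hκ n).smooth.continuous.integrable_of_hasCompactSupport (hκ n).compact).integrable_convolution
      _ hQ
  -- The two sides of the fundamental theorem converge in different senses: the end values
  -- pointwise, the derivative only in `L¹`.
  have hlim2 := tendsto_setIntegral_of_L1 Q hQ.1 (Eventually.of_forall hQi) hQlim (Ioo 0 b)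
  have hIQ : ∫ s in Ioo 0 b, Q s = ∫ s in Ioo 0 b, q s :=
    setIntegral_congr_fun measurableSet_Ioo fun s hs =>
      indicator_of_mem (show s ∈ Ioo 0 T from ⟨hs.1, hs.2.trans hb.2⟩) q
  rw [hIQ] at hlim2
  have hM0 : M 0 = m 0 := by simp [M]
  have hMb : M b = m b := by simp [M, hb.1.le]
  rw [← hM0, ← hMb]
  refine tendsto_nhds_unique (((hMlim b).sub (hMlim 0)).congr' ?_) hlim2
  filter_upwards [hlim.eventually (gt_mem_nhds (sub_pos.2 hb.2))] with n hn
  have hder : ∀ z ∈ Icc 0 b, HasDerivAt ((κ n) ⋆[ContinuousLinearMap.lsmul ℝ ℝ, volume] M)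
      (((κ n) ⋆[ContinuousLinearMap.lsmul ℝ ℝ, volume] Q) z) z := by
    intro z hz
    have hin : ∀ y, z - y ∈ tsupport (κ n) → y ∈ Ioo 0 T := fun y hy => by
      obtain ⟨h1, h2⟩ := hsupp n _ hy
      exact ⟨by linarith [hz.1], by linarith [hz.2]⟩
    have htest : IsTest fun y => κ n (z - y) :=
      ⟨(hκ n).smooth.comp (contDiff_const.sub contDiff_id),
        (hκ n).compact.comp_homeomorph (Homeomorph.subLeft z)⟩
    have hts : ∀ y ∈ tsupport (fun y => κ n (z - y)), y ∈ Ioo 0 T := fun y hy =>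
      hin y (tsupport_comp_subset_preimage (κ n) (by fun_prop : Continuous fun y => z - y) hy)
    have hw := hweak _ htest hts
    have hloc : LocallyIntegrable
        (fun s => ((1 : ℝ →L[ℝ] ℝ).smulRight (Q s))) volume := by
      refine Integrable.locallyIntegrable ?_
      exact ((ContinuousLinearMap.smulRightL ℝ ℝ ℝ) (1 : ℝ →L[ℝ] ℝ)).integrable_comp hQ
    have hf := (hκ n).fderiv_convolution hM.locallyIntegrable hloc z (fun a => by
      have e1 : ∀ y, fderiv ℝ (fun y => κ n (z - y)) y a • M y
          = a * (deriv (fun y => κ n (z - y)) y * m y) := fun y => by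
        by_cases hy : y ∈ tsupport (fun y => κ n (z - y))
        · have : M y = m y := by simp [M, (hts y hy).1.le]
          rw [this, fderiv_eq_smul_deriv]; simp; ring
        · rw [fderiv_of_notMem_tsupport ℝ hy, ← fderiv_apply_one_eq_deriv,
            fderiv_of_notMem_tsupport ℝ hy]; simp
      have e2 : ∀ y, κ n (z - y) • ((1 : ℝ →L[ℝ] ℝ).smulRight (Q y)) a
          = a * (κ n (z - y) * q y) := fun y => by
        by_cases hy : y ∈ tsupport (fun y => κ n (z - y))
        · have : Q y = q y := indicator_of_mem (hts y hy) q
          rw [this]; simp; ring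
        · rw [image_eq_zero_of_notMem_tsupport hy]; simp
      simp_rw [e1, e2]
      rw [integral_const_mul, integral_const_mul, hw]; ring)
    have hd : DifferentiableAt ℝ ((κ n) ⋆[ContinuousLinearMap.lsmul ℝ ℝ, volume] M) z :=
      ((hκ n).compact.contDiff_convolution_left (n := 1) _
        ((hκ n).smooth.of_le (by exact_mod_cast le_top)) hM.locallyIntegrable).differentiable
          one_ne_zero z
    have := hd.hasDerivAt
    rw [← fderiv_apply_one_eq_deriv, hf] at this
    have e3 : ((κ n) ⋆[ContinuousLinearMap.lsmul ℝ ℝ, volume]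
        fun s => ((1 : ℝ →L[ℝ] ℝ).smulRight (Q s))) z 1
        = ((κ n) ⋆[ContinuousLinearMap.lsmul ℝ ℝ, volume] Q) z := by
      rw [convolution_lsmul, convolution_lsmul, ContinuousLinearMap.integral_apply]
      · simp
      · exact (hκ n).integrable_smul hloc z
    rwa [e3] at this
  have := intervalIntegral.integral_eq_sub_of_hasDerivAt
    (f' := ((κ n) ⋆[ContinuousLinearMap.lsmul ℝ ℝ, volume] Q)) (a := 0) (b := b)
    (fun x hx => hder x (by rwa [uIcc_of_le hb.1.le] at hx)) (hQi n).intervalIntegrable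
  rw [← this, intervalIntegral.integral_of_le hb.1.le, integral_Ioc_eq_integral_Ioo]

section Sol
variable {u₀ : E3 → E3} {f₀ : E3 × E3 → ℝ} {u : ℝ → E3 → E3} {Du : ℝ → E3 → E3 →L[ℝ] E3}
  {f : ℝ → E3 × E3 → ℝ} {T : ℝ} {w : ℝ × E3 → E3}

theorem IsTest.memLp {ψ : E3 → ℝ} (hψ : IsTest ψ) (c : E3) : MemLp (fun x => ψ x • c) 2 :=
  (hψ.1.continuous.smul continuous_const).memLp_of_hasCompactSupport hψ.2.smul_right

theorem integrable_ball_w (hwi : ∀ R, IntegrableOn w (univ ×ˢ Metric.closedBall 0 R) (slab T))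
    (R : ℝ) : Integrable w ((volume.restrict (Ioo 0 T)).prod (volume.restrict
      (Metric.closedBall (0 : E3) R))) := by
  have := (integrableOn_slab_iff Metric.isClosed_closedBall.measurableSet).1 (hwi R)
  rwa [IntegrableOn, Measure.volume_eq_prod, ← Measure.prod_restrict] at this

/-- Weak continuity in time turns the weak time derivative into a primitive, in duality. -/
theorem integral_inner_sub_eq (hs : IsGlobalWeakSolution u₀ f₀ u Du f)
    (hw : HasWeakTimeDeriv u T w)
    (hwi : ∀ R, IntegrableOn w (univ ×ˢ Metric.closedBall 0 R) (slab T))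
    {b : ℝ} (hb : b ∈ Ioo 0 T) {ψ : E3 → ℝ} (hψ : IsTest ψ) (c : E3) :
    (∫ x, inner ℝ (u b x) (ψ x • c)) - ∫ x, inner ℝ (u 0 x) (ψ x • c)
      = ∫ s in Ioo 0 b, ∫ x, inner ℝ (w (s, x)) (ψ x • c) := by
  obtain ⟨R, hR⟩ := hψ.2.isCompact.isBounded.subset_closedBall 0
  obtain ⟨C, hC⟩ := hψ.2.exists_bound_of_continuous hψ.1.continuous
  have hwR := integrable_ball_w hwi R
  have hres : ∀ g : E3 → E3, ∫ x, inner ℝ (g x) (ψ x • c)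
      = ∫ x in Metric.closedBall 0 R, inner ℝ (g x) (ψ x • c) := fun g => by
    refine (setIntegral_eq_integral_of_forall_compl_eq_zero fun x hx => ?_).symm
    rw [image_eq_zero_of_notMem_tsupport fun h => hx (hR h)]; simp
  have hwψ : Integrable (fun z : ℝ × E3 => inner ℝ (w z) (ψ z.2 • c))
      ((volume.restrict (Ioo 0 T)).prod (volume.restrict (Metric.closedBall (0 : E3) R))) := by
    have h1 : Integrable (fun z : ℝ × E3 => inner ℝ (w z) c)
      ((volume.restrict (Ioo 0 T)).prod (volume.restrict (Metric.closedBall (0 : E3) R))) :=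
      hwR.inner_const c
    have h2 := h1.bdd_smul (φ := fun z : ℝ × E3 => ψ z.2) C
      (hψ.1.continuous.comp continuous_snd).aestronglyMeasurable (ae_of_all _ fun z => hC _)
    refine h2.congr (ae_of_all _ fun z => ?_)
    simp [inner_smul_right]
  refine sub_eq_integral_of_weak_deriv (T := T) (hs.u_cont _ (hψ.memLp c)) ?_ ?_ hb
  · simp_rw [hres]
    exact hwψ.integral_prod_left
  · intro θ hθ hθs
    -- Tensor products separate time from space, reducing the vector-valued space-time identity,
    -- once paired with `c`, to a scalar weak derivative in time.
    set φ : ℝ × E3 → ℝ := fun z => θ z.1 * ψ z.2 with hφdef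
    have hφ : IsTest φ := by
      refine ⟨(hθ.1.comp contDiff_fst).mul (hψ.1.comp contDiff_snd), ?_⟩
      refine HasCompactSupport.intro' (K := tsupport θ ×ˢ tsupport ψ)
        (hθ.2.isCompact.prod hψ.2.isCompact)
        ((isClosed_tsupport _).prod (isClosed_tsupport _)) fun z hz => ?_
      by_cases h1 : z.1 ∈ tsupport θ
      · have : z.2 ∉ tsupport ψ := fun h => hz ⟨h1, h⟩
        simp [φ, image_eq_zero_of_notMem_tsupport this]
      · simp [φ, image_eq_zero_of_notMem_tsupport h1]
    have hφs : tsupport φ ⊆ Ioo 0 T ×ˢ univ := by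
      have : tsupport φ ⊆ Prod.fst ⁻¹' tsupport θ := by
        refine closure_minimal (fun z hz => subset_tsupport _ fun h => hz ?_)
          ((isClosed_tsupport _).preimage continuous_fst)
        simp [φ, h]
      exact fun z hz => ⟨hθs (this hz), mem_univ _⟩
    have hd : ∀ z, fderiv ℝ φ z (1, 0) = deriv θ z.1 * ψ z.2 := fun z => by
      have h1 := ((hθ.1.differentiable (by simp)) z.1).hasFDerivAt.comp z
        (hasFDerivAt_fst (𝕜 := ℝ) (p := z))
      have h2 := ((hψ.1.differentiable (by simp)) z.2).hasFDerivAt.comp z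
        (hasFDerivAt_snd (𝕜 := ℝ) (p := z))
      have h3 : fderiv ℝ φ z = _ := (h1.mul h2).fderiv
      rw [h3]
      simp [mul_comm]
    have hui := fun R => integrable_ball_of_memLp (by norm_num) (hs.memLp_u T) R
    have hφ1 : ContDiff ℝ 1 φ := hφ.1.of_le (by exact_mod_cast le_top)
    have iu := integrable_smul_of_tsupport
      ((hφ1.continuous_fderiv one_ne_zero).clm_apply (continuous_const (y := ((1 : ℝ), (0 : E3)))))
      (hφ.2.mono' ((subset_tsupport _).trans (tsupport_fderiv_apply_subset φ (1, 0))))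
      ((tsupport_fderiv_apply_subset φ (1, 0)).trans hφs) hui
    have iw := integrable_smul_of_tsupport hφ.1.continuous hφ.2 hφs hwi
    have key := congrArg (fun y => inner ℝ y c) (hw.2 φ hφ hφs)
    simp only [inner_neg_left] at key
    rw [real_inner_comm, ← integral_inner iu, real_inner_comm, ← integral_inner iw] at key
    have j1 := iu.const_inner (𝕜 := ℝ) c
    have j2 := iw.const_inner (𝕜 := ℝ) c
    rw [Measure.volume_eq_prod] at j1 j2
    rw [Measure.volume_eq_prod, integral_prod _ j1, integral_prod _ j2] at key
    refine Eq.trans ?_ (key.trans (congrArg Neg.neg ?_))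
    · refine integral_congr_ae (ae_of_all _ fun s => ?_)
      dsimp only
      rw [← integral_const_mul]
      refine integral_congr_ae (ae_of_all _ fun x => ?_)
      dsimp only
      rw [hd]
      simp only [inner_smul_right, real_inner_comm]; ring
    · refine integral_congr_ae (ae_of_all _ fun s => ?_)
      dsimp only
      rw [← integral_const_mul]
      refine integral_congr_ae (ae_of_all _ fun x => ?_)
      simp only [inner_smul_right, real_inner_comm, φ]; ring

/-- The initial datum and the time derivative recover the field at almost every point. -/
theorem ae_sub_eq_integral (hs : IsGlobalWeakSolution u₀ f₀ u Du f)
    (hw : HasWeakTimeDeriv u T w)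
    (hwi : ∀ R, IntegrableOn w (univ ×ˢ Metric.closedBall 0 R) (slab T))
    {b : ℝ} (hb : b ∈ Ioo 0 T) :
    ∀ᵐ x, u b x - u 0 x = ∫ s in Ioo 0 b, w (s, x) := by
  have hmono : volume.restrict (Ioo 0 b) ≤ volume.restrict (Ioo 0 T) :=
    Measure.restrict_mono (Ioo_subset_Ioo_right hb.2.le) le_rfl
  have hwR : ∀ R, Integrable w ((volume.restrict (Ioo 0 b)).prod (volume.restrict
      (Metric.closedBall (0 : E3) R))) := fun R =>
    (integrable_ball_w hwi R).mono_measure (Measure.prod_mono hmono le_rfl)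
  have hub := (hs.u_mem b hb.1.le).locallyIntegrable (by norm_num)
  have hu0 := (hs.u_mem 0 le_rfl).locallyIntegrable (by norm_num)
  have hW : LocallyIntegrable (fun x => ∫ s in Ioo 0 b, w (s, x)) := by
    rw [locallyIntegrable_iff]
    intro K hK
    obtain ⟨R, hR⟩ := hK.isBounded.subset_closedBall 0
    exact IntegrableOn.mono_set (hwR R).integral_prod_right hR
  refine ae_eq_of_integral_contDiff_smul_eq (hub.sub hu0) hW fun ψ h1 h2 => ?_
  have hψ : IsTest ψ := ⟨h1, h2⟩
  have iu : ∀ s, 0 ≤ s → Integrable fun x => ψ x • u s x := fun s hs0 =>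
    ((hs.u_mem s hs0).locallyIntegrable (by norm_num)).integrable_smul_left_of_hasCompactSupport
      h1.continuous h2
  have iW := hW.integrable_smul_left_of_hasCompactSupport h1.continuous h2
  refine ext_inner_right ℝ fun c => ?_
  have key := integral_inner_sub_eq hs hw hwi hb hψ c
  have e1 : ∀ s, 0 ≤ s → ∫ x, inner ℝ (u s x) (ψ x • c) = inner ℝ (∫ x, ψ x • u s x) c :=
    fun s hs0 => by
      rw [real_inner_comm, ← integral_inner (iu s hs0)]
      refine integral_congr_ae (ae_of_all _ fun x => ?_)
      simp only [inner_smul_right, real_inner_comm]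
  rw [e1 b hb.1.le, e1 0 le_rfl, ← inner_sub_left, ← integral_sub (iu b hb.1.le) (iu 0 le_rfl)]
    at key
  have e2 : ∫ x, ψ x • (u b x - u 0 x) = ∫ x, ψ x • u b x - ψ x • u 0 x :=
    integral_congr_ae (ae_of_all _ fun x => by simp [smul_sub])
  rw [e2, key, real_inner_comm, ← integral_inner iW]
  obtain ⟨R, hR⟩ := h2.isCompact.isBounded.subset_closedBall 0
  obtain ⟨C, hC⟩ := h2.exists_bound_of_continuous h1.continuous
  have hres : ∀ g : E3 → ℝ, (∀ x, x ∉ tsupport ψ → g x = 0) →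
      ∫ x, g x = ∫ x in Metric.closedBall 0 R, g x := fun g hg =>
    (setIntegral_eq_integral_of_forall_compl_eq_zero fun x hx => hg x fun h => hx (hR h)).symm
  have hz : ∀ x, x ∉ tsupport ψ → ψ x = 0 := fun x hx => image_eq_zero_of_notMem_tsupport hx
  rw [hres _ fun x hx => by simp [hz x hx]]
  have e3 : ∀ s, ∫ x, inner ℝ (w (s, x)) (ψ x • c)
      = ∫ x in Metric.closedBall 0 R, inner ℝ (w (s, x)) (ψ x • c) := fun s =>
    hres _ fun x hx => by simp [hz x hx]
  simp_rw [e3]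
  have hwψ : Integrable (fun z : ℝ × E3 => inner ℝ (w z) (ψ z.2 • c))
      ((volume.restrict (Ioo 0 b)).prod (volume.restrict (Metric.closedBall (0 : E3) R))) := by
    have h3 : Integrable (fun z : ℝ × E3 => inner ℝ (w z) c)
      ((volume.restrict (Ioo 0 b)).prod (volume.restrict (Metric.closedBall (0 : E3) R))) :=
      (hwR R).inner_const c
    have h4 := h3.bdd_smul (φ := fun z : ℝ × E3 => ψ z.2) C
      (h1.continuous.comp continuous_snd).aestronglyMeasurable (ae_of_all _ fun z => hC _)
    refine h4.congr (ae_of_all _ fun z => ?_)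
    simp [inner_smul_right]
  -- The localization to a ball was made so that Fubini applies: `w` is integrable only on bounded
  -- cylinders.
  rw [integral_integral_swap hwψ]
  refine integral_congr_ae ?_
  filter_upwards [(hwR R).prod_left_ae] with x hx
  rw [inner_smul_right, ← integral_inner hx]
  simp only [inner_smul_right]
  rw [integral_const_mul]
  simp only [real_inner_comm]

/-- The field attains its initial value strongly in `L¹` on balls. -/
theorem lintegral_ball_sub_le (hs : IsGlobalWeakSolution u₀ f₀ u Du f)
    (hw : HasWeakTimeDeriv u T w)
    (hwi : ∀ R, IntegrableOn w (univ ×ˢ Metric.closedBall 0 R) (slab T))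
    {b : ℝ} (hb : b ∈ Ioo 0 T) (R : ℝ) :
    ∫⁻ x in Metric.closedBall 0 R, ‖u b x - u₀ x‖ₑ
      ≤ ∫⁻ y in Ioo 0 b ×ˢ univ, ‖cut T R w y‖ₑ := by
  have hi : Integrable (cut T R w) := integrable_cut (hwi R)
  have hB : MeasurableSet (Metric.closedBall (0 : E3) R) := Metric.isClosed_closedBall.measurableSet
  have e1 : (volume : Measure (ℝ × E3)).restrict (Ioo 0 b ×ˢ univ)
      = (volume.restrict (Ioo 0 b)).prod volume := (slab_eq_restrict b).symm
  have hm : AEMeasurable (fun y => ‖cut T R w y‖ₑ) ((volume.restrict (Ioo 0 b)).prod volume) := by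
    rw [← e1]; exact hi.1.enorm.restrict
  rw [e1, lintegral_prod_symm _ hm, ← lintegral_indicator hB]
  refine lintegral_mono_ae ?_
  filter_upwards [ae_sub_eq_integral hs hw hwi hb, hs.u_init] with x hx h0
  by_cases hxB : x ∈ Metric.closedBall (0 : E3) R
  · rw [indicator_of_mem hxB, ← h0, hx]
    refine (enorm_integral_le_lintegral_enorm _).trans (le_of_eq ?_)
    refine setLIntegral_congr_fun measurableSet_Ioo fun s hs' => ?_
    rw [cut_of_mem w ⟨hs'.1, hs'.2.trans hb.2⟩ (mem_closedBall_zero_iff.1 hxB)]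
  · rw [indicator_of_notMem hxB]; exact zero_le

/-- Absolute continuity of the integral. The strip over `(0,b)` has infinite measure, so the ball
hidden in `cut` is first made explicit; the resulting cylinder has measure proportional to `b`. -/
theorem tendsto_setLIntegral_cut {R : ℝ} (hwc : Integrable (cut T R w)) :
    Tendsto (fun b : ℝ => ∫⁻ y in Ioo 0 b ×ˢ univ, ‖cut T R w y‖ₑ) (𝓝[>] 0) (𝓝 0) := by
  have hB : MeasurableSet (Metric.closedBall (0 : E3) R) := Metric.isClosed_closedBall.measurableSet
  have h1 : ∀ b : ℝ, ∫⁻ y in Ioo 0 b ×ˢ univ, ‖cut T R w y‖ₑ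
      = ∫⁻ y in Ioo 0 b ×ˢ Metric.closedBall 0 R, ‖cut T R w y‖ₑ := fun b => by
    rw [← lintegral_indicator (measurableSet_Ioo.prod MeasurableSet.univ),
      ← lintegral_indicator (measurableSet_Ioo.prod hB)]
    refine lintegral_congr fun y => ?_
    by_cases hy : y.2 ∈ Metric.closedBall (0 : E3) R
    · by_cases hy1 : y.1 ∈ Ioo 0 b
      · rw [indicator_of_mem, indicator_of_mem]
        exacts [⟨hy1, hy⟩, ⟨hy1, mem_univ _⟩]
      · rw [indicator_of_notMem fun h => hy1 h.1, indicator_of_notMem fun h => hy1 h.1]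
    · have : cut T R w y = 0 := indicator_of_notMem (fun h => hy h.2) _
      simp [indicator, this]
  simp_rw [h1]
  refine tendsto_setLIntegral_zero hwc.2.ne ?_
  have h2 : ∀ b : ℝ, (volume : Measure (ℝ × E3)) (Ioo 0 b ×ˢ Metric.closedBall 0 R)
      = ENNReal.ofReal b * volume (Metric.closedBall (0 : E3) R) := fun b => by
    rw [Measure.volume_eq_prod, Measure.prod_prod]; simp
  have h3 : Tendsto (fun b : ℝ => ENNReal.ofReal b * volume (Metric.closedBall (0 : E3) R))
      (𝓝 0) (𝓝 (ENNReal.ofReal 0 * volume (Metric.closedBall (0 : E3) R))) :=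
    ENNReal.Tendsto.mul_const (ENNReal.continuous_ofReal.tendsto 0)
      (Or.inr measure_closedBall_lt_top.ne)
  simp only [ENNReal.ofReal_zero, zero_mul] at h3
  exact (h3.mono_left nhdsWithin_le_nhds).congr fun b => (h2 b).symm

/-- Forward mollifications at time zero converge to the initial datum. -/
theorem tendsto_mollified_initial (hs : IsGlobalWeakSolution u₀ f₀ u Du f)
    (hw : HasWeakTimeDeriv u T w)
    (hwi : ∀ R, IntegrableOn w (univ ×ˢ Metric.closedBall 0 R) (slab T)) (hT : 0 < T)
    {κ : ℕ → ℝ × E3 → ℝ} {δ : ℕ → ℝ} (hκ : ∀ n, IsMollifier (κ n) volume)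
    (hδ : Tendsto δ atTop (𝓝 0))
    (hsupp : ∀ n, ∀ y ∈ tsupport (κ n), -(2 * δ n) < y.1 ∧ y.1 < 0 ∧ ‖y.2‖ ≤ δ n ∧ ‖y‖ ≤ 2 * δ n)
    (R : ℝ) :
    Tendsto (fun n => ∫⁻ x, ‖((κ n) ⋆[ContinuousLinearMap.lsmul ℝ ℝ, volume]
      cut T R fun y => u y.1 y.2) (0, x) - (Metric.closedBall 0 R).indicator u₀ x‖ₑ)
      atTop (𝓝 0) := by
  set U := cut T R fun y => u y.1 y.2 with hU
  set U₀ := (Metric.closedBall (0 : E3) R).indicator u₀ with hU₀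
  have hB : MeasurableSet (Metric.closedBall (0 : E3) R) := Metric.isClosed_closedBall.measurableSet
  have hUi : Integrable U :=
    integrable_cut (integrable_ball_of_memLp (by norm_num) (hs.memLp_u T) R)
  have hu0 : MemLp u₀ 2 := (memLp_congr_ae hs.u_init).1 (hs.u_mem 0 le_rfl)
  have hU₀i : Integrable U₀ :=
    ((hu0.locallyIntegrable (by norm_num)).integrableOn_isCompact
      (isCompact_closedBall 0 R)).integrable_indicator hB
  have hwc : Integrable (cut T R w) := integrable_cut (hwi R)
  have hlim0 := tendsto_setLIntegral_cut hwc
  rw [ENNReal.tendsto_nhds_zero]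
  intro ε hε
  have hε2 : 0 < ε / 2 := ENNReal.half_pos hε.ne'
  obtain ⟨η, hη, hb⟩ := exists_forall_lintegral_enorm_translate_sub_le hU₀i hε2
  obtain ⟨r, hr, hb2⟩ := (mem_nhdsGT_iff_exists_Ioo_subset).1
    (hlim0.eventually (ge_mem_nhds hε2))
  have hδ2 : Tendsto (fun n => 2 * δ n) atTop (𝓝 0) := by simpa using hδ.const_mul 2
  filter_upwards [hδ.eventually (gt_mem_nhds hη), hδ2.eventually (gt_mem_nhds hr),
    hδ2.eventually (gt_mem_nhds hT)] with n hn1 hn2 hn3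
  have hm : AEMeasurable (fun q : E3 × (ℝ × E3) =>
      ENNReal.ofReal (κ n q.2) * ‖U ((0, q.1) - q.2) - U₀ q.1‖ₑ) (volume.prod volume) := by
    have hq : Measure.QuasiMeasurePreserving
        (fun q : E3 × (ℝ × E3) => ((0 : ℝ), q.1) - q.2) (volume.prod volume) volume :=
      QuasiMeasurePreserving.prod_of_right (by fun_prop)
        (ae_of_all _ fun x => (Measure.measurePreserving_sub_left volume ((0 : ℝ), x)).quasiMeasurePreserving)
    have h1 := hUi.1.comp_quasiMeasurePreserving hq
    have h2 : AEStronglyMeasurable (fun q : E3 × (ℝ × E3) => U₀ q.1) (volume.prod volume) :=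
      hU₀i.1.comp_fst
    exact (((hκ n).smooth.continuous.measurable.comp measurable_snd).ennreal_ofReal.aemeasurable).mul
      (h1.sub h2).enorm
  calc ∫⁻ x, ‖((κ n) ⋆[ContinuousLinearMap.lsmul ℝ ℝ, volume] U) (0, x) - U₀ x‖ₑ
      ≤ ∫⁻ x, ∫⁻ y, ENNReal.ofReal (κ n y) * ‖U ((0, x) - y) - U₀ x‖ₑ :=
        lintegral_mono fun x => (hκ n).enorm_convolution_sub_le hUi.locallyIntegrable _ _
    _ = ∫⁻ y, ∫⁻ x, ENNReal.ofReal (κ n y) * ‖U ((0, x) - y) - U₀ x‖ₑ :=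
        lintegral_lintegral_swap hm
    _ = ∫⁻ y, ENNReal.ofReal (κ n y) * ∫⁻ x, ‖U ((0, x) - y) - U₀ x‖ₑ :=
        lintegral_congr fun y => lintegral_const_mul' _ _ ENNReal.ofReal_ne_top
    _ ≤ ∫⁻ y, ENNReal.ofReal (κ n y) * ε := by
        refine lintegral_mono fun y => ?_
        by_cases hy : κ n y = 0
        · simp [hy]
        gcongr
        obtain ⟨h1, h2, h3, -⟩ := hsupp n y (subset_tsupport _ hy)
        -- A kernel point `y` samples the small positive time `-y.1`. The error splits into the time
        -- increment at the shifted position, small by `lintegral_ball_sub_le`, and a spatial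
        -- translation error of the truncated datum.
        have hsT : -y.1 ∈ Ioo 0 T := ⟨by linarith, by linarith⟩
        calc ∫⁻ x, ‖U ((0, x) - y) - U₀ x‖ₑ
            ≤ ∫⁻ x, (‖U (-y.1, x - y.2) - U₀ (x - y.2)‖ₑ + ‖U₀ (x - y.2) - U₀ x‖ₑ) := by
              refine lintegral_mono fun x => ?_
              have : ((0 : ℝ), x) - y = (-y.1, x - y.2) := by ext <;> simp
              rw [this, ← sub_add_sub_cancel _ (U₀ (x - y.2)) (U₀ x)]
              exact enorm_add_le _ _
          _ = (∫⁻ x, ‖U (-y.1, x - y.2) - U₀ (x - y.2)‖ₑ)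
                + ∫⁻ x, ‖U₀ (x - y.2) - U₀ x‖ₑ := by
              refine lintegral_add_right' _ ?_
              exact ((hU₀i.1.comp_quasiMeasurePreserving
                (measurePreserving_sub_right volume y.2).quasiMeasurePreserving).sub hU₀i.1).enorm
          _ = (∫⁻ x, ‖U (-y.1, x) - U₀ x‖ₑ) + ∫⁻ x, ‖U₀ (x - y.2) - U₀ x‖ₑ := by
              rw [lintegral_sub_right_eq_self (fun x => ‖U (-y.1, x) - U₀ x‖ₑ) y.2]
          _ ≤ ε / 2 + ε / 2 := by
              refine add_le_add ?_ (hb _ (h3.trans hn1.le))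
              have e2 : ∫⁻ x, ‖U (-y.1, x) - U₀ x‖ₑ
                  = ∫⁻ x in Metric.closedBall 0 R, ‖u (-y.1) x - u₀ x‖ₑ := by
                rw [← lintegral_indicator hB]
                refine lintegral_congr fun x => ?_
                by_cases hx : x ∈ Metric.closedBall (0 : E3) R
                · have hc : U (-y.1, x) = u (-y.1) x :=
                    cut_of_mem _ hsT (mem_closedBall_zero_iff.1 hx)
                  rw [indicator_of_mem hx, hc, hU₀, indicator_of_mem hx]
                · have hc : U (-y.1, x) = 0 := cut_of_lt_norm _ (by simpa using hx)
                  rw [indicator_of_notMem hx, hc, hU₀, indicator_of_notMem hx]; simp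
              rw [e2]
              exact (lintegral_ball_sub_le hs hw hwi hsT R).trans
                (hb2 ⟨hsT.1, by linarith⟩)
          _ = ε := ENNReal.add_halves ε
    _ = ε := by
        rw [lintegral_mul_const _ (hκ n).smooth.continuous.measurable.ennreal_ofReal,
          (hκ n).lintegral_eq, one_mul]

end Sol

/-! ### Transport identity for test functions of the fluid velocity -/

theorem exists_subseq_ae_tendsto_of_L1 {α F : Type*} [MeasurableSpace α] {μ : Measure α}
    [NormedAddCommGroup F] {h : ℕ → α → F} {g : α → F} (hh : ∀ n, AEStronglyMeasurable (h n) μ)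
    (hg : AEStronglyMeasurable g μ)
    (hlim : Tendsto (fun n => ∫⁻ z, ‖h n z - g z‖ₑ ∂μ) atTop (𝓝 0)) :
    ∃ ns : ℕ → ℕ, StrictMono ns ∧ ∀ᵐ z ∂μ, Tendsto (fun k => h (ns k) z) atTop (𝓝 (g z)) := by
  refine (tendstoInMeasure_of_tendsto_eLpNorm (p := 1) one_ne_zero hh hg ?_).exists_seq_tendsto_ae
  simpa [eLpNorm_one_eq_lintegral_enorm] using hlim

section Compose
variable {G : ℝ × E3 × E3 × E3 → ℝ} {V : ℝ × E3 → E3}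

/-- The support lies in the projection of `tsupport G` onto time, position and velocity, so `V`
needs smoothness but no decay. -/
theorem isTest_comp_graph (hG : IsTest G) (hV : ContDiff ℝ ∞ V) :
    IsTest fun z : ℝ × E3 × E3 => G (z.1, z.2.1, z.2.2, V (z.1, z.2.1)) := by
  refine ⟨hG.1.comp ?_, ?_⟩
  · have := hV.comp (contDiff_fst.prodMk (contDiff_fst.comp contDiff_snd) :
      ContDiff ℝ ∞ fun z : ℝ × E3 × E3 => (z.1, z.2.1))
    exact contDiff_fst.prodMk ((contDiff_fst.comp contDiff_snd).prodMk
      ((contDiff_snd.comp contDiff_snd).prodMk this))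
  · have hc : IsCompact ((fun q : ℝ × E3 × E3 × E3 => (q.1, q.2.1, q.2.2.1)) '' tsupport G) :=
      hG.2.isCompact.image (by fun_prop)
    refine HasCompactSupport.intro' hc hc.isClosed fun z hz => ?_
    exact image_eq_zero_of_notMem_tsupport fun h => hz ⟨_, h, rfl⟩

theorem fderiv_comp_graph (hG : IsTest G) (hV : ContDiff ℝ ∞ V) (z a : ℝ × E3 × E3) :
    fderiv ℝ (fun z : ℝ × E3 × E3 => G (z.1, z.2.1, z.2.2, V (z.1, z.2.1))) z a
      = fderiv ℝ G (z.1, z.2.1, z.2.2, V (z.1, z.2.1))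
          (a.1, a.2.1, a.2.2, fderiv ℝ V (z.1, z.2.1) (a.1, a.2.1)) := by
  have h2 : HasFDerivAt (fun z : ℝ × E3 × E3 => z.2.1) _ z :=
    (hasFDerivAt_fst (𝕜 := ℝ) (p := z.2)).comp z (hasFDerivAt_snd (𝕜 := ℝ) (p := z))
  have h3 : HasFDerivAt (fun z : ℝ × E3 × E3 => z.2.2) _ z :=
    (hasFDerivAt_snd (𝕜 := ℝ) (p := z.2)).comp z (hasFDerivAt_snd (𝕜 := ℝ) (p := z))
  have h1 := hasFDerivAt_fst (𝕜 := ℝ) (p := z)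
  have h4 : HasFDerivAt (fun z : ℝ × E3 × E3 => V (z.1, z.2.1)) _ z :=
    ((hV.differentiable (by simp)) (z.1, z.2.1)).hasFDerivAt.comp z (h1.prodMk h2)
  have h5 : HasFDerivAt (fun z : ℝ × E3 × E3 => G (z.1, z.2.1, z.2.2, V (z.1, z.2.1))) _ z :=
    ((hG.1.differentiable (by simp)) (z.1, z.2.1, z.2.2, V (z.1, z.2.1))).hasFDerivAt.comp z
      (h1.prodMk (h2.prodMk (h3.prodMk h4)))
  rw [h5.fderiv]
  simp

end Compose

section Sol
variable {u₀ : E3 → E3} {f₀ : E3 × E3 → ℝ} {u : ℝ → E3 → E3} {Du : ℝ → E3 → E3 →L[ℝ] E3}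
  {f : ℝ → E3 × E3 → ℝ} {T : ℝ} {w : ℝ × E3 → E3}

/-- Exhaustion by cylinders; it upgrades integrability on balls, all that is known of `w`, to
measurability on the whole slab. -/
theorem aestronglyMeasurable_iff_forall_ball {F : Type*} [NormedAddCommGroup F]
    {h : ℝ × E3 → F} : AEStronglyMeasurable h (slab T) ↔
      ∀ R : ℝ, AEStronglyMeasurable h ((slab T).restrict (univ ×ˢ Metric.closedBall 0 R)) := by
  refine ⟨fun hh R => hh.restrict, fun hh => ?_⟩
  have : (⋃ n : ℕ, (univ ×ˢ Metric.closedBall (0 : E3) n : Set (ℝ × E3))) = univ := by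
    rw [← prod_iUnion, Metric.iUnion_closedBall_nat, univ_prod_univ]
  rw [← Measure.restrict_univ (μ := slab T), ← this]
  exact AEStronglyMeasurable.iUnion fun n => hh n

/-- With velocities confined to a ball, a space-time error costs only the volume of that ball; this
carries `L¹` convergence on `ℝ × E3` to phase space. -/
theorem lintegral_slab_ball {h : ℝ × E3 → ℝ≥0∞} (hh : AEMeasurable h) (c : ℝ≥0∞) (R : ℝ) :
    ∫⁻ z : ℝ × E3 × E3, c * ((Metric.closedBall (0 : E3) R).indicator 1 z.2.2 * h (z.1, z.2.1))
        ∂phase T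
      ≤ c * (volume (Metric.closedBall (0 : E3) R) * ∫⁻ y, h y) := by
  have hB : MeasurableSet (Metric.closedBall (0 : E3) R) := Metric.isClosed_closedBall.measurableSet
  have hh' : AEMeasurable h (slab T) := by
    rw [slab_eq_restrict]; exact hh.restrict
  have hm1 : Measurable fun z : ℝ × E3 × E3 => (Metric.closedBall (0 : E3) R).indicator
      (1 : E3 → ℝ≥0∞) z.2.2 := (measurable_one.indicator hB).comp (by fun_prop)
  have hm : AEMeasurable (fun z : ℝ × E3 × E3 =>
      (Metric.closedBall (0 : E3) R).indicator 1 z.2.2 * h (z.1, z.2.1)) (phase T) :=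
    (hm1.aemeasurable (μ := phase T)).mul
      (hh'.comp_quasiMeasurePreserving (quasiMeasurePreserving_slab T))
  rw [lintegral_phase (hm.const_mul c)]
  calc _ = ∫⁻ y, c * (volume (Metric.closedBall (0 : E3) R) * h y) ∂slab T := by
        refine lintegral_congr fun y => ?_
        dsimp only
        rw [lintegral_const_mul _ ((measurable_one.indicator hB).mul_const _),
          lintegral_mul_const _ (measurable_one.indicator hB), lintegral_indicator_one hB]
    _ = c * (volume (Metric.closedBall (0 : E3) R) * ∫⁻ y, h y ∂slab T) := by
        rw [lintegral_const_mul'' _ (hh'.const_mul _), lintegral_const_mul'' _ hh']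
    _ ≤ _ := by
        gcongr
        rw [slab_eq_restrict]; exact Measure.restrict_le_self

/-- The material derivative of a test function of position, velocity and fluid velocity. -/
def materialDeriv (u : ℝ → E3 → E3) (G : ℝ × E3 × E3 × E3 → ℝ) (D : ℝ × E3 → ℝ × E3 →L[ℝ] E3)
    (V : ℝ × E3 → E3) (z : ℝ × E3 × E3) : ℝ :=
  fderiv ℝ G (z.1, z.2.1, z.2.2, V (z.1, z.2.1))
    (1, z.2.2, u z.1 z.2.1 - z.2.2, D (z.1, z.2.1) (1, z.2.2))

/-- Only the first three arguments of `G` are used to localize, so the bound does not involve `V`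
and one dominating function serves all regularizations of the field. -/
theorem abs_materialDeriv_le {G : ℝ × E3 × E3 × E3 → ℝ} {D : ℝ × E3 → ℝ × E3 →L[ℝ] E3}
    {V : ℝ × E3 → E3} {R C : ℝ} (hC : ∀ q, ‖fderiv ℝ G q‖ ≤ C)
    (hR : tsupport G ⊆ Metric.closedBall 0 R) (z : ℝ × E3 × E3) :
    |materialDeriv u G D V z| ≤ if ‖z.2.1‖ ≤ R ∧ ‖z.2.2‖ ≤ R then
      C * (1 + R + (‖u z.1 z.2.1‖ + R) + ‖D (z.1, z.2.1)‖ * (1 + R)) else 0 := by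
  have hC0 : 0 ≤ C := (norm_nonneg _).trans (hC 0)
  by_cases hq : (z.1, z.2.1, z.2.2, V (z.1, z.2.1)) ∈ tsupport G
  · have hb := hR hq
    rw [mem_closedBall_zero_iff, Prod.norm_def, Prod.norm_def, Prod.norm_def, max_le_iff,
      max_le_iff, max_le_iff] at hb
    obtain ⟨h1, h2, h3, -⟩ := hb
    dsimp only at h1 h2 h3
    rw [if_pos ⟨h2, h3⟩]
    have hR0 : 0 ≤ R := (norm_nonneg _).trans h1
    refine ((fderiv ℝ G _).le_opNorm _).trans (mul_le_mul (hC _) ?_ (norm_nonneg _) hC0)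
    have h4 : ‖u z.1 z.2.1 - z.2.2‖ ≤ ‖u z.1 z.2.1‖ + R := (norm_sub_le _ _).trans (by linarith)
    have h5 : ‖D (z.1, z.2.1) (1, z.2.2)‖ ≤ ‖D (z.1, z.2.1)‖ * (1 + R) := by
      refine ((D _).le_opNorm _).trans (mul_le_mul_of_nonneg_left ?_ (norm_nonneg _))
      rw [Prod.norm_def]
      refine max_le (by simp; linarith) (by dsimp only; linarith)
    have h6 := norm_nonneg (u z.1 z.2.1)
    have h7 : 0 ≤ ‖D (z.1, z.2.1)‖ * (1 + R) := by positivity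
    rw [Prod.norm_def, Prod.norm_def, Prod.norm_def]
    refine max_le (by simp; linarith) (max_le (by dsimp only; linarith) (max_le ?_ ?_))
    · dsimp only; linarith
    · dsimp only; linarith
  · rw [materialDeriv, fderiv_of_notMem_tsupport ℝ hq]
    simp only [_root_.zero_apply, abs_zero]
    split_ifs with h
    · have := (norm_nonneg _).trans h.1
      positivity
    · exact le_rfl

theorem aestronglyMeasurable_materialDeriv (hs : IsGlobalWeakSolution u₀ f₀ u Du f)
    {G : ℝ × E3 × E3 × E3 → ℝ} (hG : IsTest G) {D : ℝ × E3 → ℝ × E3 →L[ℝ] E3}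
    {V : ℝ × E3 → E3} (hD : AEStronglyMeasurable D (slab T))
    (hV : AEStronglyMeasurable V (slab T)) :
    AEStronglyMeasurable (materialDeriv u G D V) (phase T) := by
  have hq := quasiMeasurePreserving_slab T
  have hu := (hs.aestronglyMeasurable_u T).comp_quasiMeasurePreserving hq
  have hD' := hD.comp_quasiMeasurePreserving hq
  have hV' := hV.comp_quasiMeasurePreserving hq
  have c1 : AEStronglyMeasurable (fun z : ℝ × E3 × E3 => z.1) (phase T) :=
    (by fun_prop : Continuous fun z : ℝ × E3 × E3 => z.1).aestronglyMeasurable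
  have c2 : AEStronglyMeasurable (fun z : ℝ × E3 × E3 => z.2.1) (phase T) :=
    (by fun_prop : Continuous fun z : ℝ × E3 × E3 => z.2.1).aestronglyMeasurable
  have c3 : AEStronglyMeasurable (fun z : ℝ × E3 × E3 => z.2.2) (phase T) :=
    (by fun_prop : Continuous fun z : ℝ × E3 × E3 => z.2.2).aestronglyMeasurable
  have cd : Continuous (fderiv ℝ G) := hG.1.continuous_fderiv (by simp)
  have hDv : AEStronglyMeasurable (fun z : ℝ × E3 × E3 => D (z.1, z.2.1) (1, z.2.2)) (phase T) :=
    isBoundedBilinearMap_apply.continuous.comp_aestronglyMeasurable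
      (hD'.prodMk (aestronglyMeasurable_const.prodMk c3))
  exact isBoundedBilinearMap_apply.continuous.comp_aestronglyMeasurable
    ((cd.comp_aestronglyMeasurable (c1.prodMk (c2.prodMk (c3.prodMk hV')))).prodMk
      (aestronglyMeasurable_const.prodMk (c3.prodMk ((hu.sub c3).prodMk hDv))))

/-- Transport identity: the weak Vlasov equation may be tested against smooth functions of time,
position, velocity and the fluid velocity. -/
theorem transport_identity (h₀ : IsAdmissible u₀ f₀) (hs : IsGlobalWeakSolution u₀ f₀ u Du f)
    (hw : HasWeakTimeDeriv u T w)
    (hwi : ∀ R, IntegrableOn w (univ ×ˢ Metric.closedBall 0 R) (slab T)) (hT : 0 < T)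
    {G : ℝ × E3 × E3 × E3 → ℝ} (hG : IsTest G) {T' : ℝ} (hT' : T' < T)
    (hGT : ∀ s y, T' ≤ s → G (s, y) = 0) :
    (∫ z, f z.1 z.2 * materialDeriv u G (totalDeriv Du w) (fun y => u y.1 y.2) z ∂phase T)
      + ∫ z, f₀ z * G (0, z.1, z.2, u₀ z.1) = 0 := by
  obtain ⟨K, hK⟩ := hs.exists_ae_abs_f_le T
  have cd : Continuous (fderiv ℝ G) := hG.1.continuous_fderiv (by simp)
  obtain ⟨C, hC⟩ := (hG.2.fderiv ℝ).exists_bound_of_continuous cd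
  obtain ⟨C₀, hC₀⟩ := hG.2.exists_bound_of_continuous hG.1.continuous
  have hC0 : 0 ≤ C := (norm_nonneg _).trans (hC 0)
  obtain ⟨R, hRpos, hR⟩ := hG.2.isCompact.isBounded.subset_closedBall_lt 0 0
  have hGs : tsupport G ⊆ {q | q.1 ≤ T'} := closure_minimal
    (fun q hq => le_of_not_ge fun h => hq (hGT q.1 q.2 h)) (isClosed_le continuous_fst continuous_const)
  have hδpos : ∀ n : ℕ, (0 : ℝ) < 1 / ((n : ℝ) + 1) := fun n => by positivity
  choose κ hκ hsupp using fun n : ℕ => exists_forward_mollifier (hδpos n)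
  have hδ : Tendsto (fun n : ℕ => 1 / ((n : ℝ) + 1)) atTop (𝓝 0) :=
    tendsto_one_div_add_atTop_nhds_zero_nat
  have hδ2 : Tendsto (fun n : ℕ => 2 * (1 / ((n : ℝ) + 1))) atTop (𝓝 0) := by
    simpa using hδ.const_mul 2
  have hDi : ∀ R, IntegrableOn (totalDeriv Du w) (univ ×ˢ Metric.closedBall 0 R) (slab T) := fun R =>
    integrableOn_totalDeriv (integrable_ball_of_memLp (by norm_num) (memLp_Du hs T) R) (hwi R)
  -- The extra unit of radius leaves room for the kernel, whose spatial reach is at most `1`, around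
  -- points of the ball of radius `R`.
  set U := cut T (R + 1) fun y => u y.1 y.2 with hUdef
  set D := cut T (R + 1) (totalDeriv Du w) with hDdef
  have hUi : Integrable U :=
    integrable_cut (integrable_ball_of_memLp (by norm_num) (hs.memLp_u T) _)
  have hDint : Integrable D := integrable_cut (hDi _)
  set V : ℕ → ℝ × E3 → E3 := fun n => (κ n) ⋆[ContinuousLinearMap.lsmul ℝ ℝ, volume] U with hV
  set W : ℕ → ℝ × E3 → ℝ × E3 →L[ℝ] E3 :=
    fun n => (κ n) ⋆[ContinuousLinearMap.lsmul ℝ ℝ, volume] D with hW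
  have hVs : ∀ n, ContDiff ℝ ∞ (V n) := fun n =>
    (hκ n).compact.contDiff_convolution_left (n := ⊤) _ (hκ n).smooth hUi.locallyIntegrable
  have hWs : ∀ n, Continuous (W n) := fun n =>
    (hκ n).compact.continuous_convolution_left _ (hκ n).smooth.continuous hDint.locallyIntegrable
  have hsn : ∀ n y, κ n y ≠ 0 → ‖y‖ ≤ 2 * (1 / ((n : ℝ) + 1)) := fun n y hy =>
    (hsupp n y (subset_tsupport _ hy)).2.2.2
  have hVlim := tendsto_lintegral_convolution_sub hκ hδ2 hsn hUi
  have hWlim := tendsto_lintegral_convolution_sub hκ hδ2 hsn hDint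
  have hV0lim := tendsto_mollified_initial hs hw hwi hT hκ hδ hsupp (R + 1)
  -- almost everywhere convergent subsequence
  have hu0 : MemLp u₀ 2 := h₀.u_mem
  obtain ⟨n₁, hn₁, hae₁⟩ := exists_subseq_ae_tendsto_of_L1
    (fun n => (hVs n).continuous.aestronglyMeasurable) hUi.1 hVlim
  -- The slice `s = 0` is null in space-time, so almost everywhere convergence of the traces must be
  -- extracted separately.
  obtain ⟨n₂, hn₂, hae₂⟩ := exists_subseq_ae_tendsto_of_L1
    (h := fun k x => V (n₁ k) (0, x)) (g := (Metric.closedBall (0 : E3) (R + 1)).indicator u₀)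
    (fun k => ((hVs _).continuous.comp (by fun_prop)).aestronglyMeasurable)
    (hu0.1.indicator Metric.isClosed_closedBall.measurableSet) (hV0lim.comp hn₁.tendsto_atTop)
  set ns := n₁ ∘ n₂ with hns
  have hnsT : Tendsto ns atTop atTop := hn₁.tendsto_atTop.comp hn₂.tendsto_atTop
  have haeV : ∀ᵐ y, Tendsto (fun k => V (ns k) y) atTop (𝓝 (U y)) := by
    filter_upwards [hae₁] with y hy using hy.comp hn₂.tendsto_atTop
  -- the equation for the regularized field
  have heq : ∀ n, (∫ z, f z.1 z.2 * materialDeriv u G (fun y => fderiv ℝ (V n) y) (V n) z ∂phase T)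
      + ∫ z, f₀ z * G (0, z.1, z.2, V n (0, z.1)) = 0 := fun n => by
    have := hs.weak_vlasov h₀ (T := T) (isTest_comp_graph hG (hVs n))
      (fun s z hsT => hGT _ _ (hT'.le.trans hsT))
    simp_rw [fderiv_comp_graph hG (hVs n)] at this
    exact this
  have hFi : ∀ n, Integrable (fun z => f z.1 z.2 *
      materialDeriv u G (fun y => fderiv ℝ (V n) y) (V n) z) (phase T) := fun n => by
    have := integrable_mul_fderiv_test hs (T := T) (isTest_comp_graph hG (hVs n))
    simp_rw [fderiv_comp_graph hG (hVs n)] at this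
    exact this
  have hlim1 : Tendsto (fun k => ∫ z, f z.1 z.2 *
      materialDeriv u G (fun y => fderiv ℝ (V (ns k)) y) (V (ns k)) z ∂phase T) atTop
      (𝓝 (∫ z, f z.1 z.2 * materialDeriv u G (totalDeriv Du w) (fun y => u y.1 y.2) z
        ∂phase T)) := by
    have hDm : AEStronglyMeasurable (totalDeriv Du w) (slab T) := by
      refine (aestronglyMeasurable_iff_forall_ball (T := T)).2 fun R => (hDi R).1
    have hVm : ∀ n, AEStronglyMeasurable (V n) (slab T) := fun n =>
      (hVs n).continuous.aestronglyMeasurable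
    have hfm := hs.aestronglyMeasurable_f T
    have hA := hfm.mul (aestronglyMeasurable_materialDeriv hs hG hDm (hs.aestronglyMeasurable_u T))
    have hAk := fun k => hfm.mul (aestronglyMeasurable_materialDeriv hs hG hDm (hVm (ns k)))
    refine tendsto_integral_of_L1 _ hA (Eventually.of_forall fun k => hFi _) ?_
    -- replacing the regularized derivative
    set c : ℝ≥0∞ := ENNReal.ofReal (K * (C * (1 + R)))
    have hB1 : ∀ᶠ k in atTop, ∫⁻ z, ‖f z.1 z.2 *
          materialDeriv u G (fun y => fderiv ℝ (V (ns k)) y) (V (ns k)) z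
          - f z.1 z.2 * materialDeriv u G (totalDeriv Du w) (V (ns k)) z‖ₑ ∂phase T
        ≤ c * (volume (Metric.closedBall (0 : E3) R) * ∫⁻ y, ‖W (ns k) y - D y‖ₑ) := by
      filter_upwards [hnsT.eventually (hδ2.eventually (gt_mem_nhds (sub_pos.2 hT'))),
        hnsT.eventually (hδ.eventually (gt_mem_nhds one_pos))] with k hk1 hk2
      refine le_trans (lintegral_mono_ae ?_)
        (lintegral_slab_ball (T := T) (h := fun y => ‖W (ns k) y - D y‖ₑ)
          ((hWs _).aestronglyMeasurable.sub hDint.1).enorm c R)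
      have hsT : ∀ᵐ z ∂phase T, z.1 ∈ Ioo 0 T :=
        Measure.quasiMeasurePreserving_fst.ae (ae_restrict_mem measurableSet_Ioo)
      filter_upwards [hK, hsT] with z hz hzT
      by_cases hq : (z.1, z.2.1, z.2.2, V (ns k) (z.1, z.2.1)) ∈ tsupport G
      · have hb := hR hq
        rw [mem_closedBall_zero_iff, Prod.norm_def, Prod.norm_def, Prod.norm_def, max_le_iff,
          max_le_iff, max_le_iff] at hb
        obtain ⟨-, h2, h3, -⟩ := hb
        have hqT : z.1 ≤ T' := hGs hq
        dsimp only at h2 h3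
        -- On the support of `G` one has `s ≤ T'`, and the kernel reaches forward by less than `T -
        -- T'`: the sampled times remain in `(0,T)`.
        have e1 : fderiv ℝ (V (ns k)) (z.1, z.2.1) = W (ns k) (z.1, z.2.1) := by
          refine fderiv_mollified hs hw hwi (hκ _) fun y hy => ?_
          obtain ⟨g1, g2, g3, -⟩ := hsupp _ _ hy
          simp only [Prod.fst_sub, Prod.snd_sub] at g1 g2 g3
          refine ⟨⟨by linarith [hzT.1], by linarith⟩, mem_closedBall_zero_iff.2 ?_⟩
          have : y.2 = z.2.1 - (z.2.1 - y.2) := by abel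
          rw [this]
          exact (norm_sub_le _ _).trans (by linarith)
        have e2 : D (z.1, z.2.1) = totalDeriv Du w (z.1, z.2.1) :=
          cut_of_mem _ hzT (by linarith)
        have e3 : f z.1 z.2 * materialDeriv u G (fun y => fderiv ℝ (V (ns k)) y) (V (ns k)) z
            - f z.1 z.2 * materialDeriv u G (totalDeriv Du w) (V (ns k)) z
            = f z.1 z.2 * fderiv ℝ G (z.1, z.2.1, z.2.2, V (ns k) (z.1, z.2.1))
              (0, 0, 0, (W (ns k) (z.1, z.2.1) - D (z.1, z.2.1)) (1, z.2.2)) := by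
          rw [← mul_sub, materialDeriv, materialDeriv, ← map_sub, e1, e2]
          simp
        rw [e3, indicator_of_mem (mem_closedBall_zero_iff.2 h3), Pi.one_apply, one_mul,
          ← ofReal_norm (W (ns k) (z.1, z.2.1) - D (z.1, z.2.1)), ← ENNReal.ofReal_mul (by positivity),
          ← ofReal_norm]
        refine ENNReal.ofReal_le_ofReal ?_
        rw [norm_mul, mul_assoc]
        refine mul_le_mul hz ?_ (norm_nonneg _) K.2
        rw [mul_assoc]
        refine ((fderiv ℝ G _).le_opNorm _).trans (mul_le_mul (hC _) ?_ (norm_nonneg _) hC0)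
        have h5 : ‖(W (ns k) (z.1, z.2.1) - D (z.1, z.2.1)) (1, z.2.2)‖
            ≤ (1 + R) * ‖W (ns k) (z.1, z.2.1) - D (z.1, z.2.1)‖ := by
          rw [mul_comm]
          refine (ContinuousLinearMap.le_opNorm _ _).trans
            (mul_le_mul_of_nonneg_left ?_ (norm_nonneg _))
          rw [Prod.norm_def]
          exact max_le (by simp; linarith) (by dsimp only; linarith)
        simpa [Prod.norm_def] using h5
      · simp [materialDeriv, fderiv_of_notMem_tsupport ℝ hq]
    have hB2 : Tendsto (fun k => c * (volume (Metric.closedBall (0 : E3) R) *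
        ∫⁻ y, ‖W (ns k) y - D y‖ₑ)) atTop (𝓝 0) := by
      have h1 := ENNReal.Tendsto.const_mul (a := volume (Metric.closedBall (0 : E3) R))
        (hWlim.comp hnsT) (Or.inr measure_closedBall_lt_top.ne)
      have h2 := ENNReal.Tendsto.const_mul (a := c) h1 (Or.inr ENNReal.ofReal_ne_top)
      simpa using h2
    -- the pointwise limit in the argument
    have hA1 : Tendsto (fun k => ∫⁻ z, ENNReal.ofReal ‖f z.1 z.2 *
          materialDeriv u G (totalDeriv Du w) (V (ns k)) z
          - f z.1 z.2 * materialDeriv u G (totalDeriv Du w) (fun y => u y.1 y.2) z‖ ∂phase T)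
        atTop (𝓝 0) := by
      set bd : ℝ × E3 × E3 → ℝ := fun z => if ‖z.2.1‖ ≤ R ∧ ‖z.2.2‖ ≤ R then
        K * (C * (1 + R + (‖u z.1 z.2.1‖ + R) + ‖totalDeriv Du w (z.1, z.2.1)‖ * (1 + R)))
        else 0 with hbd
      have hbdi : Integrable bd (phase T) := by
        have : IsFiniteMeasure ((slab T).restrict (univ ×ˢ Metric.closedBall 0 R)) :=
          ⟨by simpa using slab_ball_lt_top T R⟩
        have hui := integrable_ball_of_memLp (by norm_num) (hs.memLp_u T) R
        refine integrable_of_le_cutoff (R := R) (h := fun y => K * (C * (1 + R + (‖u y.1 y.2‖ + R)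
          + ‖totalDeriv Du w y‖ * (1 + R)))) ?_ ?_ (ae_of_all _ fun z => ?_)
        · exact ((((integrable_const (1 + R)).add (hui.norm.add (integrable_const R))).add
            ((hDi R).norm.mul_const _)).const_mul C).const_mul _
        · have hq := quasiMeasurePreserving_slab T
          have m1 := (hs.aestronglyMeasurable_u T).norm.comp_quasiMeasurePreserving hq
          have m2 := hDm.norm.comp_quasiMeasurePreserving hq
          have hset : MeasurableSet ({z : ℝ × E3 × E3 | ‖z.2.1‖ ≤ R} ∩ {z | ‖z.2.2‖ ≤ R}) :=
            (measurableSet_le (by fun_prop) measurable_const).inter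
              (measurableSet_le (by fun_prop) measurable_const)
          have m3 : AEStronglyMeasurable (fun z : ℝ × E3 × E3 => K * (C * (1 + R +
              (‖u z.1 z.2.1‖ + R) + ‖totalDeriv Du w (z.1, z.2.1)‖ * (1 + R)))) (phase T) :=
            ((((aestronglyMeasurable_const (b := 1 + R)).add
              (m1.add (aestronglyMeasurable_const (b := R)))).add
              (m2.mul (aestronglyMeasurable_const (b := 1 + R)))).const_mul C).const_mul K
          refine (m3.indicator hset).congr (ae_of_all _ fun z => ?_)
          by_cases hx : ‖z.2.1‖ ≤ R <;> by_cases hv : ‖z.2.2‖ ≤ R <;> simp [indicator, hbd, hx, hv]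
        · rw [hbd]
          dsimp only
          split_ifs
          · rw [abs_of_nonneg (by positivity)]
          · simp
      refine tendsto_lintegral_norm_of_dominated_convergence (bound := bd) hAk hbdi.2 ?_ ?_
      · intro k
        filter_upwards [hK] with z hz
        have h1 := abs_materialDeriv_le (u := u) (D := totalDeriv Du w) (V := V (ns k)) hC hR z
        rw [norm_mul]
        refine (mul_le_mul hz h1 (abs_nonneg _) K.2).trans (le_of_eq ?_)
        rw [hbd, mul_ite, mul_zero]
      · have h1 : ∀ᵐ y ∂slab T, Tendsto (fun k => V (ns k) y) atTop (𝓝 (U y)) := by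
          rw [slab_eq_restrict]; exact ae_restrict_of_ae haeV
        have hsT : ∀ᵐ z ∂phase T, z.1 ∈ Ioo 0 T :=
          Measure.quasiMeasurePreserving_fst.ae (ae_restrict_mem measurableSet_Ioo)
        filter_upwards [(quasiMeasurePreserving_slab T).ae h1, hsT] with z hz hzT
        refine Tendsto.const_mul _ ?_
        by_cases hzR : ‖z.2.1‖ ≤ R
        · have hU' : U (z.1, z.2.1) = u z.1 z.2.1 := cut_of_mem _ hzT (by linarith)
          rw [hU'] at hz
          have h2 : Tendsto (fun k => fderiv ℝ G (z.1, z.2.1, z.2.2, V (ns k) (z.1, z.2.1))) atTop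
              (𝓝 (fderiv ℝ G (z.1, z.2.1, z.2.2, u z.1 z.2.1))) := (cd.tendsto _).comp ((tendsto_const_nhds (x := z.1)).prodMk_nhds
            ((tendsto_const_nhds (x := z.2.1)).prodMk_nhds
              ((tendsto_const_nhds (x := z.2.2)).prodMk_nhds hz)))
          exact ((ContinuousLinearMap.apply ℝ ℝ ((1 : ℝ), z.2.2, u z.1 z.2.1 - z.2.2,
            totalDeriv Du w (z.1, z.2.1) (1, z.2.2))).continuous.tendsto _).comp h2
        -- Outside the ball the truncated limit `U` need not be `u`, but there the derivative of `G`
        -- vanishes whatever its last argument.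
        · have h0 : ∀ V', materialDeriv u G (totalDeriv Du w) V' z = 0 := fun V' => by
            rw [materialDeriv, fderiv_of_notMem_tsupport ℝ]
            · simp
            · intro h
              have := hR h
              rw [mem_closedBall_zero_iff, Prod.norm_def, Prod.norm_def, max_le_iff,
                max_le_iff] at this
              exact hzR this.2.1
          simp [h0]
    have hsum := hB2.add hA1
    rw [add_zero] at hsum
    -- The `L¹` error is the sum of two: the replacement of the mollified derivative by the true
    -- one, and the change of the last argument of `G`.
    refine tendsto_of_tendsto_of_tendsto_of_le_of_le' tendsto_const_nhds hsum
      (Eventually.of_forall fun _ => zero_le) ?_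
    filter_upwards [hB1] with k hk
    refine le_trans ?_ (add_le_add hk le_rfl)
    rw [← lintegral_add_right']
    · refine lintegral_mono fun z => ?_
      dsimp only
      rw [ofReal_norm, Pi.mul_apply]
      refine le_trans (le_of_eq ?_) (enorm_add_le _ _)
      rw [sub_add_sub_cancel]
    · exact ((hAk k).sub hA).norm.aemeasurable.ennreal_ofReal
  have hlim2 : Tendsto (fun k => ∫ z, f₀ z * G (0, z.1, z.2, V (ns k) (0, z.1))) atTop
      (𝓝 (∫ z, f₀ z * G (0, z.1, z.2, u₀ z.1))) := by
    refine tendsto_integral_of_dominated_convergence (fun z => |f₀ z| * C₀) (fun k => ?_) ?_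
      (fun k => ae_of_all _ fun z => ?_) ?_
    · refine h₀.f_mem_one.1.mul (Continuous.aestronglyMeasurable ?_)
      exact hG.1.continuous.comp (continuous_const.prodMk (continuous_fst.prodMk
        (continuous_snd.prodMk ((hVs _).continuous.comp (continuous_const.prodMk continuous_fst)))))
    · exact (memLp_one_iff_integrable.1 h₀.f_mem_one).norm.mul_const C₀
    · rw [norm_mul]
      exact mul_le_mul_of_nonneg_left (hC₀ _) (norm_nonneg _)
    · filter_upwards [Measure.quasiMeasurePreserving_fst.ae hae₂] with z hz
      refine Tendsto.const_mul _ ?_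
      by_cases hzR : ‖z.1‖ ≤ R
      · rw [indicator_of_mem (mem_closedBall_zero_iff.2 (by linarith))] at hz
        exact (hG.1.continuous.tendsto _).comp (tendsto_const_nhds.prodMk_nhds
          (tendsto_const_nhds.prodMk_nhds (tendsto_const_nhds.prodMk_nhds hz)))
      · have h0 : ∀ y, G (0, z.1, z.2, y) = 0 := fun y =>
          image_eq_zero_of_notMem_tsupport fun h => hzR (by
            have := hR h
            rw [mem_closedBall_zero_iff, Prod.norm_def, Prod.norm_def, max_le_iff,
              max_le_iff] at this
            exact this.2.1)
        simp [h0]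
  refine tendsto_nhds_unique (hlim1.add hlim2) ?_
  simp_rw [heq]
  exact tendsto_const_nhds

end Sol

/-! ### Cutoffs, smooth powers and Young's inequality -/

/-- Cutoffs on balls of radius `n + 1`. -/
theorem exists_cutoff : ∃ (χ : ℕ → E3 → ℝ) (C : ℝ), 0 ≤ C ∧ (∀ n, IsTest (χ n)) ∧
    (∀ n x, |χ n x| ≤ 1) ∧ (∀ n x h, |fderiv ℝ (χ n) x h| ≤ C / ((n : ℝ) + 1) * ‖h‖) ∧
    (∀ n x, χ n x ≠ 0 → ‖x‖ ≤ 2 * ((n : ℝ) + 1)) ∧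
    (∀ x, ∀ᶠ n in atTop, χ n x = 1 ∧ fderiv ℝ (χ n) x = 0) := by
  let b : ContDiffBump (0 : E3) := ⟨1, 2, by norm_num, by norm_num⟩
  have hb : ContDiff ℝ ∞ b := b.contDiff
  have hbd : Continuous (fderiv ℝ b) := hb.continuous_fderiv (by simp)
  obtain ⟨C, hC⟩ := (b.hasCompactSupport.fderiv ℝ).exists_bound_of_continuous hbd
  have hN : ∀ n : ℕ, (0 : ℝ) < (n : ℝ) + 1 := fun n => by positivity
  have hder : ∀ (n : ℕ) x, fderiv ℝ (fun x => b (((n : ℝ) + 1)⁻¹ • x)) x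
      = ((n : ℝ) + 1)⁻¹ • fderiv ℝ b (((n : ℝ) + 1)⁻¹ • x) := fun n x => by
    have h1 : HasFDerivAt (fun x => b (((n : ℝ) + 1)⁻¹ • x)) _ x :=
      ((hb.differentiable (by simp)) (((n : ℝ) + 1)⁻¹ • x)).hasFDerivAt.comp x
        ((hasFDerivAt_id x).const_smul ((n : ℝ) + 1)⁻¹)
    rw [h1.fderiv]
    ext h; simp
  refine ⟨fun n x => b (((n : ℝ) + 1)⁻¹ • x), C, (norm_nonneg _).trans (hC 0), fun n => ⟨?_, ?_⟩,
    fun n x => ?_, fun n x h => ?_, fun n x hx => ?_, fun x => ?_⟩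
  · exact hb.comp (contDiff_const_smul _)
  · exact b.hasCompactSupport.comp_homeomorph
      (Homeomorph.smulOfNeZero ((n : ℝ) + 1)⁻¹ (inv_ne_zero (hN n).ne'))
  · rw [abs_of_nonneg b.nonneg]; exact b.le_one
  · rw [hder]
    have h1 := (fderiv ℝ b (((n : ℝ) + 1)⁻¹ • x)).le_of_opNorm_le (hC _) h
    rw [_root_.smul_apply, smul_eq_mul, abs_mul, abs_of_pos (inv_pos.2 (hN n)), div_eq_inv_mul,
      mul_assoc]
    exact mul_le_mul_of_nonneg_left h1 (inv_pos.2 (hN n)).le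
  · have : (((n : ℝ) + 1)⁻¹ • x) ∈ Function.support b := hx
    rw [b.support_eq, mem_ball_zero_iff, norm_smul, norm_inv, Real.norm_of_nonneg (hN n).le,
      inv_mul_lt_iff₀ (hN n)] at this
    have h2 : b.rOut = 2 := rfl
    rw [h2] at this
    linarith
  · filter_upwards [eventually_gt_atTop ⌈‖x‖⌉₊] with n hn
    have hx : ((n : ℝ) + 1)⁻¹ • x ∈ Metric.ball (0 : E3) b.rIn := by
      rw [mem_ball_zero_iff, norm_smul, norm_inv, Real.norm_of_nonneg (hN n).le,
        inv_mul_lt_iff₀ (hN n)]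
      have h1 : ‖x‖ ≤ n := (Nat.le_ceil _).trans (by exact_mod_cast hn.le)
      have h2 : b.rIn = 1 := rfl
      rw [h2]; linarith
    have h1 := b.eventuallyEq_one_of_mem_ball hx
    refine ⟨h1.eq_of_nhds, ?_⟩
    rw [hder, h1.fderiv_eq]
    simp

theorem sq_rpow_half {x : ℝ} (hx : 0 ≤ x) (q : ℝ) : (x ^ 2) ^ q = x ^ (2 * q) := by
  rw [Real.rpow_mul hx]; norm_num

/-- Smooth compactly supported approximations of `|ξ|^p`. -/
theorem exists_approx_rpow {p : ℝ} (hp : 2 ≤ p) : ∃ (Φ : ℕ → E3 → ℝ) (C : ℝ), 0 ≤ C ∧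
    (∀ n, IsTest (Φ n)) ∧ (∀ n ξ, |Φ n ξ| ≤ (1 + ‖ξ‖) ^ p) ∧
    (∀ n ξ h, |fderiv ℝ (Φ n) ξ h| ≤ C * (1 + ‖ξ‖) ^ (p - 1) * ‖h‖) ∧
    (∀ n ξ, Φ n ξ ≠ 0 → ‖ξ‖ ≤ 2 * ((n : ℝ) + 1)) ∧
    (∀ ξ, Tendsto (fun n => Φ n ξ) atTop (𝓝 (‖ξ‖ ^ p))) ∧
    (∀ ξ h, Tendsto (fun n => fderiv ℝ (Φ n) ξ h) atTop (𝓝 (p * ‖ξ‖ ^ (p - 2) * inner ℝ ξ h))) := by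
  obtain ⟨χ, L, hL, hχ, hχ1, hχd, hχs, hχl⟩ := exists_cutoff
  have hN : ∀ n : ℕ, (0 : ℝ) < 1 / ((n : ℝ) + 1) := fun n => by positivity
  have hN1 : ∀ n : ℕ, 1 / ((n : ℝ) + 1) ≤ (1 : ℝ) := fun n => by
    rw [div_le_one (by positivity)]; linarith [(Nat.cast_nonneg n : (0 : ℝ) ≤ n)]
  have hbase : ∀ (n : ℕ) (ξ : E3), 0 < 1 / ((n : ℝ) + 1) + ‖ξ‖ ^ 2 := fun n ξ => by
    have := hN n; positivity
  have hbase2 : ∀ (n : ℕ) (ξ : E3), 1 / ((n : ℝ) + 1) + ‖ξ‖ ^ 2 ≤ (1 + ‖ξ‖) ^ 2 := fun n ξ => by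
    nlinarith [hN1 n, norm_nonneg ξ]
  -- The positive shift keeps the base away from zero, so the power is smooth at the origin. In the
  -- limit the exponent `p / 2 - 1` is nonnegative because `p ≥ 2`.
  set H : ℕ → E3 → ℝ := fun n ξ => (1 / ((n : ℝ) + 1) + ‖ξ‖ ^ 2) ^ (p / 2) with hH
  have hHs : ∀ n, ContDiff ℝ ∞ (H n) := fun n => by
    refine ContDiff.rpow_const_of_ne ?_ fun ξ => (hbase n ξ).ne'
    exact contDiff_const.add (contDiff_norm_sq ℝ)
  have hHd : ∀ n ξ h, fderiv ℝ (H n) ξ h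
      = p * (1 / ((n : ℝ) + 1) + ‖ξ‖ ^ 2) ^ (p / 2 - 1) * inner ℝ ξ h := fun n ξ h => by
    have h1 : HasFDerivAt (fun ξ : E3 => 1 / ((n : ℝ) + 1) + ‖ξ‖ ^ 2) _ ξ :=
      ((hasStrictFDerivAt_norm_sq ξ).hasFDerivAt).const_add _
    have h2 : HasFDerivAt (H n) _ ξ := h1.rpow_const (p := p / 2) (Or.inl (hbase n ξ).ne')
    rw [h2.fderiv]
    simp
    ring
  have hH0 : ∀ n ξ, 0 ≤ H n ξ := fun n ξ => Real.rpow_nonneg (hbase n ξ).le _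
  have hHb : ∀ n ξ, H n ξ ≤ (1 + ‖ξ‖) ^ p := fun n ξ => by
    calc H n ξ ≤ ((1 + ‖ξ‖) ^ 2) ^ (p / 2) :=
          Real.rpow_le_rpow (hbase n ξ).le (hbase2 n ξ) (by linarith)
      _ = _ := by rw [sq_rpow_half (by positivity)]; congr 1; ring
  have hHdb : ∀ n ξ h, |fderiv ℝ (H n) ξ h| ≤ p * (1 + ‖ξ‖) ^ (p - 1) * ‖h‖ := fun n ξ h => by
    rw [hHd, abs_mul, abs_mul, abs_of_nonneg (by linarith : 0 ≤ p),
      abs_of_nonneg (Real.rpow_nonneg (hbase n ξ).le _)]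
    have h1 : (1 / ((n : ℝ) + 1) + ‖ξ‖ ^ 2) ^ (p / 2 - 1) ≤ (1 + ‖ξ‖) ^ (p - 2) := by
      calc _ ≤ ((1 + ‖ξ‖) ^ 2) ^ (p / 2 - 1) :=
            Real.rpow_le_rpow (hbase n ξ).le (hbase2 n ξ) (by linarith)
        _ = _ := by rw [sq_rpow_half (by positivity)]; congr 1; ring
    have h2 : |inner ℝ ξ h| ≤ (1 + ‖ξ‖) * ‖h‖ := (abs_real_inner_le_norm ξ h).trans
      (mul_le_mul_of_nonneg_right (by linarith) (norm_nonneg _))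
    have h3 : (1 + ‖ξ‖) ^ (p - 1) = (1 + ‖ξ‖) ^ (p - 2) * (1 + ‖ξ‖) := by
      rw [← Real.rpow_add_one (by positivity)]; congr 1; ring
    rw [h3]
    calc _ ≤ p * (1 + ‖ξ‖) ^ (p - 2) * ((1 + ‖ξ‖) * ‖h‖) := by
          refine mul_le_mul (mul_le_mul_of_nonneg_left h1 (by linarith)) h2 (abs_nonneg _) ?_
          have := Real.rpow_nonneg (by positivity : 0 ≤ 1 + ‖ξ‖) (p - 2)
          have : 0 ≤ p := by linarith
          positivity
      _ = _ := by ring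
  have hlim : ∀ (ξ : E3) (q : ℝ), 0 ≤ q → Tendsto (fun n : ℕ => (1 / ((n : ℝ) + 1) + ‖ξ‖ ^ 2) ^ q)
      atTop (𝓝 (‖ξ‖ ^ (2 * q))) := fun ξ q hq => by
    rw [← sq_rpow_half (norm_nonneg ξ)]
    have h1 : Tendsto (fun n : ℕ => 1 / ((n : ℝ) + 1) + ‖ξ‖ ^ 2) atTop (𝓝 (‖ξ‖ ^ 2)) := by
      simpa using (tendsto_one_div_add_atTop_nhds_zero_nat (𝕜 := ℝ)).add_const (‖ξ‖ ^ 2)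
    exact h1.rpow_const (Or.inr hq)
  have hder : ∀ n ξ h, fderiv ℝ (fun ξ => χ n ξ * H n ξ) ξ h
      = χ n ξ * fderiv ℝ (H n) ξ h + fderiv ℝ (χ n) ξ h * H n ξ := fun n ξ h => by
    have h1 := ((hχ n).1.differentiable (by simp) ξ).hasFDerivAt.mul
      ((hHs n).differentiable (by simp) ξ).hasFDerivAt
    have h2 : fderiv ℝ (fun ξ => χ n ξ * H n ξ) ξ = _ := h1.fderiv
    rw [h2]
    simp [mul_comm]
  refine ⟨fun n ξ => χ n ξ * H n ξ, p + 3 * L, by positivity, fun n => ⟨(hχ n).1.mul (hHs n),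
    (hχ n).2.mul_right⟩, fun n ξ => ?_, fun n ξ h => ?_, fun n ξ hξ => ?_, fun ξ => ?_,
    fun ξ h => ?_⟩
  · rw [abs_mul, abs_of_nonneg (hH0 n ξ)]
    exact (mul_le_of_le_one_left (hH0 n ξ) (hχ1 n ξ)).trans (hHb n ξ)
  · rw [hder]
    have hP := Real.rpow_nonneg (by positivity : 0 ≤ 1 + ‖ξ‖) (p - 1)
    have t1 : |χ n ξ * fderiv ℝ (H n) ξ h| ≤ p * (1 + ‖ξ‖) ^ (p - 1) * ‖h‖ := by
      rw [abs_mul]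
      exact (mul_le_of_le_one_left (abs_nonneg _) (hχ1 n ξ)).trans (hHdb n ξ h)
    -- On the support of the cutoff `1 + ‖ξ‖ ≤ 3 (n + 1)`, which compensates its gradient of size `L
    -- / (n + 1)`; hence the constant `3 L`.
    have t2 : |fderiv ℝ (χ n) ξ h * H n ξ| ≤ 3 * L * (1 + ‖ξ‖) ^ (p - 1) * ‖h‖ := by
      by_cases hξ : ‖ξ‖ ≤ 2 * ((n : ℝ) + 1)
      · rw [abs_mul, abs_of_nonneg (hH0 n ξ)]
        have h3 : (1 + ‖ξ‖) ^ p = (1 + ‖ξ‖) ^ (p - 1) * (1 + ‖ξ‖) := by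
          rw [← Real.rpow_add_one (by positivity)]; congr 1; ring
        have hn : (0 : ℝ) < (n : ℝ) + 1 := by positivity
        calc _ ≤ (L / ((n : ℝ) + 1) * ‖h‖) * ((1 + ‖ξ‖) ^ (p - 1) * (3 * ((n : ℝ) + 1))) := by
              refine mul_le_mul (hχd n ξ h) ((hHb n ξ).trans ?_) (hH0 n ξ) (by positivity)
              rw [h3]
              refine mul_le_mul_of_nonneg_left ?_ hP
              linarith [(Nat.cast_nonneg n : (0 : ℝ) ≤ n)]
          _ = _ := by field_simp
      · have : fderiv ℝ (χ n) ξ = 0 := by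
          refine fderiv_of_notMem_tsupport ℝ fun hm => hξ ?_
          have hcl : tsupport (χ n) ⊆ Metric.closedBall 0 (2 * ((n : ℝ) + 1)) :=
            closure_minimal (fun y hy => mem_closedBall_zero_iff.2 (hχs n y hy))
              Metric.isClosed_closedBall
          exact mem_closedBall_zero_iff.1 (hcl hm)
        rw [this]
        simp only [_root_.zero_apply, zero_mul, abs_zero]
        positivity
    calc _ ≤ _ := abs_add_le _ _
      _ ≤ p * (1 + ‖ξ‖) ^ (p - 1) * ‖h‖ + 3 * L * (1 + ‖ξ‖) ^ (p - 1) * ‖h‖ := add_le_add t1 t2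
      _ = _ := by ring
  · exact hχs n ξ (left_ne_zero_of_mul hξ)
  · have h1 := hlim ξ (p / 2) (by linarith)
    rw [show 2 * (p / 2) = p by ring] at h1
    refine h1.congr' ?_
    filter_upwards [hχl ξ] with n hn
    rw [hn.1, one_mul]
  · have h1 := ((hlim ξ (p / 2 - 1) (by linarith)).const_mul p).mul_const (inner ℝ ξ h)
    rw [show 2 * (p / 2 - 1) = p - 2 by ring] at h1
    refine h1.congr' ?_
    filter_upwards [hχl ξ] with n hn
    rw [hder, hn.1, hn.2, hHd]; simp

/-- Young's inequality by cases: if `B ≤ ε A` the first term suffices, otherwise `A ≤ ε⁻¹ B` and the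
second does. -/
theorem rpow_sub_one_mul_le {p ε A B : ℝ} (hp : 1 ≤ p) (hε : 0 < ε) (hA : 0 ≤ A) (hB : 0 ≤ B) :
    A ^ (p - 1) * B ≤ ε * A ^ p + (ε⁻¹) ^ (p - 1) * B ^ p := by
  have hAp := Real.rpow_nonneg hA p
  have hBp := Real.rpow_nonneg hB p
  have he := Real.rpow_nonneg (inv_pos.2 hε).le (p - 1)
  have hsplit : ∀ {X : ℝ}, 0 ≤ X → X ^ (p - 1) * X = X ^ p := fun {X} hX => by
    rcases hX.eq_or_lt with h | h
    · rw [← h, mul_zero, Real.zero_rpow (by linarith)]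
    · rw [← Real.rpow_add_one h.ne']; congr 1; ring
  rcases le_total B (ε * A) with h | h
  · have : A ^ (p - 1) * B ≤ A ^ (p - 1) * (ε * A) :=
      mul_le_mul_of_nonneg_left h (Real.rpow_nonneg hA _)
    have e1 : A ^ (p - 1) * (ε * A) = ε * A ^ p := by rw [← hsplit hA]; ring
    nlinarith [mul_nonneg he hBp]
  · have hA' : A ≤ ε⁻¹ * B := by rw [inv_mul_eq_div, le_div_iff₀ hε]; linarith
    have : A ^ (p - 1) * B ≤ (ε⁻¹ * B) ^ (p - 1) * B :=
      mul_le_mul_of_nonneg_right (Real.rpow_le_rpow hA hA' (by linarith)) hB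
    rw [Real.mul_rpow (inv_pos.2 hε).le hB, mul_assoc, hsplit hB] at this
    nlinarith [mul_nonneg hε.le hAp]

/-- Test functions of product form in time, position, velocity and relative velocity. -/
def productTest (θ : ℝ → ℝ) (χ Φ : E3 → ℝ) (q : ℝ × E3 × E3 × E3) : ℝ :=
  θ q.1 * (χ q.2.1 * (χ q.2.2.1 * Φ (q.2.2.1 - q.2.2.2)))

/-- `χ` confines `v` and `Φ` confines `v - y`, hence `y` too. The shear `(v, y) ↦ (v, v - y)` is its
own inverse, so it carries the product of the supports onto a compact set containing the support. -/
theorem isTest_productTest {θ : ℝ → ℝ} {χ Φ : E3 → ℝ} (hθ : IsTest θ) (hχ : IsTest χ)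
    (hΦ : IsTest Φ) : IsTest (productTest θ χ Φ) := by
  refine ⟨?_, ?_⟩
  · refine (hθ.1.comp contDiff_fst).mul ((hχ.1.comp (contDiff_fst.comp contDiff_snd)).mul
      ((hχ.1.comp (contDiff_fst.comp (contDiff_snd.comp contDiff_snd))).mul (hΦ.1.comp ?_)))
    exact (contDiff_fst.comp (contDiff_snd.comp contDiff_snd)).sub
      (contDiff_snd.comp (contDiff_snd.comp contDiff_snd))
  · have hc : IsCompact ((fun q : ℝ × E3 × E3 × E3 => (q.1, q.2.1, q.2.2.1, q.2.2.1 - q.2.2.2)) ''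
        (tsupport θ ×ˢ (tsupport χ ×ˢ (tsupport χ ×ˢ tsupport Φ)))) :=
      (hθ.2.isCompact.prod (hχ.2.isCompact.prod (hχ.2.isCompact.prod hΦ.2.isCompact))).image
        (by fun_prop)
    refine HasCompactSupport.intro' hc hc.isClosed fun q hq => ?_
    by_contra h
    rw [productTest, mul_eq_zero, mul_eq_zero, mul_eq_zero, not_or, not_or, not_or] at h
    refine hq ⟨(q.1, q.2.1, q.2.2.1, q.2.2.1 - q.2.2.2), ⟨subset_tsupport _ h.1,
      subset_tsupport _ h.2.1, subset_tsupport _ h.2.2.1, subset_tsupport _ h.2.2.2⟩, ?_⟩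
    simp

theorem fderiv_productTest {θ : ℝ → ℝ} {χ Φ : E3 → ℝ} (hθ : IsTest θ) (hχ : IsTest χ)
    (hΦ : IsTest Φ) (q a : ℝ × E3 × E3 × E3) :
    fderiv ℝ (productTest θ χ Φ) q a =
      a.1 * deriv θ q.1 * (χ q.2.1 * (χ q.2.2.1 * Φ (q.2.2.1 - q.2.2.2)))
      + θ q.1 * (fderiv ℝ χ q.2.1 a.2.1 * (χ q.2.2.1 * Φ (q.2.2.1 - q.2.2.2))
        + χ q.2.1 * (fderiv ℝ χ q.2.2.1 a.2.2.1 * Φ (q.2.2.1 - q.2.2.2)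
          + χ q.2.2.1 * fderiv ℝ Φ (q.2.2.1 - q.2.2.2) (a.2.2.1 - a.2.2.2))) := by
  have d1 := hasFDerivAt_fst (𝕜 := ℝ) (p := q)
  have d2 : HasFDerivAt (fun q : ℝ × E3 × E3 × E3 => q.2.1) _ q :=
    (hasFDerivAt_fst (𝕜 := ℝ) (p := q.2)).comp q (hasFDerivAt_snd (𝕜 := ℝ) (p := q))
  have d' : HasFDerivAt (fun q : ℝ × E3 × E3 × E3 => q.2.2) _ q :=
    (hasFDerivAt_snd (𝕜 := ℝ) (p := q.2)).comp q (hasFDerivAt_snd (𝕜 := ℝ) (p := q))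
  have d3 : HasFDerivAt (fun q : ℝ × E3 × E3 × E3 => q.2.2.1) _ q :=
    (hasFDerivAt_fst (𝕜 := ℝ) (p := q.2.2)).comp q d'
  have d4 : HasFDerivAt (fun q : ℝ × E3 × E3 × E3 => q.2.2.2) _ q :=
    (hasFDerivAt_snd (𝕜 := ℝ) (p := q.2.2)).comp q d'
  have g1 : HasFDerivAt (fun q : ℝ × E3 × E3 × E3 => θ q.1) _ q :=
    ((hθ.1.differentiable (by simp)) q.1).hasFDerivAt.comp q d1
  have g2 : HasFDerivAt (fun q : ℝ × E3 × E3 × E3 => χ q.2.1) _ q :=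
    ((hχ.1.differentiable (by simp)) q.2.1).hasFDerivAt.comp q d2
  have g3 : HasFDerivAt (fun q : ℝ × E3 × E3 × E3 => χ q.2.2.1) _ q :=
    ((hχ.1.differentiable (by simp)) q.2.2.1).hasFDerivAt.comp q d3
  have g4 : HasFDerivAt (fun q : ℝ × E3 × E3 × E3 => Φ (q.2.2.1 - q.2.2.2)) _ q :=
    ((hΦ.1.differentiable (by simp)) (q.2.2.1 - q.2.2.2)).hasFDerivAt.comp q (d3.sub d4)
  have h : fderiv ℝ (productTest θ χ Φ) q = _ := (g1.mul (g2.mul (g3.mul g4))).fderiv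
  rw [h]
  simp
  ring

/-! ### Balance law for the relative moment -/

section Sol
variable {u₀ : E3 → E3} {f₀ : E3 × E3 → ℝ} {u : ℝ → E3 → E3} {Du : ℝ → E3 → E3 →L[ℝ] E3}
  {f : ℝ → E3 × E3 → ℝ} {T : ℝ} {w : ℝ × E3 → E3}

theorem one_add_rpow_le {p x : ℝ} (hp : 0 ≤ p) (hx : 0 ≤ x) :
    (1 + x) ^ p ≤ 2 ^ p * (1 + x ^ p) := by
  have hxp := Real.rpow_nonneg hx p
  rcases le_total x 1 with h | h
  · calc (1 + x) ^ p ≤ 2 ^ p := Real.rpow_le_rpow (by linarith) (by linarith) hp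
      _ ≤ _ := le_mul_of_one_le_right (by positivity) (by linarith)
  · calc (1 + x) ^ p ≤ (2 * x) ^ p := Real.rpow_le_rpow (by linarith) (by linarith) hp
      _ = 2 ^ p * x ^ p := Real.mul_rpow (by norm_num) hx
      _ ≤ _ := mul_le_mul_of_nonneg_left (by linarith) (by positivity)

/-- Uniform bound on the derivatives of the regularized moments along characteristics. -/
theorem abs_fderiv_productTest_le {p : ℝ} (hp : 2 ≤ p) {θ : ℝ → ℝ} {χ Φ : E3 → ℝ} {N C M : ℝ}
    (hN : 1 ≤ N) (hC : 0 ≤ C) (hM : 0 ≤ M) (hθ : IsTest θ) (hχ : IsTest χ) (hΦ : IsTest Φ)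
    (hθM : ∀ s, |θ s| ≤ M) (hθM' : ∀ s, |deriv θ s| ≤ M)
    (hχ1 : ∀ x, |χ x| ≤ 1) (hχd : ∀ x h, |fderiv ℝ χ x h| ≤ C / N * ‖h‖)
    (hχs : ∀ x, χ x ≠ 0 → ‖x‖ ≤ 2 * N) (hΦb : ∀ ξ, |Φ ξ| ≤ (1 + ‖ξ‖) ^ p)
    (hΦd : ∀ ξ h, |fderiv ℝ Φ ξ h| ≤ C * (1 + ‖ξ‖) ^ (p - 1) * ‖h‖)
    (hΦs : ∀ ξ, Φ ξ ≠ 0 → ‖ξ‖ ≤ 2 * N) (s : ℝ) (x v y a b : E3) {c : ℝ} (hc : ‖b‖ ≤ c) :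
    |fderiv ℝ (productTest θ χ Φ) (s, x, v, y) (1, v, y - v, a + b)|
      ≤ M * ((1 + 7 * C) * 2 ^ p * (1 + ‖v - y‖ ^ p) + C * ‖a‖ ^ p + C * c ^ p) := by
  have hN0 : 0 < N := by linarith
  set ξ := v - y with hξ
  have hP := Real.rpow_nonneg (by positivity : 0 ≤ 1 + ‖ξ‖) p
  have hP1 := Real.rpow_nonneg (by positivity : 0 ≤ 1 + ‖ξ‖) (p - 1)
  have hc0 : 0 ≤ c := (norm_nonneg _).trans hc
  have t1 : |χ v * Φ ξ| ≤ (1 + ‖ξ‖) ^ p := by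
    rw [abs_mul]; exact (mul_le_of_le_one_left (abs_nonneg _) (hχ1 v)).trans (hΦb ξ)
  have t0 : |χ x * (χ v * Φ ξ)| ≤ (1 + ‖ξ‖) ^ p := by
    rw [abs_mul]; exact (mul_le_of_le_one_left (abs_nonneg _) (hχ1 x)).trans t1
  -- Free transport hits the spatial cutoff with the factor `v`, but the velocity cutoff gives `‖v‖
  -- ≤ 2 N` against a gradient of size `C / N`: no extra velocity moment is spent.
  have t2 : |fderiv ℝ χ x v * (χ v * Φ ξ)| ≤ 2 * C * (1 + ‖ξ‖) ^ p := by
    by_cases hv : χ v = 0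
    · simp only [hv, zero_mul, mul_zero, abs_zero]; positivity
    · rw [abs_mul]
      refine mul_le_mul ((hχd x v).trans ?_) t1 (abs_nonneg _) (by positivity)
      calc C / N * ‖v‖ ≤ C / N * (2 * N) := mul_le_mul_of_nonneg_left (hχs v hv) (by positivity)
        _ = 2 * C := by field_simp
  -- The same cancellation for the friction term, now with the support of `Φ` bounding the relative
  -- velocity.
  have t3 : |fderiv ℝ χ v (y - v) * Φ ξ| ≤ 2 * C * (1 + ‖ξ‖) ^ p := by
    by_cases hv : Φ ξ = 0
    · simp only [hv, mul_zero, abs_zero]; positivity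
    · rw [abs_mul]
      refine mul_le_mul ((hχd v _).trans ?_) (hΦb ξ) (abs_nonneg _) (by positivity)
      rw [norm_sub_rev]
      calc C / N * ‖v - y‖ ≤ C / N * (2 * N) := mul_le_mul_of_nonneg_left (hΦs ξ hv) (by positivity)
        _ = 2 * C := by field_simp
  have t4 : |χ v * fderiv ℝ Φ ξ (y - v - (a + b))|
      ≤ C * (3 * (1 + ‖ξ‖) ^ p + ‖a‖ ^ p + c ^ p) := by
    rw [abs_mul]
    refine (mul_le_of_le_one_left (abs_nonneg _) (hχ1 v)).trans ((hΦd ξ _).trans ?_)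
    rw [mul_assoc]
    refine mul_le_mul_of_nonneg_left ?_ hC
    have n1 : ‖y - v - (a + b)‖ ≤ (1 + ‖ξ‖) + ‖a‖ + c := by
      have := norm_sub_le (y - v) (a + b)
      have h2 := norm_add_le a b
      rw [norm_sub_rev y v] at this
      linarith
    have y1 := rpow_sub_one_mul_le (p := p) (ε := 1) (A := 1 + ‖ξ‖) (by linarith) one_pos
      (by positivity) (norm_nonneg a)
    have y2 := rpow_sub_one_mul_le (p := p) (ε := 1) (A := 1 + ‖ξ‖) (by linarith) one_pos
      (by positivity) hc0
    simp only [inv_one, Real.one_rpow, one_mul] at y1 y2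
    have y3 : (1 + ‖ξ‖) ^ (p - 1) * (1 + ‖ξ‖) = (1 + ‖ξ‖) ^ p := by
      rw [← Real.rpow_add_one (by positivity)]; congr 1; ring
    calc (1 + ‖ξ‖) ^ (p - 1) * ‖y - v - (a + b)‖
        ≤ (1 + ‖ξ‖) ^ (p - 1) * ((1 + ‖ξ‖) + ‖a‖ + c) := mul_le_mul_of_nonneg_left n1 hP1
      _ = (1 + ‖ξ‖) ^ p + (1 + ‖ξ‖) ^ (p - 1) * ‖a‖ + (1 + ‖ξ‖) ^ (p - 1) * c := by
          rw [mul_add, mul_add, y3]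
      _ ≤ _ := by linarith
  have t5 : |χ x * (fderiv ℝ χ v (y - v) * Φ ξ + χ v * fderiv ℝ Φ ξ (y - v - (a + b)))|
      ≤ 2 * C * (1 + ‖ξ‖) ^ p + C * (3 * (1 + ‖ξ‖) ^ p + ‖a‖ ^ p + c ^ p) := by
    rw [abs_mul]
    exact (mul_le_of_le_one_left (abs_nonneg _) (hχ1 x)).trans
      ((abs_add_le _ _).trans (add_le_add t3 t4))
  rw [fderiv_productTest hθ hχ hΦ]
  simp only [one_mul]
  calc _ ≤ M * (1 + ‖ξ‖) ^ p + M * (2 * C * (1 + ‖ξ‖) ^ p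
        + (2 * C * (1 + ‖ξ‖) ^ p + C * (3 * (1 + ‖ξ‖) ^ p + ‖a‖ ^ p + c ^ p))) := by
        refine (abs_add_le _ _).trans (add_le_add ?_ ?_)
        · rw [abs_mul]; exact mul_le_mul (hθM' s) t0 (abs_nonneg _) hM
        · rw [abs_mul]
          exact mul_le_mul (hθM s) ((abs_add_le _ _).trans (add_le_add t2 t5)) (abs_nonneg _) hM
    -- The `7` is `2 + 2 + 3`: the spatial cutoff, the velocity cutoff and the derivative of `Φ`.
    _ = M * ((1 + 7 * C) * (1 + ‖ξ‖) ^ p + C * ‖a‖ ^ p + C * c ^ p) := by ring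
    _ ≤ _ := by
        refine mul_le_mul_of_nonneg_left ?_ hM
        have := mul_le_mul_of_nonneg_left (one_add_rpow_le (p := p) (by linarith) (norm_nonneg ξ))
          (by positivity : 0 ≤ 1 + 7 * C)
        rw [← mul_assoc] at this
        linarith

/-- Balance of the `p`-th relative moment against a test function of time. -/
theorem moment_identity (h₀ : IsAdmissible u₀ f₀) (hs : IsGlobalWeakSolution u₀ f₀ u Du f)
    (hw : HasWeakTimeDeriv u T w)
    (hwi : ∀ R, IntegrableOn w (univ ×ˢ Metric.closedBall 0 R) (slab T)) (hT : 0 < T)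
    {p : ℝ} (hp : 2 ≤ p)
    (hI0 : Integrable fun z : E3 × E3 => f₀ z * ‖z.2 - u₀ z.1‖ ^ p)
    (hI1 : Integrable (fun z => f z.1 z.2 * ‖z.2.2 - u z.1 z.2.1‖ ^ p) (phase T))
    (hI2 : Integrable (fun z => f z.1 z.2 * ‖w (z.1, z.2.1)‖ ^ p) (phase T))
    (hI3 : Integrable (fun z => f z.1 z.2 * (gradNorm (Du z.1 z.2.1) * ‖z.2.2‖) ^ p) (phase T))
    {θ : ℝ → ℝ} (hθ : IsTest θ) {T' : ℝ} (hT' : T' < T) (hθT : ∀ s, T' ≤ s → θ s = 0) :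
    Integrable (fun z => f z.1 z.2 * (deriv θ z.1 * ‖z.2.2 - u z.1 z.2.1‖ ^ p
      + θ z.1 * (p * ‖z.2.2 - u z.1 z.2.1‖ ^ (p - 2) * inner ℝ (z.2.2 - u z.1 z.2.1)
        (u z.1 z.2.1 - z.2.2 - (w (z.1, z.2.1) + Du z.1 z.2.1 z.2.2))))) (phase T) ∧
    (∫ z, f z.1 z.2 * (deriv θ z.1 * ‖z.2.2 - u z.1 z.2.1‖ ^ p
      + θ z.1 * (p * ‖z.2.2 - u z.1 z.2.1‖ ^ (p - 2) * inner ℝ (z.2.2 - u z.1 z.2.1)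
        (u z.1 z.2.1 - z.2.2 - (w (z.1, z.2.1) + Du z.1 z.2.1 z.2.2)))) ∂phase T)
      + θ 0 * ∫ z, f₀ z * ‖z.2 - u₀ z.1‖ ^ p = 0 := by
  obtain ⟨χ, C₁, hC₁, hχ, hχ1, hχd, hχs, hχl⟩ := exists_cutoff
  obtain ⟨Φ, C₂, hC₂, hΦ, hΦb, hΦd, hΦs, hΦl, hΦl'⟩ := exists_approx_rpow hp
  obtain ⟨M₁, hM₁⟩ := hθ.2.exists_bound_of_continuous hθ.1.continuous
  obtain ⟨M₂, hM₂⟩ := hθ.2.deriv.exists_bound_of_continuous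
    (hθ.1.continuous_deriv (by simp))
  set C := max C₁ C₂
  set M := max M₁ M₂
  have hC : 0 ≤ C := hC₁.trans (le_max_left _ _)
  have hM : 0 ≤ M := ((norm_nonneg _).trans (hM₁ 0)).trans (le_max_left _ _)
  set mat : ℕ → ℝ × E3 × E3 → ℝ := fun n z => f z.1 z.2 *
    materialDeriv u (productTest θ (χ n) (Φ n)) (totalDeriv Du w) (fun y => u y.1 y.2) z with hmat
  set lim : ℝ × E3 × E3 → ℝ := fun z => f z.1 z.2 * (deriv θ z.1 * ‖z.2.2 - u z.1 z.2.1‖ ^ p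
      + θ z.1 * (p * ‖z.2.2 - u z.1 z.2.1‖ ^ (p - 2) * inner ℝ (z.2.2 - u z.1 z.2.1)
        (u z.1 z.2.1 - z.2.2 - (w (z.1, z.2.1) + Du z.1 z.2.1 z.2.2)))) with hlimdef
  -- A dominating function independent of `n`; its four pieces are integrable by the mass of `f` and
  -- by `hI1`, `hI2`, `hI3`.
  set bd : ℝ × E3 × E3 → ℝ := fun z => M * ((1 + 7 * C) * 2 ^ p *
    (f z.1 z.2 + f z.1 z.2 * ‖z.2.2 - u z.1 z.2.1‖ ^ p) + C * (f z.1 z.2 * ‖w (z.1, z.2.1)‖ ^ p)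
      + C * (f z.1 z.2 * (gradNorm (Du z.1 z.2.1) * ‖z.2.2‖) ^ p)) with hbd
  have hbdi : Integrable bd (phase T) :=
    (((((hs.integrable_f T).add hI1).const_mul _).add (hI2.const_mul _)).add
      (hI3.const_mul _)).const_mul _
  have hDm : AEStronglyMeasurable (totalDeriv Du w) (slab T) :=
    aestronglyMeasurable_iff_forall_ball.2 fun R => (integrableOn_totalDeriv
      (integrable_ball_of_memLp (by norm_num) (memLp_Du hs T) R) (hwi R)).1
  have hmm : ∀ n, AEStronglyMeasurable (mat n) (phase T) := fun n =>
    (hs.aestronglyMeasurable_f T).mul (aestronglyMeasurable_materialDeriv hs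
      (isTest_productTest hθ (hχ n) (hΦ n)) hDm (hs.aestronglyMeasurable_u T))
  have hle : ∀ n, ∀ᵐ z ∂phase T, ‖mat n z‖ ≤ bd z := fun n => by
    filter_upwards [hs.ae_nonneg_f T] with z hz
    have hn : (1 : ℝ) ≤ (n : ℝ) + 1 := by linarith [(Nat.cast_nonneg n : (0 : ℝ) ≤ n)]
    have hmax : C₁ / ((n : ℝ) + 1) ≤ C / ((n : ℝ) + 1) :=
      div_le_div_of_nonneg_right (le_max_left _ _) (by positivity)
    have key := abs_fderiv_productTest_le hp hn hC hM hθ (hχ n) (hΦ n)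
      (fun s => (hM₁ s).trans (le_max_left _ _)) (fun s => (hM₂ s).trans (le_max_right _ _))
      (hχ1 n) (fun x h => (hχd n x h).trans (mul_le_mul_of_nonneg_right hmax (norm_nonneg _)))
      (hχs n) (hΦb n)
      (fun ξ h => (hΦd n ξ h).trans (mul_le_mul_of_nonneg_right
        (mul_le_mul_of_nonneg_right (le_max_right _ _) (by positivity)) (norm_nonneg _)))
      (hΦs n) z.1 z.2.1 z.2.2 (u z.1 z.2.1) (w (z.1, z.2.1)) (Du z.1 z.2.1 z.2.2)
      (norm_apply_le_gradNorm_mul _ _)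
    rw [hmat]
    dsimp only
    rw [norm_mul, Real.norm_of_nonneg hz, materialDeriv, totalDeriv_apply, one_smul]
    refine (mul_le_mul_of_nonneg_left key hz).trans (le_of_eq ?_)
    rw [hbd]
    dsimp only
    ring
  have hpt : ∀ z, Tendsto (fun n => mat n z) atTop (𝓝 (lim z)) := fun z => by
    refine Tendsto.const_mul _ ?_
    simp only [materialDeriv, totalDeriv_apply, one_smul]
    simp_rw [fun n => fderiv_productTest hθ (hχ n) (hΦ n)]
    simp only [one_mul]
    set ξ := z.2.2 - u z.1 z.2.1
    have a1 : Tendsto (fun n => χ n z.2.1) atTop (𝓝 1) :=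
      tendsto_const_nhds.congr' ((hχl _).mono fun n h => h.1.symm)
    have a2 : Tendsto (fun n => χ n z.2.2) atTop (𝓝 1) :=
      tendsto_const_nhds.congr' ((hχl _).mono fun n h => h.1.symm)
    have a3 : ∀ x h : E3, Tendsto (fun n => fderiv ℝ (χ n) x h) atTop (𝓝 0) := fun x h =>
      tendsto_const_nhds.congr' ((hχl x).mono fun n hn => by simp [hn.2])
    have a4 := hΦl ξ
    have a5 := hΦl' ξ (u z.1 z.2.1 - z.2.2 - (w (z.1, z.2.1) + Du z.1 z.2.1 z.2.2))
    have b1 := ((a1.mul (a2.mul a4)).const_mul (deriv θ z.1)).add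
      ((((a3 z.2.1 z.2.2).mul (a2.mul a4)).add (a1.mul (((a3 z.2.2 (u z.1 z.2.1 - z.2.2)).mul a4).add
        (a2.mul a5)))).const_mul (θ z.1))
    simp only [one_mul, zero_mul, zero_add] at b1
    exact b1
  have hlimm : AEStronglyMeasurable lim (phase T) :=
    aestronglyMeasurable_of_tendsto_ae atTop hmm (ae_of_all _ hpt)
  refine ⟨hbdi.mono' hlimm ?_, ?_⟩
  · filter_upwards [ae_all_iff.2 hle] with z hz
    exact le_of_tendsto (hpt z).norm (Eventually.of_forall hz)
  have hl1 := tendsto_integral_of_dominated_convergence bd hmm hbdi hle (ae_of_all _ hpt)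
  have hl2 : Tendsto (fun n => ∫ z, f₀ z * productTest θ (χ n) (Φ n) (0, z.1, z.2, u₀ z.1)) atTop
      (𝓝 (∫ z, f₀ z * (θ 0 * ‖z.2 - u₀ z.1‖ ^ p))) := by
    have hu0 : AEStronglyMeasurable (fun z : E3 × E3 => u₀ z.1) volume := h₀.u_mem.1.comp_fst
    refine tendsto_integral_of_dominated_convergence
      (fun z => M * 2 ^ p * (|f₀ z| + |f₀ z * ‖z.2 - u₀ z.1‖ ^ p|)) (fun n => ?_) ?_
      (fun n => ae_of_all _ fun z => ?_) (ae_of_all _ fun z => ?_)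
    · exact h₀.f_mem_one.1.mul
        ((isTest_productTest hθ (hχ n) (hΦ n)).1.continuous.comp_aestronglyMeasurable
          (aestronglyMeasurable_const.prodMk (continuous_fst.aestronglyMeasurable.prodMk
            (continuous_snd.aestronglyMeasurable.prodMk hu0))))
    · exact ((memLp_one_iff_integrable.1 h₀.f_mem_one).norm.add hI0.norm).const_mul _
    · have hP := Real.rpow_nonneg (norm_nonneg (z.2 - u₀ z.1)) p
      have h1 : |productTest θ (χ n) (Φ n) (0, z.1, z.2, u₀ z.1)|
          ≤ M * (2 ^ p * (1 + ‖z.2 - u₀ z.1‖ ^ p)) := by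
        rw [productTest, abs_mul]
        refine mul_le_mul ((hM₁ 0).trans (le_max_left _ _)) ?_ (abs_nonneg _) hM
        rw [abs_mul, abs_mul]
        refine (mul_le_of_le_one_left (by positivity) (hχ1 n _)).trans
          ((mul_le_of_le_one_left (abs_nonneg _) (hχ1 n _)).trans ((hΦb n _).trans ?_))
        exact one_add_rpow_le (by linarith) (norm_nonneg _)
      rw [norm_mul, abs_mul, abs_of_nonneg hP, Real.norm_eq_abs, Real.norm_eq_abs]
      refine (mul_le_mul_of_nonneg_left h1 (abs_nonneg _)).trans (le_of_eq (by ring))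
    · refine Tendsto.const_mul _ (Tendsto.const_mul _ ?_)
      have a1 : ∀ x, Tendsto (fun n => χ n x) atTop (𝓝 1) := fun x =>
        tendsto_const_nhds.congr' ((hχl _).mono fun n h => h.1.symm)
      simpa using (a1 z.1).mul ((a1 z.2).mul (hΦl (z.2 - u₀ z.1)))
  have heq : ∀ n, (∫ z, mat n z ∂phase T)
      + ∫ z, f₀ z * productTest θ (χ n) (Φ n) (0, z.1, z.2, u₀ z.1) = 0 := fun n =>
    transport_identity h₀ hs hw hwi hT (isTest_productTest hθ (hχ n) (hΦ n)) hT'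
      (fun s y hsT => by simp [productTest, hθT s hsT])
  have e1 : ∫ z, f₀ z * (θ 0 * ‖z.2 - u₀ z.1‖ ^ p) = θ 0 * ∫ z, f₀ z * ‖z.2 - u₀ z.1‖ ^ p := by
    rw [← integral_const_mul]
    exact integral_congr_ae (ae_of_all _ fun z => by ring)
  rw [← e1]
  refine tendsto_nhds_unique (hl1.add hl2) ?_
  simp_rw [heq]
  exact tendsto_const_nhds

end Sol

/-! ### Time weights -/

/-- Smooth truncations of the weight `(1+s)^a` on `[0,T)`. -/
theorem exists_time_weight (a T : ℝ) : ∃ θ : ℕ → ℝ → ℝ,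
    (∀ n, IsTest (θ n)) ∧ (∀ n, ∃ T' < T, ∀ s, T' ≤ s → θ n s = 0) ∧
    (∀ n, ∀ s, 0 ≤ s → 0 ≤ θ n s ∧ θ n s ≤ (1 + s) ^ a) ∧
    (∀ n, ∀ s, 0 ≤ s → deriv (θ n) s ≤ |a| * (1 + s) ^ (a - 1)) ∧
    (∀ s, 0 ≤ s → s < T → Tendsto (fun n => θ n s) atTop (𝓝 ((1 + s) ^ a))) := by
  have hN : ∀ n : ℕ, (0 : ℝ) < (n : ℝ) + 1 := fun n => by positivity
  -- A smooth extension of the weight to negative times: it vanishes for `s ≤ -1/2`, avoiding the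
  -- singularity at `-1`, and is unchanged for `s ≥ -1/4`, so value and derivative at `0` are the
  -- true ones.
  set W₀ : ℝ → ℝ := fun s => Real.smoothTransition (4 * s + 2) * (1 + s) ^ a with hW₀
  set ζ : ℕ → ℝ → ℝ := fun n s => Real.smoothTransition (((n : ℝ) + 1) * (T - s) - 1) with hζ
  have hW₀s : ContDiff ℝ ∞ W₀ := by
    rw [contDiff_iff_contDiffAt]
    intro s
    rcases lt_or_ge s (-1 / 2) with h | h
    · have : W₀ =ᶠ[𝓝 s] fun _ => 0 := by
        filter_upwards [gt_mem_nhds h] with y hy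
        rw [hW₀]
        dsimp only
        rw [Real.smoothTransition.zero_of_nonpos (by linarith), zero_mul]
      exact contDiffAt_const.congr_of_eventuallyEq this
    · refine ContDiffAt.mul ?_ ?_
      · exact Real.smoothTransition.contDiffAt.comp s (by fun_prop)
      · exact (contDiffAt_const.add contDiffAt_id).rpow_const_of_ne (by
          simp only [id]; linarith)
  have hζs : ∀ n, ContDiff ℝ ∞ (ζ n) := fun n =>
    Real.smoothTransition.contDiff.comp (by fun_prop)
  have hW₀0 : ∀ s, 0 ≤ s → W₀ s = (1 + s) ^ a := fun s hs => by
    rw [hW₀]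
    dsimp only
    rw [Real.smoothTransition.one_of_one_le (by linarith), one_mul]
  have hW₀d : ∀ s, 0 ≤ s → HasDerivAt W₀ (a * (1 + s) ^ (a - 1)) s := fun s hs => by
    have h1 : HasDerivAt (fun s : ℝ => (1 + s) ^ a) (a * (1 + s) ^ (a - 1)) s := by
      have := ((hasDerivAt_id s).const_add 1).rpow_const (p := a) (Or.inl (by simp only [id]; linarith))
      simpa using this
    refine h1.congr_of_eventuallyEq ?_
    filter_upwards [lt_mem_nhds (show -1 / 4 < s by linarith)] with y hy
    rw [hW₀]
    dsimp only
    rw [Real.smoothTransition.one_of_one_le (by linarith), one_mul]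
  -- The final cutoff has an unbounded derivative as `n` grows, but of the favourable sign; this is
  -- why only an upper bound on the derivative of the weight is claimed.
  have hζd : ∀ n s, deriv (ζ n) s ≤ 0 := fun n s => by
    refine Antitone.deriv_nonpos fun x y hxy => ?_
    refine Real.smoothTransition.monotone ?_
    have := hN n
    nlinarith
  have hζ0 : ∀ n s, 0 ≤ ζ n s := fun n s => Real.smoothTransition.nonneg _
  have hζ1 : ∀ n s, ζ n s ≤ 1 := fun n s => Real.smoothTransition.le_one _
  have hzero : ∀ (n : ℕ) s, T - 1 / ((n : ℝ) + 1) ≤ s → W₀ s * ζ n s = 0 := fun n s h => by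
    have : ζ n s = 0 := by
      refine Real.smoothTransition.zero_of_nonpos ?_
      have h1 : ((n : ℝ) + 1) * (T - s) ≤ ((n : ℝ) + 1) * (1 / ((n : ℝ) + 1)) :=
        mul_le_mul_of_nonneg_left (by linarith) (hN n).le
      rw [mul_one_div_cancel (hN n).ne'] at h1
      linarith
    rw [this, mul_zero]
  refine ⟨fun n s => W₀ s * ζ n s, fun n => ⟨hW₀s.mul (hζs n), ?_⟩, fun n =>
    ⟨T - 1 / ((n : ℝ) + 1), by linarith [one_div_pos.2 (hN n)], hzero n⟩, fun n s hs => ?_,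
    fun n s hs => ?_, fun s hs hsT => ?_⟩
  · refine HasCompactSupport.intro (isCompact_Icc (a := -1 / 2) (b := T)) fun s hs => ?_
    rcases lt_or_ge s (-1 / 2) with h | h
    · rw [hW₀]
      dsimp only
      rw [Real.smoothTransition.zero_of_nonpos (by linarith), zero_mul, zero_mul]
    · have hsT : T < s := not_le.1 fun h' => hs ⟨h, h'⟩
      exact hzero n s (by linarith [one_div_pos.2 (hN n)])
  · have := Real.rpow_nonneg (by linarith : 0 ≤ 1 + s) a
    dsimp only
    rw [hW₀0 s hs]
    exact ⟨mul_nonneg this (hζ0 n s), mul_le_of_le_one_right this (hζ1 n s)⟩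
  · have h1 := (hW₀d s hs).mul ((hζs n).differentiable (by simp) s).hasDerivAt
    have h2 : deriv (fun s => W₀ s * ζ n s) s = _ := h1.deriv
    rw [h2, hW₀0 s hs]
    have p1 := Real.rpow_nonneg (by linarith : 0 ≤ 1 + s) a
    have p2 := Real.rpow_nonneg (by linarith : 0 ≤ 1 + s) (a - 1)
    have q1 : a * (1 + s) ^ (a - 1) * ζ n s ≤ |a| * (1 + s) ^ (a - 1) := by
      refine (mul_le_mul_of_nonneg_right (mul_le_mul_of_nonneg_right (le_abs_self a) p2)
        (hζ0 n s)).trans (mul_le_of_le_one_right (by positivity) (hζ1 n s))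
    have q2 := mul_nonpos_of_nonneg_of_nonpos p1 (hζd n s)
    linarith
  · rw [← hW₀0 s hs]
    refine tendsto_const_nhds.congr' ?_
    have h1 : Tendsto (fun n : ℕ => ((n : ℝ) + 1) * (T - s)) atTop atTop :=
      (tendsto_natCast_atTop_atTop.atTop_add tendsto_const_nhds).atTop_mul_const (by linarith)
    filter_upwards [h1.eventually_ge_atTop 2] with n hn
    have : ζ n s = 1 := Real.smoothTransition.one_of_one_le (by linarith)
    rw [this, mul_one]

theorem rpow_weight_le {T s : ℝ} (hs : 0 ≤ s) (hsT : s ≤ T) (b : ℝ) :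
    (1 + s) ^ b ≤ (1 + T) ^ |b| :=
  (Real.rpow_le_rpow_of_exponent_le (by linarith) (le_abs_self b)).trans
    (Real.rpow_le_rpow (by linarith) (by linarith) (abs_nonneg b))

theorem ae_phase_mem (T : ℝ) : ∀ᵐ z ∂phase T, z.1 ∈ Ioo 0 T :=
  Measure.quasiMeasurePreserving_fst.ae (ae_restrict_mem measurableSet_Ioo)

theorem aestronglyMeasurable_weight (b : ℝ) (μ : Measure (ℝ × E3 × E3)) :
    AEStronglyMeasurable (fun z : ℝ × E3 × E3 => (1 + z.1) ^ b) μ :=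
  ((measurable_fst.const_add 1).pow_const b).aestronglyMeasurable

theorem integrable_weight_mul {T : ℝ} {h : ℝ × E3 × E3 → ℝ} (hh : Integrable h (phase T)) (b : ℝ) :
    Integrable (fun z => (1 + z.1) ^ b * h z) (phase T) := by
  refine hh.bdd_mul (c := (1 + T) ^ |b|) (aestronglyMeasurable_weight b _) ?_
  filter_upwards [ae_phase_mem T] with z hz
  rw [Real.norm_of_nonneg (Real.rpow_nonneg (by linarith [hz.1]) _)]
  exact rpow_weight_le hz.1.le hz.2.le b

/-- On a bounded time interval every weight is bounded above and below, so finiteness for one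
exponent is finiteness for all. This makes the left-hand side of the estimate finite, hence
absorbable. -/
theorem integrable_of_weight_mul {T : ℝ} {h : ℝ × E3 × E3 → ℝ} (b : ℝ)
    (hh : Integrable (fun z => (1 + z.1) ^ b * h z) (phase T)) : Integrable h (phase T) := by
  refine (integrable_weight_mul hh (-b)).congr ?_
  filter_upwards [ae_phase_mem T] with z hz
  have : 0 < 1 + z.1 := by linarith [hz.1]
  rw [← mul_assoc, ← Real.rpow_add this, neg_add_cancel, Real.rpow_zero, one_mul]

/-- Lower order weights interpolate between the weight itself and any faster decaying weight. -/
theorem abs_mul_rpow_sub_one_le (a : ℝ) (k : ℕ) {s : ℝ} (hs : 0 ≤ s) :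
    |a| * (1 + s) ^ (a - 1) ≤ 1 / 4 * (1 + s) ^ a + |a| * (4 * |a|) ^ k * (1 + s) ^ (a - k) := by
  have h1 : 0 < 1 + s := by linarith
  have e1 : (1 + s) ^ a = (1 + s) ^ (a - 1) * (1 + s) := by
    rw [← Real.rpow_add_one h1.ne']; congr 1; ring
  have p1 := Real.rpow_nonneg h1.le (a - 1)
  have p2 := Real.rpow_nonneg h1.le (a - k)
  -- The threshold `1 + s = 4 |a|` is where the lost power of `1 + s` exactly pays for `|a|` with
  -- the factor `1/4`; below it `(1 + s) ^ k` is bounded by a constant.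
  rcases le_total (4 * |a|) (1 + s) with h | h
  · have h2 : |a| * (1 + s) ^ (a - 1) ≤ 1 / 4 * (1 + s) ^ a := by rw [e1]; nlinarith
    have h3 : 0 ≤ |a| * (4 * |a|) ^ k * (1 + s) ^ (a - k) := by positivity
    linarith
  · have e2 : (1 + s) ^ (a - 1) ≤ (4 * |a|) ^ k * (1 + s) ^ (a - k) := by
      calc (1 + s) ^ (a - 1) ≤ (1 + s) ^ (a - k + k) :=
            Real.rpow_le_rpow_of_exponent_le (by linarith) (by linarith)
        _ = (1 + s) ^ k * (1 + s) ^ (a - k) := by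
            rw [Real.rpow_add_natCast h1.ne', mul_comm]
        _ ≤ _ := mul_le_mul_of_nonneg_right (pow_le_pow_left₀ h1.le h k) p2
    have h3 := mul_le_mul_of_nonneg_left e2 (abs_nonneg a)
    have h4 : 0 ≤ 1 / 4 * (1 + s) ^ a := by positivity
    linarith

/-! ### Weighted estimate when all moments are finite -/

section Sol
variable {u₀ : E3 → E3} {f₀ : E3 × E3 → ℝ} {u : ℝ → E3 → E3} {Du : ℝ → E3 → E3 →L[ℝ] E3}
  {f : ℝ → E3 × E3 → ℝ} {T : ℝ} {w : ℝ × E3 → E3}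

/-- Pointwise form of the dissipation estimate along characteristics. -/
theorem moment_integrand_le {p : ℝ} (hp : 2 ≤ p) (a : ℝ) (k : ℕ) {s d θ : ℝ} (hs : 0 ≤ s)
    (hθ : 0 ≤ θ) (hθ1 : θ ≤ (1 + s) ^ a) (hd : d ≤ |a| * (1 + s) ^ (a - 1))
    (ξ w b : E3) {c : ℝ} (hb : ‖b‖ ≤ c) :
    d * ‖ξ‖ ^ p + θ * (p * ‖ξ‖ ^ (p - 2) * inner ℝ ξ (-ξ - (w + b)))
      ≤ (1 / 4 + p / 4) * ((1 + s) ^ a * ‖ξ‖ ^ p)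
        + |a| * (4 * |a|) ^ k * ((1 + s) ^ (a - k) * ‖ξ‖ ^ p)
        + p * 8 ^ (p - 1) * ((1 + s) ^ a * ‖w‖ ^ p + (1 + s) ^ a * c ^ p)
        - p * (θ * ‖ξ‖ ^ p) := by
  have hξp := Real.rpow_nonneg (norm_nonneg ξ) p
  have hξ1 := Real.rpow_nonneg (norm_nonneg ξ) (p - 1)
  have hξ2 := Real.rpow_nonneg (norm_nonneg ξ) (p - 2)
  have hc0 : 0 ≤ c := (norm_nonneg _).trans hb
  have hp0 : 0 ≤ p := by linarith
  have hW := Real.rpow_nonneg (by linarith : 0 ≤ 1 + s) a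
  -- Two cross terms with `ε = 1/8` each add up to `1/4` of `‖ξ‖ ^ p`; the price is `(1/8)⁻¹ ^ (p -
  -- 1)`.
  have y1 := rpow_sub_one_mul_le (p := p) (ε := 1 / 8) (by linarith) (by norm_num) (norm_nonneg ξ)
    (norm_nonneg w)
  have y2 := rpow_sub_one_mul_le (p := p) (ε := 1 / 8) (by linarith) (by norm_num) (norm_nonneg ξ)
    hc0
  rw [show ((1 : ℝ) / 8)⁻¹ = 8 by norm_num] at y1 y2
  have hin : inner ℝ ξ (-ξ - (w + b)) ≤ -(‖ξ‖ * ‖ξ‖) + ‖ξ‖ * ‖w‖ + ‖ξ‖ * c := by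
    rw [inner_sub_right, inner_neg_right, inner_add_right, real_inner_self_eq_norm_mul_norm]
    have h1 := (abs_le.1 (abs_real_inner_le_norm ξ w)).1
    have h2 := (abs_le.1 (abs_real_inner_le_norm ξ b)).1
    have h3 := mul_le_mul_of_nonneg_left hb (norm_nonneg ξ)
    linarith
  have e1 : ‖ξ‖ ^ (p - 2) * ‖ξ‖ = ‖ξ‖ ^ (p - 1) := by
    rcases (norm_nonneg ξ).eq_or_lt with h | h
    · rw [← h, mul_zero, Real.zero_rpow (by linarith)]
    · rw [← Real.rpow_add_one h.ne']; congr 1; ring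
  have e2 : ‖ξ‖ ^ (p - 1) * ‖ξ‖ = ‖ξ‖ ^ p := by
    rcases (norm_nonneg ξ).eq_or_lt with h | h
    · rw [← h, mul_zero, Real.zero_rpow (by linarith)]
    · rw [← Real.rpow_add_one h.ne']; congr 1; ring
  have h1 : ‖ξ‖ ^ (p - 2) * inner ℝ ξ (-ξ - (w + b))
      ≤ -‖ξ‖ ^ p + ‖ξ‖ ^ (p - 1) * ‖w‖ + ‖ξ‖ ^ (p - 1) * c := by
    refine (mul_le_mul_of_nonneg_left hin hξ2).trans (le_of_eq ?_)
    rw [← e2, ← e1]; ring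
  set S := ‖ξ‖ ^ (p - 1) * ‖w‖ + ‖ξ‖ ^ (p - 1) * c
  have hS0 : 0 ≤ S := by positivity
  have hS : S ≤ 1 / 4 * ‖ξ‖ ^ p + 8 ^ (p - 1) * (‖w‖ ^ p + c ^ p) := by linarith
  -- The error terms may be enlarged from `θ` to the full weight, but the damping term must keep
  -- `θ`; it regains the full weight only in the limit of the truncations.
  have h2 : θ * (p * ‖ξ‖ ^ (p - 2) * inner ℝ ξ (-ξ - (w + b)))
      ≤ p * ((1 + s) ^ a * (1 / 4 * ‖ξ‖ ^ p + 8 ^ (p - 1) * (‖w‖ ^ p + c ^ p)))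
        - p * (θ * ‖ξ‖ ^ p) := by
    have q1 : θ * (‖ξ‖ ^ (p - 2) * inner ℝ ξ (-ξ - (w + b))) ≤ θ * (-‖ξ‖ ^ p + S) :=
      mul_le_mul_of_nonneg_left (by linarith) hθ
    have q2 : θ * S ≤ (1 + s) ^ a * (1 / 4 * ‖ξ‖ ^ p + 8 ^ (p - 1) * (‖w‖ ^ p + c ^ p)) :=
      mul_le_mul hθ1 hS hS0 hW
    have q3 := mul_le_mul_of_nonneg_left (q1.trans (le_of_eq (mul_add θ _ _))) hp0
    have q4 := mul_le_mul_of_nonneg_left q2 hp0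
    calc _ = p * (θ * (‖ξ‖ ^ (p - 2) * inner ℝ ξ (-ξ - (w + b)))) := by ring
      _ ≤ _ := by rw [mul_add] at q3; linarith
  have h3 : d * ‖ξ‖ ^ p ≤ (1 / 4 * (1 + s) ^ a + |a| * (4 * |a|) ^ k * (1 + s) ^ (a - k)) * ‖ξ‖ ^ p :=
    mul_le_mul_of_nonneg_right (hd.trans (abs_mul_rpow_sub_one_le a k hs)) hξp
  refine (add_le_add h3 h2).trans (le_of_eq (by ring))

/-- The weighted dissipation estimate for finite moments. -/
theorem weighted_moment_le (h₀ : IsAdmissible u₀ f₀) (hs : IsGlobalWeakSolution u₀ f₀ u Du f)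
    (hw : HasWeakTimeDeriv u T w)
    (hwi : ∀ R, IntegrableOn w (univ ×ˢ Metric.closedBall 0 R) (slab T)) (hT : 0 < T)
    {p : ℝ} (hp : 2 ≤ p)
    (hI0 : Integrable fun z : E3 × E3 => f₀ z * ‖z.2 - u₀ z.1‖ ^ p)
    (hI1 : Integrable (fun z => f z.1 z.2 * ‖z.2.2 - u z.1 z.2.1‖ ^ p) (phase T))
    (hI2 : Integrable (fun z => f z.1 z.2 * ‖w (z.1, z.2.1)‖ ^ p) (phase T))
    (hI3 : Integrable (fun z => f z.1 z.2 * (gradNorm (Du z.1 z.2.1) * ‖z.2.2‖) ^ p) (phase T))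
    (a : ℝ) (k : ℕ) :
    ∫ z, (1 + z.1) ^ a * (f z.1 z.2 * ‖z.2.2 - u z.1 z.2.1‖ ^ p) ∂phase T
      ≤ |a| * (4 * |a|) ^ k *
          (∫ z, (1 + z.1) ^ (a - k) * (f z.1 z.2 * ‖z.2.2 - u z.1 z.2.1‖ ^ p) ∂phase T)
        + p * 8 ^ (p - 1) * ((∫ z, (1 + z.1) ^ a * (f z.1 z.2 * ‖w (z.1, z.2.1)‖ ^ p) ∂phase T)
          + ∫ z, (1 + z.1) ^ a * (f z.1 z.2 * (gradNorm (Du z.1 z.2.1) * ‖z.2.2‖) ^ p) ∂phase T)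
        + ∫ z, f₀ z * ‖z.2 - u₀ z.1‖ ^ p := by
  obtain ⟨θ, hθ, hθT, hθb, hθd, hθl⟩ := exists_time_weight a T
  have jX := integrable_weight_mul hI1 a
  have jY := integrable_weight_mul hI1 (a - k)
  have jW := integrable_weight_mul hI2 a
  have jZ := integrable_weight_mul hI3 a
  set X := ∫ z, (1 + z.1) ^ a * (f z.1 z.2 * ‖z.2.2 - u z.1 z.2.1‖ ^ p) ∂phase T
  set Y := ∫ z, (1 + z.1) ^ (a - k) * (f z.1 z.2 * ‖z.2.2 - u z.1 z.2.1‖ ^ p) ∂phase T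
  set W := ∫ z, (1 + z.1) ^ a * (f z.1 z.2 * ‖w (z.1, z.2.1)‖ ^ p) ∂phase T
  set Z := ∫ z, (1 + z.1) ^ a * (f z.1 z.2 * (gradNorm (Du z.1 z.2.1) * ‖z.2.2‖) ^ p) ∂phase T
  set D₀ := ∫ z, f₀ z * ‖z.2 - u₀ z.1‖ ^ p with hD₀
  have hD0 : 0 ≤ D₀ := integral_nonneg_of_ae (by
    filter_upwards [h₀.f_nonneg] with z hz
    exact mul_nonneg hz (by positivity))
  have hbound : ∀ n, ∀ᵐ z ∂phase T, ‖θ n z.1 * (f z.1 z.2 * ‖z.2.2 - u z.1 z.2.1‖ ^ p)‖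
      ≤ (1 + z.1) ^ a * (f z.1 z.2 * ‖z.2.2 - u z.1 z.2.1‖ ^ p) := fun n => by
    filter_upwards [ae_phase_mem T, hs.ae_nonneg_f T] with z hz hf
    obtain ⟨h1, h2⟩ := hθb n z.1 hz.1.le
    have : 0 ≤ f z.1 z.2 * ‖z.2.2 - u z.1 z.2.1‖ ^ p := by positivity
    rw [Real.norm_of_nonneg (by positivity)]
    exact mul_le_mul_of_nonneg_right h2 this
  have hmeas : ∀ n, AEStronglyMeasurable (fun z : ℝ × E3 × E3 =>
      θ n z.1 * (f z.1 z.2 * ‖z.2.2 - u z.1 z.2.1‖ ^ p)) (phase T) := fun n =>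
    ((hθ n).1.continuous.comp continuous_fst).aestronglyMeasurable.mul hI1.1
  have hlim := tendsto_integral_of_dominated_convergence _ hmeas jX hbound (by
    filter_upwards [ae_phase_mem T] with z hz
    exact (hθl z.1 hz.1.le hz.2).mul_const _)
  have hn : ∀ n, p * ∫ z, θ n z.1 * (f z.1 z.2 * ‖z.2.2 - u z.1 z.2.1‖ ^ p) ∂phase T
      ≤ (1 / 4 + p / 4) * X + |a| * (4 * |a|) ^ k * Y + p * 8 ^ (p - 1) * (W + Z) + D₀ := fun n => by
    obtain ⟨T', hT', hz⟩ := hθT n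
    obtain ⟨hint, hid⟩ := moment_identity h₀ hs hw hwi hT hp hI0 hI1 hI2 hI3 (hθ n) hT' hz
    have jθ : Integrable (fun z => θ n z.1 * (f z.1 z.2 * ‖z.2.2 - u z.1 z.2.1‖ ^ p)) (phase T) :=
      jX.mono' (hmeas n) (hbound n)
    have hmono := integral_mono_ae hint
      ((((jX.const_mul (1 / 4 + p / 4)).add (jY.const_mul (|a| * (4 * |a|) ^ k))).add
        ((jW.add jZ).const_mul (p * 8 ^ (p - 1)))).sub (jθ.const_mul p)) (by
        filter_upwards [ae_phase_mem T, hs.ae_nonneg_f T] with z hzT hf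
        have := mul_le_mul_of_nonneg_left (moment_integrand_le hp a k hzT.1.le (hθb n z.1 hzT.1.le).1
          (hθb n z.1 hzT.1.le).2 (hθd n z.1 hzT.1.le) (z.2.2 - u z.1 z.2.1) (w (z.1, z.2.1))
          (Du z.1 z.2.1 z.2.2) (norm_apply_le_gradNorm_mul _ _)) hf
        rw [neg_sub] at this
        refine this.trans (le_of_eq ?_)
        simp only [Pi.add_apply, Pi.sub_apply]
        ring)
    have e1 := integral_sub (((jX.const_mul (1 / 4 + p / 4)).add
      (jY.const_mul (|a| * (4 * |a|) ^ k))).add ((jW.add jZ).const_mul (p * 8 ^ (p - 1))))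
      (jθ.const_mul p)
    have e2 := integral_add ((jX.const_mul (1 / 4 + p / 4)).add
      (jY.const_mul (|a| * (4 * |a|) ^ k))) ((jW.add jZ).const_mul (p * 8 ^ (p - 1)))
    have e3 := integral_add (jX.const_mul (1 / 4 + p / 4)) (jY.const_mul (|a| * (4 * |a|) ^ k))
    have e4 := integral_add jW jZ
    simp only [Pi.add_apply, Pi.sub_apply, integral_const_mul] at hmono e1 e2 e3 e4
    rw [e1, e2, e3, e4] at hmono
    have hθ0 : θ n 0 * D₀ ≤ D₀ := by
      have := (hθb n 0 le_rfl).2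
      simp only [add_zero, Real.one_rpow] at this
      exact mul_le_of_le_one_left hD0 this
    linarith
  have hfin := le_of_tendsto' (hlim.const_mul p) hn
  have hX0 : 0 ≤ X := integral_nonneg_of_ae (by
    filter_upwards [ae_phase_mem T, hs.ae_nonneg_f T] with z hz hf
    have : 0 < 1 + z.1 := by linarith [hz.1]
    have h1 : 0 ≤ f z.1 z.2 * ‖z.2.2 - u z.1 z.2.1‖ ^ p := by positivity
    exact mul_nonneg (by positivity) h1)
  change p * X ≤ _ at hfin
  -- Absorption: `p - (1/4 + p/4) ≥ 1` for `p ≥ 2`, and `X` is a finite nonnegative number.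
  nlinarith

end Sol

/-! ### The norms of the statement as phase-space integrals -/

theorem integrable_smul_of_locallyIntegrableOn {s : Set (ℝ × E3)} {w : ℝ × E3 → E3}
    (hw : LocallyIntegrableOn w s) {g : ℝ × E3 → ℝ} (hg : Continuous g)
    (hgc : HasCompactSupport g) (hgs : tsupport g ⊆ s) : Integrable fun z => g z • w z := by
  obtain ⟨C, hC⟩ := hgc.exists_bound_of_continuous hg
  refine (integrableOn_iff_integrable_of_support_subset (s := tsupport g) ?_).1
    ((hw.integrableOn_compact_subset hgs hgc).bdd_smul C hg.aestronglyMeasurable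
      (ae_of_all _ hC))
  exact fun z hz => subset_tsupport g fun h => hz (by simp [h])

/-- Weak time derivatives are unique. -/
theorem HasWeakTimeDeriv.ae_eq {u : ℝ → E3 → E3} {t : ℝ} {w w' : ℝ × E3 → E3}
    (hw : HasWeakTimeDeriv u t w) (hw' : HasWeakTimeDeriv u t w') : w =ᵐ[slab t] w' := by
  have hop : IsOpen (Ioo 0 t ×ˢ univ : Set (ℝ × E3)) := isOpen_Ioo.prod isOpen_univ
  have h := hop.ae_eq_zero_of_integral_contDiff_smul_eq_zero (f := w - w') (μ := volume)
    (hw.1.sub hw'.1) (fun g g1 g2 g3 => by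
      have i1 : Integrable fun z => g z • w z :=
        integrable_smul_of_locallyIntegrableOn hw.1 g1.continuous g2 g3
      have i2 : Integrable fun z => g z • w' z :=
        integrable_smul_of_locallyIntegrableOn hw'.1 g1.continuous g2 g3
      simp only [Pi.sub_apply, smul_sub]
      rw [integral_sub i1 i2, sub_eq_zero, ← neg_inj, ← hw.2 g ⟨g1, g2⟩ g3, ← hw'.2 g ⟨g1, g2⟩ g3])
  rw [slab_eq_restrict, Filter.EventuallyEq, ae_restrict_iff' hop.measurableSet]
  filter_upwards [h] with z hz hzm
  exact sub_eq_zero.1 (hz hzm)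

/-- The infimum runs over functions that agree almost everywhere, so every competitor attains it. -/
theorem timeDerivNorm_eq {u : ℝ → E3 → E3} {p γ t : ℝ} {w : ℝ × E3 → E3}
    (hw : HasWeakTimeDeriv u t w) : timeDerivNorm p γ t u =
      eLpNorm (fun z : ℝ × E3 => ((1 + z.1) ^ γ : ℝ) • w z) (ENNReal.ofReal p) (slab t) := by
  refine le_antisymm (iInf₂_le w hw) (le_iInf₂ fun w' hw' => le_of_eq (eLpNorm_congr_ae ?_))
  filter_upwards [hw.ae_eq hw'] with z hz
  rw [hz]

theorem HasWeakTimeDeriv.aestronglyMeasurable {u : ℝ → E3 → E3} {t : ℝ} {w : ℝ × E3 → E3}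
    (hw : HasWeakTimeDeriv u t w) : AEStronglyMeasurable w (slab t) := by
  rw [slab_eq_restrict]
  exact hw.1.aestronglyMeasurable

theorem ae_slab_mem (T : ℝ) : ∀ᵐ z ∂slab T, z.1 ∈ Ioo 0 T :=
  Measure.quasiMeasurePreserving_fst.ae (ae_restrict_mem measurableSet_Ioo)

/-- The weight is bounded below on `(0,t)`, so a finite weighted norm gives `L^p`, hence `L¹` on
cylinders: the regularity of `∂ₛu` that the transport identity requires. -/
theorem integrableOn_ball_of_weighted {p γ t : ℝ} (hp : 1 ≤ p) {w : ℝ × E3 → E3}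
    (hw : AEStronglyMeasurable w (slab t))
    (h : eLpNorm (fun z : ℝ × E3 => ((1 + z.1) ^ γ : ℝ) • w z) (ENNReal.ofReal p) (slab t) < ⊤)
    (R : ℝ) : IntegrableOn w (univ ×ˢ Metric.closedBall 0 R) (slab t) := by
  refine integrable_ball_of_memLp (q := ENNReal.ofReal p) (by simpa using hp) ⟨hw, ?_⟩ R
  refine (eLpNorm_le_mul_eLpNorm_of_ae_le_mul (c := (1 + t) ^ |(-γ)|)
    (g := fun z : ℝ × E3 => ((1 + z.1) ^ γ : ℝ) • w z) ?_ _).trans_lt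
    (ENNReal.mul_lt_top ENNReal.ofReal_lt_top h)
  filter_upwards [ae_slab_mem t] with z hz
  have hz0 : 0 < 1 + z.1 := by linarith [hz.1]
  rw [norm_smul, Real.norm_of_nonneg (by positivity), ← mul_assoc]
  refine le_mul_of_one_le_left (norm_nonneg _) ?_
  have h1 : (1 + z.1) ^ (-γ) * (1 + z.1) ^ γ = 1 := by
    rw [← Real.rpow_add hz0, neg_add_cancel, Real.rpow_zero]
  refine h1.symm.le.trans ?_
  exact mul_le_mul_of_nonneg_right (rpow_weight_le hz.1.le hz.2.le (-γ)) (by positivity)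

section Sol
variable {u₀ : E3 → E3} {f₀ : E3 × E3 → ℝ} {u : ℝ → E3 → E3} {Du : ℝ → E3 → E3 →L[ℝ] E3}
  {f : ℝ → E3 × E3 → ℝ} {t : ℝ} {w : ℝ × E3 → E3} {p : ℝ}

namespace IsGlobalWeakSolution

theorem aestronglyMeasurable_relMoment (hs : IsGlobalWeakSolution u₀ f₀ u Du f) (t : ℝ)
    (hp : 0 ≤ p) : AEStronglyMeasurable
      (fun z : ℝ × E3 × E3 => f z.1 z.2 * ‖z.2.2 - u z.1 z.2.1‖ ^ p) (phase t) := by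
  have hu := (hs.aestronglyMeasurable_u t).comp_quasiMeasurePreserving (quasiMeasurePreserving_slab t)
  have hv : AEStronglyMeasurable (fun z : ℝ × E3 × E3 => z.2.2) (phase t) :=
    (by fun_prop : Continuous fun z : ℝ × E3 × E3 => z.2.2).aestronglyMeasurable
  exact (hs.aestronglyMeasurable_f t).mul
    ((Real.continuous_rpow_const hp).comp_aestronglyMeasurable (hv.sub hu).norm)

theorem aestronglyMeasurable_slab_mul (hs : IsGlobalWeakSolution u₀ f₀ u Du f)
    (hw : AEStronglyMeasurable w (slab t)) (hp : 0 ≤ p) : AEStronglyMeasurable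
      (fun z : ℝ × E3 × E3 => f z.1 z.2 * ‖w (z.1, z.2.1)‖ ^ p) (phase t) :=
  (hs.aestronglyMeasurable_f t).mul ((Real.continuous_rpow_const hp).comp_aestronglyMeasurable
    (hw.comp_quasiMeasurePreserving (quasiMeasurePreserving_slab t)).norm)

theorem aestronglyMeasurable_grad (hs : IsGlobalWeakSolution u₀ f₀ u Du f) (t : ℝ)
    (hp : 0 ≤ p) : AEStronglyMeasurable
      (fun z : ℝ × E3 × E3 => f z.1 z.2 * (gradNorm (Du z.1 z.2.1) * ‖z.2.2‖) ^ p) (phase t) := by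
  have hD := (hs.aestronglyMeasurable_Du t).comp_quasiMeasurePreserving
    (quasiMeasurePreserving_slab t)
  have hv : AEStronglyMeasurable (fun z : ℝ × E3 × E3 => ‖z.2.2‖) (phase t) :=
    (by fun_prop : Continuous fun z : ℝ × E3 × E3 => ‖z.2.2‖).aestronglyMeasurable
  exact (hs.aestronglyMeasurable_f t).mul ((Real.continuous_rpow_const hp).comp_aestronglyMeasurable
    ((continuous_gradNorm.comp_aestronglyMeasurable hD).mul hv))

theorem weightedDissipation_eq (hs : IsGlobalWeakSolution u₀ f₀ u Du f) (t : ℝ) (hp : 0 ≤ p)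
    (b : ℝ) : weightedDissipation p b t u f =
      ∫⁻ z, ENNReal.ofReal ((1 + z.1) ^ b * (f z.1 z.2 * ‖z.2.2 - u z.1 z.2.1‖ ^ p)) ∂phase t := by
  have hm := ((aestronglyMeasurable_weight b (phase t)).mul
    (hs.aestronglyMeasurable_relMoment t hp)).aemeasurable.ennreal_ofReal
  unfold phase at hm ⊢
  refine Eq.trans ?_ (lintegral_prod _ hm).symm
  refine setLIntegral_congr_fun measurableSet_Ioo fun s hs' => ?_
  have h0 : 0 ≤ (1 + s) ^ b := Real.rpow_nonneg (by linarith [hs'.1]) _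
  rw [higherDissipation, relMoment, mul_comm, ← lintegral_const_mul' _ _ ENNReal.ofReal_ne_top]
  refine lintegral_congr fun z => ?_
  rw [← ENNReal.ofReal_mul h0]
  rfl

/-- The `p`-th power undoes the root in `m_p^{1/p}`, leaving a velocity integral that Tonelli merges
with the space-time one. -/
theorem gradMomentNorm_rpow_eq (hs : IsGlobalWeakSolution u₀ f₀ u Du f) (t : ℝ) (hp : 0 < p)
    (γ : ℝ) : gradMomentNorm p γ t Du f ^ p =
      ∫⁻ z, ENNReal.ofReal ((1 + z.1) ^ (p * γ) *
        (f z.1 z.2 * (gradNorm (Du z.1 z.2.1) * ‖z.2.2‖) ^ p)) ∂phase t := by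
  have hm := ((aestronglyMeasurable_weight (p * γ) (phase t)).mul
    (hs.aestronglyMeasurable_grad t hp.le)).aemeasurable.ennreal_ofReal
  refine Eq.trans ?_ (lintegral_phase hm).symm
  rw [gradMomentNorm, eLpNorm_eq_lintegral_rpow_enorm_toReal (by simpa using hp) (by simp),
    ENNReal.toReal_ofReal hp.le, ← ENNReal.rpow_mul, one_div_mul_cancel hp.ne', ENNReal.rpow_one]
  refine lintegral_congr_ae ?_
  filter_upwards [ae_slab_mem t] with z hz
  have hz0 : 0 < 1 + z.1 := by linarith [hz.1]
  have hg := gradNorm_nonneg (Du z.1 z.2)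
  rw [enorm_eq_self, ENNReal.mul_rpow_of_nonneg _ _ hp.le, ← ENNReal.rpow_mul,
    one_div_mul_cancel hp.ne', ENNReal.rpow_one, ENNReal.ofReal_rpow_of_nonneg (by positivity) hp.le,
    moment, ← lintegral_const_mul' _ _ ENNReal.ofReal_ne_top]
  refine lintegral_congr fun v => ?_
  rw [← ENNReal.ofReal_mul (by positivity)]
  congr 1
  simp only [Pi.mul_apply]
  rw [Real.mul_rpow (by positivity) hg, Real.mul_rpow hg (norm_nonneg _), ← Real.rpow_mul hz0.le,
    mul_comm γ p]
  ring

theorem ae_lintegral_eq_density (hs : IsGlobalWeakSolution u₀ f₀ u Du f) (t : ℝ) :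
    ∀ᵐ y ∂slab t, ∫⁻ v, ENNReal.ofReal (f y.1 (y.2, v)) = ENNReal.ofReal (density f y.1 y.2) := by
  have hmp := measurePreserving_assoc_phase t
  have hi := (hmp.integrable_comp_emb (MeasurableEquiv.measurableEmbedding _)).2 (hs.integrable_f t)
  have h0 := Measure.ae_ae_of_ae_prod (hmp.quasiMeasurePreserving.ae (hs.ae_nonneg_f t))
  filter_upwards [hi.prod_right_ae, h0] with y h1 h2
  exact (ofReal_integral_eq_lintegral_ofReal h1 h2).symm

/-- The time derivative does not depend on `v`, so integrating `f` in velocity leaves `ρ_f`, which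
is bounded by its essential supremum. -/
theorem lintegral_timeDeriv_le (hs : IsGlobalWeakSolution u₀ f₀ u Du f) (hp : 0 < p) (γ : ℝ)
    (hw : AEStronglyMeasurable w (slab t)) :
    ∫⁻ z, ENNReal.ofReal ((1 + z.1) ^ (p * γ) * (f z.1 z.2 * ‖w (z.1, z.2.1)‖ ^ p)) ∂phase t
      ≤ densityNorm t f *
        eLpNorm (fun z : ℝ × E3 => ((1 + z.1) ^ γ : ℝ) • w z) (ENNReal.ofReal p) (slab t) ^ p := by
  have hm := ((aestronglyMeasurable_weight (p * γ) (phase t)).mul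
    (hs.aestronglyMeasurable_slab_mul hw hp.le)).aemeasurable.ennreal_ofReal
  have hwm : AEMeasurable (fun z : ℝ × E3 => ‖((1 + z.1) ^ γ : ℝ) • w z‖ₑ ^ p) (slab t) :=
    ((((measurable_fst.const_add 1).pow_const γ).aestronglyMeasurable).smul hw).enorm.pow_const p
  refine (le_of_eq (lintegral_phase hm)).trans ?_
  rw [eLpNorm_eq_lintegral_rpow_enorm_toReal (by simpa using hp) (by simp),
    ENNReal.toReal_ofReal hp.le, ← ENNReal.rpow_mul, one_div_mul_cancel hp.ne', ENNReal.rpow_one,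
    ← lintegral_const_mul'' _ hwm]
  refine lintegral_mono_ae ?_
  have hd : ∀ᵐ y ∂slab t, ‖density f y.1 y.2‖ₑ ≤ densityNorm t f := by
    unfold densityNorm
    rw [eLpNorm_exponent_top]
    exact ae_le_eLpNormEssSup
  filter_upwards [ae_slab_mem t, hs.ae_lintegral_eq_density t, hd] with y hy h1 h2
  have hy0 : 0 < 1 + y.1 := by linarith [hy.1]
  have e1 : ∀ v, ENNReal.ofReal ((1 + y.1) ^ (p * γ) * (f y.1 (y.2, v) * ‖w y‖ ^ p))
      = ENNReal.ofReal (f y.1 (y.2, v)) * ‖((1 + y.1) ^ γ : ℝ) • w y‖ₑ ^ p := fun v => by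
    rw [← ofReal_norm, ENNReal.ofReal_rpow_of_nonneg (norm_nonneg _) hp.le, norm_smul,
      Real.norm_of_nonneg (by positivity), Real.mul_rpow (by positivity) (norm_nonneg _),
      ← Real.rpow_mul hy0.le, mul_comm γ p, ← ENNReal.ofReal_mul' (by positivity)]
    congr 1; ring
  calc _ = ∫⁻ v, ENNReal.ofReal (f y.1 (y.2, v)) * ‖((1 + y.1) ^ γ : ℝ) • w y‖ₑ ^ p :=
        lintegral_congr fun v => e1 v
    _ = ENNReal.ofReal (density f y.1 y.2) * ‖((1 + y.1) ^ γ : ℝ) • w y‖ₑ ^ p := by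
        rw [lintegral_mul_const' _ _ (ENNReal.rpow_ne_top_of_nonneg hp.le enorm_ne_top), h1]
    _ ≤ _ := by
        gcongr
        exact (Real.ofReal_le_enorm _).trans h2

/-- A vanishing density contradicts unit mass. This excludes the product `0 * ⊤`, whose value `0`
would make the right-hand side finite with no control on `∂ₛu`. -/
theorem densityNorm_ne_zero (hs : IsGlobalWeakSolution u₀ f₀ u Du f) (ht : 0 < t) :
    densityNorm t f ≠ 0 := by
  intro h
  have hd : ∀ᵐ y ∂slab t, ‖density f y.1 y.2‖ₑ ≤ densityNorm t f := by
    unfold densityNorm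
    rw [eLpNorm_exponent_top]
    exact ae_le_eLpNormEssSup
  have hm := (hs.aestronglyMeasurable_f t).aemeasurable.ennreal_ofReal
  have h1 : ∫⁻ z, ENNReal.ofReal (f z.1 z.2) ∂phase t = 0 := by
    rw [lintegral_phase hm, lintegral_eq_zero_of_ae_eq_zero]
    filter_upwards [hs.ae_lintegral_eq_density t, hd] with y h2 h3
    rw [h2, Pi.zero_apply]
    rw [h] at h3
    have := le_antisymm h3 zero_le
    rw [enorm_eq_zero] at this
    rw [this, ENNReal.ofReal_zero]
  have hi := hs.integrable_f t
  unfold phase at h1 hm hi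
  rw [lintegral_prod _ hm] at h1
  have h2 : ∫⁻ s in Ioo 0 t, ∫⁻ z, ENNReal.ofReal (f s z) = ∫⁻ s in Ioo 0 t, 1 := by
    refine lintegral_congr_ae ?_
    filter_upwards [ae_Ioo_of_Ici t hs.f_mass, ae_restrict_mem measurableSet_Ioo, hi.prod_right_ae]
      with s hs1 hs2 hs3
    rw [← ofReal_integral_eq_lintegral_ofReal hs3 (hs.f_nonneg s hs2.1.le), hs1, ENNReal.ofReal_one]
  rw [h2] at h1
  simp only [lintegral_const, Measure.restrict_apply MeasurableSet.univ, univ_inter,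
    Real.volume_Ioo, sub_zero, one_mul, ENNReal.ofReal_eq_zero] at h1
  linarith

end IsGlobalWeakSolution

theorem integrable_of_lintegral_ofReal_ne_top {α : Type*} [MeasurableSpace α] {μ : Measure α}
    {h : α → ℝ} (hm : AEStronglyMeasurable h μ) (h0 : ∀ᵐ z ∂μ, 0 ≤ h z)
    (hfin : ∫⁻ z, ENNReal.ofReal (h z) ∂μ ≠ ⊤) : Integrable h μ :=
  (lintegral_ofReal_ne_top_iff_integrable hm h0).1 hfin

end Sol

end VNS

/-! ### The inequality in `[0, ∞]` -/

theorem corollary4p4 (p : ℝ) (hp : 2 ≤ p) (γ : ℝ) (k : ℕ) :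
    ∃ C : NNReal, ∀ (u₀ : VNS.E3 → VNS.E3) (f₀ : VNS.E3 × VNS.E3 → ℝ)
      (u : ℝ → VNS.E3 → VNS.E3) (Du : ℝ → VNS.E3 → VNS.E3 →L[ℝ] VNS.E3)
      (f : ℝ → VNS.E3 × VNS.E3 → ℝ),
      VNS.IsAdmissible u₀ f₀ → VNS.IsGlobalWeakSolution u₀ f₀ u Du f →
      ∀ t : ℝ, 0 ≤ t →
        VNS.weightedDissipation p (p * γ) t u f ≤
          C * (VNS.weightedDissipation p (p * γ - k) t u f
            + VNS.densityNorm t f * VNS.timeDerivNorm p γ t u ^ p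
            + VNS.gradMomentNorm p γ t Du f ^ p
            + VNS.relMoment p u₀ f₀) := by
  have hp0 : 0 < p := by linarith
  set c₁ : ℝ := |p * γ| * (4 * |p * γ|) ^ k with hc₁
  set c₂ : ℝ := p * 8 ^ (p - 1) with hc₂
  have hc₁0 : 0 ≤ c₁ := by positivity
  have hc₂0 : 0 ≤ c₂ := by positivity
  -- The sum dominates each coefficient: `c₁` from the weight, `c₂` from Young, `1` from the initial
  -- moment. The summand `1` also makes the constant nonzero, so an infinite right-hand side stays
  -- infinite.
  refine ⟨(c₁ + c₂ + 1).toNNReal, fun u₀ f₀ u Du f h₀ hs t ht => ?_⟩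
  change _ ≤ ENNReal.ofReal (c₁ + c₂ + 1) * _
  -- At `t = 0` the density norm is over a null set and may vanish, but the left-hand side is `0`.
  rcases ht.eq_or_lt with rfl | ht
  · simp [VNS.weightedDissipation]
  set Y := VNS.weightedDissipation p (p * γ - k) t u f with hY
  set P := VNS.densityNorm t f * VNS.timeDerivNorm p γ t u ^ p with hP
  set Z := VNS.gradMomentNorm p γ t Du f ^ p with hZ
  set R := VNS.relMoment p u₀ f₀ with hR
  by_cases htop : Y + P + Z + R = ⊤
  · rw [htop, ENNReal.mul_top]
    · exact le_top
    · simp only [ne_eq, ENNReal.ofReal_eq_zero, not_le]; positivity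
  simp only [ENNReal.add_eq_top, not_or] at htop
  obtain ⟨⟨⟨hYf, hPf⟩, hZf⟩, hRf⟩ := htop
  have htd : VNS.timeDerivNorm p γ t u < ⊤ := by
    rw [lt_top_iff_ne_top]
    intro h
    apply hPf
    rw [hP, h, ENNReal.top_rpow_of_pos hp0, ENNReal.mul_top (hs.densityNorm_ne_zero ht)]
  obtain ⟨w, hw, hwn⟩ : ∃ w, ∃ _ : VNS.HasWeakTimeDeriv u t w,
      eLpNorm (fun z : ℝ × VNS.E3 => ((1 + z.1) ^ γ : ℝ) • w z) (ENNReal.ofReal p) (VNS.slab t)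
        < ⊤ := by
    simpa only [VNS.timeDerivNorm, iInf_lt_iff] using htd
  have hwm := hw.aestronglyMeasurable
  have hwi := VNS.integrableOn_ball_of_weighted (by linarith) hwm hwn
  have hPle := hs.lintegral_timeDeriv_le hp0 γ hwm
  rw [← VNS.timeDerivNorm_eq hw, ← hP] at hPle
  have hYe := hs.weightedDissipation_eq t hp0.le (p * γ - k)
  have hXe := hs.weightedDissipation_eq t hp0.le (p * γ)
  have hZe := hs.gradMomentNorm_rpow_eq t hp0 γ
  have hnn : ∀ (b : ℝ) (g : ℝ × VNS.E3 × VNS.E3 → ℝ), (∀ z, 0 ≤ g z) →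
      ∀ᵐ z ∂VNS.phase t, 0 ≤ (1 + z.1) ^ b * (f z.1 z.2 * g z) := fun b g hg => by
    filter_upwards [VNS.ae_phase_mem t, hs.ae_nonneg_f t] with z hz hf
    have : 0 < 1 + z.1 := by linarith [hz.1]
    have := hg z
    positivity
  have mX := hs.aestronglyMeasurable_relMoment t hp0.le
  have mW := hs.aestronglyMeasurable_slab_mul hwm hp0.le
  have mZ := hs.aestronglyMeasurable_grad t hp0.le
  have nX := fun b => hnn b (fun z => ‖z.2.2 - u z.1 z.2.1‖ ^ p) (fun z => by positivity)
  have nW := hnn (p * γ) (fun z => ‖w (z.1, z.2.1)‖ ^ p) (fun z => by positivity)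
  have nZ := hnn (p * γ) (fun z => (VNS.gradNorm (Du z.1 z.2.1) * ‖z.2.2‖) ^ p) (fun z => by
    have := VNS.gradNorm_nonneg (Du z.1 z.2.1)
    positivity)
  have mwt := fun b => VNS.aestronglyMeasurable_weight b (VNS.phase t)
  have jY := VNS.integrable_of_lintegral_ofReal_ne_top ((mwt (p * γ - k)).mul mX) (nX _)
    (by rw [hYe] at hY; exact hY ▸ hYf)
  have jW := VNS.integrable_of_lintegral_ofReal_ne_top ((mwt (p * γ)).mul mW) nW
    (ne_top_of_le_ne_top hPf hPle)
  have jZ := VNS.integrable_of_lintegral_ofReal_ne_top ((mwt (p * γ)).mul mZ) nZ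
    (by rw [hZe] at hZ; exact hZ ▸ hZf)
  -- Finiteness of the lower-order integral `Y` is the source of integrability for the unweighted
  -- and then the fully weighted moment.
  have hI1 := VNS.integrable_of_weight_mul _ jY
  have jX := VNS.integrable_weight_mul hI1 (p * γ)
  have n0 : ∀ᵐ z, 0 ≤ f₀ z * ‖z.2 - u₀ z.1‖ ^ p := by
    filter_upwards [h₀.f_nonneg] with z hz
    positivity
  have hI0 : Integrable fun z : VNS.E3 × VNS.E3 => f₀ z * ‖z.2 - u₀ z.1‖ ^ p := by
    refine VNS.integrable_of_lintegral_ofReal_ne_top ?_ n0 hRf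
    have hu0 : AEStronglyMeasurable (fun z : VNS.E3 × VNS.E3 => u₀ z.1) volume :=
      h₀.u_mem.1.comp_fst
    exact h₀.f_mem_one.1.mul ((Real.continuous_rpow_const hp0.le).comp_aestronglyMeasurable
      (continuous_snd.aestronglyMeasurable.sub hu0).norm)
  have key := VNS.weighted_moment_le h₀ hs hw hwi ht hp hI0 hI1
    (VNS.integrable_of_weight_mul _ jW) (VNS.integrable_of_weight_mul _ jZ) (p * γ) k
  have eX := ofReal_integral_eq_lintegral_ofReal jX (nX (p * γ))
  have eY := ofReal_integral_eq_lintegral_ofReal jY (nX _)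
  have eW := ofReal_integral_eq_lintegral_ofReal jW nW
  have eZ := ofReal_integral_eq_lintegral_ofReal jZ nZ
  have eR := ofReal_integral_eq_lintegral_ofReal hI0 n0
  rw [hXe, ← eX]
  refine (ENNReal.ofReal_le_ofReal key).trans ?_
  have pY := integral_nonneg_of_ae (nX (p * γ - k))
  have pW := integral_nonneg_of_ae nW
  have pZ := integral_nonneg_of_ae nZ
  have pR := integral_nonneg_of_ae n0
  rw [ENNReal.ofReal_add (add_nonneg (mul_nonneg hc₁0 pY) (mul_nonneg hc₂0 (add_nonneg pW pZ))) pR,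
    ENNReal.ofReal_add (mul_nonneg hc₁0 pY) (mul_nonneg hc₂0 (add_nonneg pW pZ)),
    ENNReal.ofReal_mul hc₁0, ENNReal.ofReal_mul hc₂0, ENNReal.ofReal_add pW pZ]
  have fY : ENNReal.ofReal (∫ z, (1 + z.1) ^ (p * γ - k) *
      (f z.1 z.2 * ‖z.2.2 - u z.1 z.2.1‖ ^ p) ∂VNS.phase t) ≤ Y := by
    rw [hY, hYe]; exact eY.le
  have fW : ENNReal.ofReal (∫ z, (1 + z.1) ^ (p * γ) * (f z.1 z.2 * ‖w (z.1, z.2.1)‖ ^ p)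
      ∂VNS.phase t) ≤ P := eW.le.trans hPle
  have fZ : ENNReal.ofReal (∫ z, (1 + z.1) ^ (p * γ) *
      (f z.1 z.2 * (VNS.gradNorm (Du z.1 z.2.1) * ‖z.2.2‖) ^ p) ∂VNS.phase t) ≤ Z := by
    rw [hZ, hZe]; exact eZ.le
  have fR : ENNReal.ofReal (∫ z, f₀ z * ‖z.2 - u₀ z.1‖ ^ p) ≤ R := eR.le
  set K := ENNReal.ofReal (c₁ + c₂ + 1)
  have k1 : ENNReal.ofReal c₁ ≤ K := ENNReal.ofReal_le_ofReal (by linarith)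
  have k2 : ENNReal.ofReal c₂ ≤ K := ENNReal.ofReal_le_ofReal (by linarith)
  have k3 : 1 ≤ K := by
    rw [← ENNReal.ofReal_one]; exact ENNReal.ofReal_le_ofReal (by linarith)
  calc _ ≤ K * Y + K * (P + Z) + 1 * R := by
        rw [one_mul]
        exact add_le_add (add_le_add (mul_le_mul' k1 fY) (mul_le_mul' k2 (add_le_add fW fZ))) fR
    _ ≤ K * Y + K * (P + Z) + K * R := add_le_add le_rfl (mul_le_mul' k3 le_rfl)
    _ = K * (Y + P + Z + R) := by ring
end
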